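/- Let $S^3=\{(x,y,z,w)\in\mathbb R^4: x^2+y^2+z^2+w^2=1\}$ carry the round metric, with toroidal coordinates $x=\cos\chi\cos\theta$, $y=\cos\chi\sin\theta$, $z=\sin\chi\cos\varphi$, $w=\sin\chi\sin\varphi$ $(0\le\chi\le\pi/2)$. For integers $k\ge 0$, $\ell$, $m$ with $|\ell|+|m|\le k$ and $\ell+m\equiv k\pmod 2$ (we then say that $\Psi_{k\ell m}$ exists) put $d=d_{k\ell m}=\frac{k-(|\ell|+|m|)}{2}$ and $$\Psi_{k\ell m}=\frac{\cos^{|\ell|}\chi\,\sin^{|m|}\chi\;P_d^{(|m|,|\ell|)}(\cos 2\chi)\,\Theta_\ell(\theta)\,\Phi_m(\varphi)}{\sqrt{2^{\hat\ell+\hat m}}\;\pi\,\sqrt{\dfrac{(|\ell|+d)!\,(|m|+d)!}{2(k+1)\,d!\,(|\ell|+|m|+d)!}}},$$ where $P_d^{(a,b)}(u)=2^{-d}\sum_{i=0}^{d}\binom{a+d}{i}\binom{b+d}{d-i}(u+1)^i(u-1)^{d-i}$ is the Jacobi polynomial, $\Theta_j(t)=\Phi_j(t)=\cos(|j|t)$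 for $j\ge 0$ and $\sin(|j|t)$ for $j<0$, and $\hat\jmath=1$ if $j=0$, $\hat\jmath=0$ otherwise. Let $\sigma_{k\ell m}=\pm1$ be the product of four signs, which are $+$ if and only if, respectively, $d$ is even, $\ell\ge 0$, $m\ge 0$, $m$ is even. Let $n\ge 1$ and let $D^*_n$, the binary dihedral group of order $4n$, be the group of isometries of $S^3$ generated by $(\chi,\theta,\varphi)\mapsto(\chi,\theta+\frac{2\pi}{2n},\varphi+\frac{2\pi}{2n})$ and $(\chi,\theta,\varphi)\mapsto(\frac{\pi}{2}-\chi,-\varphi,\pi-\theta)$. Functions on the prism space $S^3/D^*_n$ are identified with their lifts, the $D^*_n$-invariant functions on $S^3$, and are given the inner product $\int_{S^3}fg\,dV$ of their lifts. **Theorem 3.** Every eigenvalue of the Laplacian $\nabla^2$ on (real, smooth functions on) $S^3/D^*_n$ is of the form $-k(k+2)$ with an integer $k\ge 0$. For every integer $k\ge 0$ the eigenspace $\{f:\nabla^2 f=-k(k+2)f\}$ of $S^3/D_n^*$ has an orthonormal basis whose lifts to $S^3$ are exactly the following functions, each of them being listed when its condition holds and the modes $\Psi$ in it exist (where $\ell\geq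 1$ in items 2-6, and $\ell>m\ge1$, so that each unordered pair of distinct positive integers occurs once, in items 7-10): 1. $\Psi_{k,0,0}$, if $k\equiv 0\pmod 4$; 2. $\sqrt{\tfrac12}(\Psi_{k,\ell,0}+\Psi_{k,0,\ell})$ and $\sqrt{\tfrac12}(\Psi_{k,-\ell,0}-\Psi_{k,0,-\ell})$, if $\ell\equiv 0\pmod{2n}$ and $d_{k\ell 0}$ is even; 3. $\sqrt{\tfrac12}(\Psi_{k,\ell,0}-\Psi_{k,0,\ell})$ and $\sqrt{\tfrac12}(\Psi_{k,-\ell,0}+\Psi_{k,0,-\ell})$, if $\ell\equiv 0\pmod{2n}$ and $d_{k\ell 0}$ is odd; 4. $\sqrt{\tfrac12}(\Psi_{k,\ell,\ell}+\Psi_{k,-\ell,-\ell})$ and $\sqrt{\tfrac12}(\Psi_{k,-\ell,\ell}-\Psi_{k,\ell,-\ell})$, if $k\equiv 0\pmod 4$; 5. $\sqrt{\tfrac12}(\Psi_{k,\ell,\ell}-\Psi_{k,-\ell,-\ell})$, if $2\ell\equiv 0\pmod{2n}$ and $k\equiv 0\pmod 4$; 6. $\sqrt{\tfrac12}(\Psi_{k,-\ell,\ell}+\Psi_{k,\ell,-\ell})$,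 if $2\ell\equiv 0\pmod{2n}$ and $k\equiv 2\pmod 4$; 7. $\tfrac12((\Psi_{k,\ell,m}+\Psi_{k,-\ell,-m})+(\Psi_{k,m,\ell}+\Psi_{k,-m,-\ell}))$ and $\tfrac12((\Psi_{k,\ell,-m}-\Psi_{k,-\ell,m})-(\Psi_{k,-m,\ell}-\Psi_{k,m,-\ell}))$, if $\ell\equiv m\pmod{2n}$ and $\sigma_{k\ell m}>0$; 8. $\tfrac12((\Psi_{k,\ell,m}+\Psi_{k,-\ell,-m})-(\Psi_{k,m,\ell}+\Psi_{k,-m,-\ell}))$ and $\tfrac12((\Psi_{k,\ell,-m}-\Psi_{k,-\ell,m})+(\Psi_{k,-m,\ell}-\Psi_{k,m,-\ell}))$, if $\ell\equiv m\pmod{2n}$ and $\sigma_{k\ell m}<0$; 9. $\tfrac12((\Psi_{k,\ell,m}-\Psi_{k,-\ell,-m})+(\Psi_{k,m,\ell}-\Psi_{k,-m,-\ell}))$ and $\tfrac12((\Psi_{k,\ell,-m}+\Psi_{k,-\ell,m})-(\Psi_{k,-m,\ell}+\Psi_{k,m,-\ell}))$, if $\ell\equiv -m\pmod{2n}$ and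 $\sigma_{k\ell m}>0$; 10. $\tfrac12((\Psi_{k,\ell,m}-\Psi_{k,-\ell,-m})-(\Psi_{k,m,\ell}-\Psi_{k,-m,-\ell}))$ and $\tfrac12((\Psi_{k,\ell,-m}+\Psi_{k,-\ell,m})+(\Psi_{k,-m,\ell}+\Psi_{k,m,-\ell}))$, if $\ell\equiv -m\pmod{2n}$ and $\sigma_{k\ell m}<0$. -/

import Mathlib

open scoped Manifold ContDiff

noncomputable section

namespace Prism

/-- Euclidean 4-space, with coordinates `(x, y, z, w) = (x 0, x 1, x 2, x 3)`. -/
abbrev E4 : Type := EuclideanSpace ℝ (Fin 4)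

/-- The unit 3-sphere in Euclidean 4-space. -/
abbrev S3 : Type := Metric.sphere (0 : E4) 1

instance factFinrankE4 : Fact (Module.finrank ℝ E4 = 3 + 1) := ⟨by simp⟩

/-! ### The Laplacian of the round 3-sphere -/

/-- The extension of a function on the sphere to `E4` that is constant along open rays from the
origin (and has the irrelevant value `0` at the origin). -/
def radialExt {F : Type} [Zero F] (f : S3 → F) (x : E4) : F :=
  open Classical in
  if h : x ≠ 0 then
    f ⟨‖x‖⁻¹ • x, by
      rw [mem_sphere_zero_iff_norm, norm_smul, norm_inv, norm_norm]
      exact inv_mul_cancel₀ (norm_ne_zero_iff.mpr h)⟩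
  else 0

/-- The Riemannian gradient of a function on the round sphere, as a vector field tangent to the
sphere with values in `E4`. The radially constant extension has no normal derivative, so its
Euclidean gradient at a point of the sphere is tangent to the sphere. -/
def sphereGradient (f : S3 → ℝ) (p : S3) : E4 :=
  gradient (radialExt f) (p : E4)

/-- The Riemannian divergence of a vector field tangent to the round sphere: the trace of its
derivative along the sphere (the radially constant extension contributes nothing in the normal
direction). -/
def sphereDivergence (V : S3 → E4) (p : S3) : ℝ :=
  LinearMap.trace ℝ E4 (fderiv ℝ (radialExt V) (p : E4) : E4 →ₗ[ℝ] E4)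

/-- The Laplacian of the round 3-sphere, the divergence of the gradient. -/
def sphereLaplacian (f : S3 → ℝ) (p : S3) : ℝ :=
  sphereDivergence (sphereGradient f) p

/-- The `L²` inner product of real functions on the 3-sphere, for the usual surface measure
(of total mass `2 π²`). -/
def sphereInner (f g : S3 → ℝ) : ℝ :=
  ∫ p, f p * g p ∂((MeasureTheory.volume : MeasureTheory.Measure E4).toSphere)

/-! ### Toroidal coordinates -/

/-- The point of `E4` with toroidal coordinates `(χ, θ, φ)`. -/
def toroidal (χ θ φ : ℝ) : E4 :=
  !₂[Real.cos χ * Real.cos θ, Real.cos χ * Real.sin θ,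
     Real.sin χ * Real.cos φ, Real.sin χ * Real.sin φ]

/-- The coordinate `χ ∈ [0, π/2]` of a point of the sphere. -/
def chi (p : S3) : ℝ := Real.arccos ‖(⟨p.1 0, p.1 1⟩ : ℂ)‖

/-- The coordinate `θ` of a point of the sphere, in `(-π, π]` (and `0` where it is undefined). -/
def theta (p : S3) : ℝ := Complex.arg ⟨p.1 0, p.1 1⟩

/-- The coordinate `φ` of a point of the sphere, in `(-π, π]` (and `0` where it is undefined). -/
def phi (p : S3) : ℝ := Complex.arg ⟨p.1 2, p.1 3⟩

/-- Every point of the sphere is the point with its own toroidal coordinates. -/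
theorem toroidal_coordinates (p : S3) : toroidal (chi p) (theta p) (phi p) = p.1 := by
  have hp : p.1 0 ^ 2 + p.1 1 ^ 2 + p.1 2 ^ 2 + p.1 3 ^ 2 = 1 := by
    have h : ‖p.1‖ = 1 := mem_sphere_zero_iff_norm.mp p.2
    have h2 : ‖p.1‖ ^ 2 = 1 := by rw [h]; norm_num
    rw [EuclideanSpace.norm_sq_eq] at h2
    simpa [Fin.sum_univ_four] using h2
  have n1 : ‖(⟨p.1 0, p.1 1⟩ : ℂ)‖ ^ 2 = p.1 0 ^ 2 + p.1 1 ^ 2 := by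
    rw [← Complex.normSq_eq_norm_sq, Complex.normSq_mk]; ring
  have n2 : ‖(⟨p.1 2, p.1 3⟩ : ℂ)‖ ^ 2 = p.1 2 ^ 2 + p.1 3 ^ 2 := by
    rw [← Complex.normSq_eq_norm_sq, Complex.normSq_mk]; ring
  have hc : Real.cos (chi p) = ‖(⟨p.1 0, p.1 1⟩ : ℂ)‖ := by
    apply Real.cos_arccos
    · linarith [norm_nonneg (⟨p.1 0, p.1 1⟩ : ℂ)]
    · nlinarith [sq_nonneg (p.1 2), sq_nonneg (p.1 3)]
  have hs : Real.sin (chi p) = ‖(⟨p.1 2, p.1 3⟩ : ℂ)‖ := by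
    rw [chi, Real.sin_arccos, n1, ← Real.sqrt_sq (norm_nonneg (⟨p.1 2, p.1 3⟩ : ℂ)), n2]
    congr 1
    linarith
  ext i
  fin_cases i
  · simp [toroidal, hc, theta, Complex.norm_mul_cos_arg]
  · simp [toroidal, hc, theta, Complex.norm_mul_sin_arg]
  · simp [toroidal, hs, phi, Complex.norm_mul_cos_arg]
  · simp [toroidal, hs, phi, Complex.norm_mul_sin_arg]

/-! ### The eigenmodes of the 3-sphere -/

/-- The Jacobi polynomial `P_d^{(a, b)}`. -/
def jacobi (a b d : ℕ) (u : ℝ) : ℝ :=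
  1 / 2 ^ d * ∑ i ∈ Finset.range (d + 1),
    ((a + d).choose i : ℝ) * ((b + d).choose (d - i) : ℝ) * (u + 1) ^ i * (u - 1) ^ (d - i)

/-- The circular harmonics: `cos (|j| t)` for `j ≥ 0` and `sin (|j| t)` for `j < 0`. -/
def circ (j : ℤ) (t : ℝ) : ℝ :=
  if 0 ≤ j then Real.cos ((j.natAbs : ℝ) * t) else Real.sin ((j.natAbs : ℝ) * t)

/-- The mode with labels `k, ℓ, m` exists. -/
def ModeExists (k : ℕ) (ℓ m : ℤ) : Prop :=
  |ℓ| + |m| ≤ (k : ℤ) ∧ ℓ + m ≡ (k : ℤ) [ZMOD 2]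

/-- `d = (k - (|ℓ| + |m|)) / 2`, an exact natural number whenever `ModeExists k ℓ m`. -/
def dNum (k : ℕ) (ℓ m : ℤ) : ℕ := (k - (ℓ.natAbs + m.natAbs)) / 2

/-- `1` if `j = 0` and `0` otherwise. -/
def hat (j : ℤ) : ℕ := if j = 0 then 1 else 0

/-- The unnormalized eigenmode in toroidal coordinates. -/
def psiTilde (k : ℕ) (ℓ m : ℤ) (χ θ φ : ℝ) : ℝ :=
  Real.cos χ ^ ℓ.natAbs * Real.sin χ ^ m.natAbs *
    jacobi m.natAbs ℓ.natAbs (dNum k ℓ m) (Real.cos (2 * χ)) * circ ℓ θ * circ m φ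

/-- The normalizing constant, the `L²` norm of the unnormalized eigenmode. -/
def psiNorm (k : ℕ) (ℓ m : ℤ) : ℝ :=
  Real.sqrt (2 ^ (hat ℓ + hat m)) * Real.pi *
    Real.sqrt (((ℓ.natAbs + dNum k ℓ m).factorial * (m.natAbs + dNum k ℓ m).factorial : ℝ) /
      (2 * ((k : ℝ) + 1) * (dNum k ℓ m).factorial *
        (ℓ.natAbs + m.natAbs + dNum k ℓ m).factorial))

/-- The normalized eigenmode `Ψ_{k ℓ m}` as a function on the sphere. -/
def Psi (k : ℕ) (ℓ m : ℤ) (p : S3) : ℝ :=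
  psiTilde k ℓ m (chi p) (theta p) (phi p) / psiNorm k ℓ m

/-- The sign `σ_{k ℓ m}`. -/
def sigma (k : ℕ) (ℓ m : ℤ) : ℤ :=
  (if Even (dNum k ℓ m) then 1 else -1) * (if 0 ≤ ℓ then 1 else -1) *
    (if 0 ≤ m then 1 else -1) * (if Even m then 1 else -1)

/-! ### The binary dihedral group and the prism space -/

/-- The simultaneous rotation through the angle `t` in the `(x, y)`- and `(z, w)`-planes. -/
def corkscrew (t : ℝ) : E4 ≃ₗᵢ[ℝ] E4 :=
  LinearIsometry.toLinearIsometryEquiv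
    { toFun := fun v =>
        !₂[Real.cos t * v 0 - Real.sin t * v 1, Real.sin t * v 0 + Real.cos t * v 1,
           Real.cos t * v 2 - Real.sin t * v 3, Real.sin t * v 2 + Real.cos t * v 3]
      map_add' := fun u v => by ext i; fin_cases i <;> simp <;> ring
      map_smul' := fun c v => by ext i; fin_cases i <;> simp <;> ring
      norm_map' := fun v => by
        rw [EuclideanSpace.norm_eq, EuclideanSpace.norm_eq]
        congr 1
        simp [Fin.sum_univ_four]
        linear_combination (v 0 ^ 2 + v 1 ^ 2 + v 2 ^ 2 + v 3 ^ 2) * Real.sin_sq_add_cos_sq t }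
    rfl

/-- The isometry `(x, y, z, w) ↦ (z, -w, -x, y)`, of order four. -/
def quarterTurn : E4 ≃ₗᵢ[ℝ] E4 :=
  LinearIsometry.toLinearIsometryEquiv
    { toFun := fun v => !₂[v 2, -v 3, -v 0, v 1]
      map_add' := fun u v => by ext i; fin_cases i <;> simp <;> ring
      map_smul' := fun c v => by ext i; fin_cases i <;> simp
      norm_map' := fun v => by
        rw [EuclideanSpace.norm_eq, EuclideanSpace.norm_eq]
        congr 1
        simp [Fin.sum_univ_four]
        ring }
    rfl

/-- In toroidal coordinates the rotation is `(χ, θ, φ) ↦ (χ, θ + t, φ + t)`. -/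
theorem corkscrew_toroidal (t χ θ φ : ℝ) :
    corkscrew t (toroidal χ θ φ) = toroidal χ (θ + t) (φ + t) := by
  ext i
  fin_cases i <;> simp [corkscrew, toroidal, Real.cos_add, Real.sin_add] <;> ring

/-- In toroidal coordinates the second isometry is `(χ, θ, φ) ↦ (π/2 - χ, -φ, π - θ)`. -/
theorem quarterTurn_toroidal (χ θ φ : ℝ) :
    quarterTurn (toroidal χ θ φ) = toroidal (Real.pi / 2 - χ) (-φ) (Real.pi - θ) := by
  ext i
  fin_cases i <;> simp [quarterTurn, toroidal, Real.cos_pi_div_two_sub, Real.sin_pi_div_two_sub]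

/-- The binary dihedral group `D*_n` (of order `4 n`, for `n ≥ 1`) as a group of isometries. -/
def binaryDihedral (n : ℕ) : Subgroup (E4 ≃ₗᵢ[ℝ] E4) :=
  Subgroup.closure {corkscrew (2 * Real.pi / (2 * (n : ℝ))), quarterTurn}

/-- Two points of the sphere are equivalent if they lie in one orbit of `D*_n`. -/
def orbitSetoid (n : ℕ) : Setoid S3 where
  r p q := ∃ g ∈ binaryDihedral n, g (p : E4) = (q : E4)
  iseqv :=
    { refl := fun _ => ⟨1, one_mem _, rfl⟩
      symm := fun {p q} ⟨g, hg, h⟩ => ⟨g⁻¹, inv_mem hg, by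
        rw [← h]; exact g.symm_apply_apply (p : E4)⟩
      trans := fun {p q r} ⟨g, hg, h⟩ ⟨g', hg', h'⟩ => ⟨g' * g, mul_mem hg' hg, by
        rw [← h', ← h]; rfl⟩ }

/-- The prism space `S³ / D*_n`. -/
def PrismSpace (n : ℕ) : Type := Quotient (orbitSetoid n)

/-- The covering map from the sphere onto the prism space. -/
def proj (n : ℕ) (p : S3) : PrismSpace n := Quotient.mk (orbitSetoid n) p

/-- The lift to the sphere of a function on the prism space. -/
def lift {n : ℕ} (f : PrismSpace n → ℝ) (p : S3) : ℝ := f (proj n p)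

/-- `f` is a smooth function on the prism space with `∇² f = lam f`. The covering map is a local
diffeomorphism and a local isometry, so smoothness and the Laplacian are those of the lift. -/
def IsEigenfunction (n : ℕ) (lam : ℝ) (f : PrismSpace n → ℝ) : Prop :=
  ContMDiff (𝓡 3) 𝓘(ℝ, ℝ) ∞ (lift f) ∧ ∀ p : S3, sphereLaplacian (lift f) p = lam * lift f p

/-! ### The list of basis vectors -/

/-- Labels of the candidate basis vectors, with `ℓ` and `m` natural numbers. -/
inductive Label : Type
  | zero : Label
  | axisEven₁ (ℓ : ℕ) : Label
  | axisEven₂ (ℓ : ℕ) : Label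
  | axisOdd₁ (ℓ : ℕ) : Label
  | axisOdd₂ (ℓ : ℕ) : Label
  | diag₁ (ℓ : ℕ) : Label
  | diag₂ (ℓ : ℕ) : Label
  | diag₃ (ℓ : ℕ) : Label
  | diag₄ (ℓ : ℕ) : Label
  | samePos₁ (ℓ m : ℕ) : Label
  | samePos₂ (ℓ m : ℕ) : Label
  | sameNeg₁ (ℓ m : ℕ) : Label
  | sameNeg₂ (ℓ m : ℕ) : Label
  | oppPos₁ (ℓ m : ℕ) : Label
  | oppPos₂ (ℓ m : ℕ) : Label
  | oppNeg₁ (ℓ m : ℕ) : Label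
  | oppNeg₂ (ℓ m : ℕ) : Label

/-- The basis vector with a given label, for the wave number `k`. -/
def Label.vec (k : ℕ) : Label → S3 → ℝ
  | .zero => Psi k 0 0
  | .axisEven₁ ℓ => √(1 / 2) • (Psi k ℓ 0 + Psi k 0 ℓ)
  | .axisEven₂ ℓ => √(1 / 2) • (Psi k (-ℓ) 0 - Psi k 0 (-ℓ))
  | .axisOdd₁ ℓ => √(1 / 2) • (Psi k ℓ 0 - Psi k 0 ℓ)
  | .axisOdd₂ ℓ => √(1 / 2) • (Psi k (-ℓ) 0 + Psi k 0 (-ℓ))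
  | .diag₁ ℓ => √(1 / 2) • (Psi k ℓ ℓ + Psi k (-ℓ) (-ℓ))
  | .diag₂ ℓ => √(1 / 2) • (Psi k (-ℓ) ℓ - Psi k ℓ (-ℓ))
  | .diag₃ ℓ => √(1 / 2) • (Psi k ℓ ℓ - Psi k (-ℓ) (-ℓ))
  | .diag₄ ℓ => √(1 / 2) • (Psi k (-ℓ) ℓ + Psi k ℓ (-ℓ))
  | .samePos₁ ℓ m =>
      (1 / 2 : ℝ) • ((Psi k ℓ m + Psi k (-ℓ) (-m)) + (Psi k m ℓ + Psi k (-m) (-ℓ)))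
  | .samePos₂ ℓ m =>
      (1 / 2 : ℝ) • ((Psi k ℓ (-m) - Psi k (-ℓ) m) - (Psi k (-m) ℓ - Psi k m (-ℓ)))
  | .sameNeg₁ ℓ m =>
      (1 / 2 : ℝ) • ((Psi k ℓ m + Psi k (-ℓ) (-m)) - (Psi k m ℓ + Psi k (-m) (-ℓ)))
  | .sameNeg₂ ℓ m =>
      (1 / 2 : ℝ) • ((Psi k ℓ (-m) - Psi k (-ℓ) m) + (Psi k (-m) ℓ - Psi k m (-ℓ)))
  | .oppPos₁ ℓ m =>
      (1 / 2 : ℝ) • ((Psi k ℓ m - Psi k (-ℓ) (-m)) + (Psi k m ℓ - Psi k (-m) (-ℓ)))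
  | .oppPos₂ ℓ m =>
      (1 / 2 : ℝ) • ((Psi k ℓ (-m) + Psi k (-ℓ) m) - (Psi k (-m) ℓ + Psi k m (-ℓ)))
  | .oppNeg₁ ℓ m =>
      (1 / 2 : ℝ) • ((Psi k ℓ m - Psi k (-ℓ) (-m)) - (Psi k m ℓ - Psi k (-m) (-ℓ)))
  | .oppNeg₂ ℓ m =>
      (1 / 2 : ℝ) • ((Psi k ℓ (-m) + Psi k (-ℓ) m) + (Psi k (-m) ℓ + Psi k m (-ℓ)))

/-- The range of the labels of the modes `Ψ_{k, ±ℓ, 0}` and `Ψ_{k, 0, ±ℓ}`, and the condition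
under which the first generator fixes them. -/
def AxisCond (n k ℓ : ℕ) : Prop :=
  0 < ℓ ∧ ModeExists k ℓ 0 ∧ (ℓ : ℤ) ≡ 0 [ZMOD 2 * n]

/-- The range of the labels of the modes `Ψ_{k, ±ℓ, ±ℓ}`. -/
def DiagRange (k ℓ : ℕ) : Prop := 0 < ℓ ∧ ModeExists k ℓ ℓ

/-- The range of the labels of the modes `Ψ_{k, ±ℓ, ±m}`, `Ψ_{k, ±m, ±ℓ}` with `ℓ ≠ m` positive;
each unordered pair `{ℓ, m}` is taken once, as `m < ℓ`. -/
def GenericRange (k ℓ m : ℕ) : Prop := 0 < m ∧ m < ℓ ∧ ModeExists k ℓ m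

/-- The condition under which the vector with a given label belongs to the basis. -/
def Label.Cond (n k : ℕ) : Label → Prop
  | .zero => ModeExists k 0 0 ∧ k ≡ 0 [MOD 4]
  | .axisEven₁ ℓ => AxisCond n k ℓ ∧ Even (dNum k ℓ 0)
  | .axisEven₂ ℓ => AxisCond n k ℓ ∧ Even (dNum k ℓ 0)
  | .axisOdd₁ ℓ => AxisCond n k ℓ ∧ Odd (dNum k ℓ 0)
  | .axisOdd₂ ℓ => AxisCond n k ℓ ∧ Odd (dNum k ℓ 0)
  | .diag₁ ℓ => DiagRange k ℓ ∧ k ≡ 0 [MOD 4]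
  | .diag₂ ℓ => DiagRange k ℓ ∧ k ≡ 0 [MOD 4]
  | .diag₃ ℓ => DiagRange k ℓ ∧ (2 * ℓ : ℤ) ≡ 0 [ZMOD 2 * n] ∧ k ≡ 0 [MOD 4]
  | .diag₄ ℓ => DiagRange k ℓ ∧ (2 * ℓ : ℤ) ≡ 0 [ZMOD 2 * n] ∧ k ≡ 2 [MOD 4]
  | .samePos₁ ℓ m => GenericRange k ℓ m ∧ (ℓ : ℤ) ≡ m [ZMOD 2 * n] ∧ 0 < sigma k ℓ m
  | .samePos₂ ℓ m => GenericRange k ℓ m ∧ (ℓ : ℤ) ≡ m [ZMOD 2 * n] ∧ 0 < sigma k ℓ m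
  | .sameNeg₁ ℓ m => GenericRange k ℓ m ∧ (ℓ : ℤ) ≡ m [ZMOD 2 * n] ∧ sigma k ℓ m < 0
  | .sameNeg₂ ℓ m => GenericRange k ℓ m ∧ (ℓ : ℤ) ≡ m [ZMOD 2 * n] ∧ sigma k ℓ m < 0
  | .oppPos₁ ℓ m => GenericRange k ℓ m ∧ (ℓ : ℤ) ≡ -m [ZMOD 2 * n] ∧ 0 < sigma k ℓ m
  | .oppPos₂ ℓ m => GenericRange k ℓ m ∧ (ℓ : ℤ) ≡ -m [ZMOD 2 * n] ∧ 0 < sigma k ℓ m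
  | .oppNeg₁ ℓ m => GenericRange k ℓ m ∧ (ℓ : ℤ) ≡ -m [ZMOD 2 * n] ∧ sigma k ℓ m < 0
  | .oppNeg₂ ℓ m => GenericRange k ℓ m ∧ (ℓ : ℤ) ≡ -m [ZMOD 2 * n] ∧ sigma k ℓ m < 0

end Prism

end

noncomputable section

namespace Prism

open MeasureTheory Set Filter Topology
open scoped Pointwise ComplexConjugate

/-! Write `z = x + iy` and `u = z + iw` for the two complex coordinates (`zFst`, `zSnd`). For each
`d`, `ℓ`, `m` the polynomial `mode d ℓ m` is a combination of monomials in the coordinates and their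
conjugates, of weight `ℓ` in the first coordinate and `m` in the second, homogeneous of degree `|ℓ|
+ |m| + 2d`. Its coefficients are those of a Jacobi polynomial, and their two-term recurrence is
exactly harmonicity. Hence its restriction to the sphere has eigenvalue `-k(k+2)` with `k = |ℓ| +
|m| + 2d` (`IsHarmonicExt.sphereLaplacian_eq`), and each `Psi` is a combination of real or imaginary
parts of modes.

Two analytic facts carry the spectral statements. The Laplacian is symmetric
(`sphereInner_laplacian_comm`), so eigenfunctions with distinct eigenvalues are orthogonal. The
modes are total (`eq_zero_of_integral_mode_eq_zero`): Jacobi polynomials of all degrees span the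
polynomials in the squared modulus of the first coordinate, so on the sphere every monomial is a
combination of modes, and Stone-Weierstrass applies. An eigenfunction whose eigenvalue is not of the
form `-k(k+2)` is therefore orthogonal to everything and vanishes.

The group acts on modes by scalars and a swap. The corkscrew multiplies `mode d ℓ m` by
`exp(i(ℓ+m)π/n)`, and the quarter turn sends it to `(-1)^(d+|m|)` times `mode d (-m) (-ℓ)`. So each
vector of the list is, up to a nonzero factor, a real or imaginary part of a mode added to its
translate by the quarter turn (`Label.vec_eq_symMode`). The conditions in the list say when the mode
is fixed by the corkscrew and the sum does not cancel.

Completeness needs no dimension count. An invariant eigenfunction minus its projection to the listed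
vectors is invariant and orthogonal to them. Its integrals against modes of other degrees vanish by
symmetry of the Laplacian, those with `2n` not dividing `ℓ + m` vanish by the corkscrew, and the
others reduce, by conjugation and the quarter turn, to integrals against listed vectors or to
symmetrizations that are zero. By totality the difference is zero.

Orthonormality of the `Psi` comes from Gaussian integrals over `ℂ × ℂ`, where the two variables
separate, together with a finite-difference evaluation of Jacobi moments. Orthonormality of the list
is then a computation with integer sign vectors. -/

/-- The surface measure on the 3-sphere. -/
abbrev sphereMeasure : Measure S3 := (volume : Measure E4).toSphere

/-! ### Radial extensions, polar coordinates and invariance of the surface measure. -/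

/-- The radial projection onto the sphere, as a function of a nonzero vector. -/
def toS3 (x : E4) (h : x ≠ 0) : S3 := ⟨‖x‖⁻¹ • x, by
  rw [mem_sphere_zero_iff_norm, norm_smul, norm_inv, norm_norm]
  exact inv_mul_cancel₀ (norm_ne_zero_iff.mpr h)⟩

theorem radialExt_of_ne {F : Type} [Zero F] (f : S3 → F) {x : E4} (h : x ≠ 0) :
    radialExt f x = f (toS3 x h) := by
  simp [radialExt, h, toS3]

theorem S3.ne_zero (p : S3) : (p : E4) ≠ 0 := by
  intro h
  have := mem_sphere_zero_iff_norm.mp p.2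
  simp [h] at this

theorem S3.norm_eq (p : S3) : ‖(p : E4)‖ = 1 := mem_sphere_zero_iff_norm.mp p.2

theorem toS3_smul {c : ℝ} (hc : 0 < c) {x : E4} (h : x ≠ 0) (h' : c • x ≠ 0) :
    toS3 (c • x) h' = toS3 x h := by
  ext1
  simp only [toS3, norm_smul, smul_smul, Real.norm_eq_abs, abs_of_pos hc]
  congr 1
  field_simp

theorem radialExt_smul {F : Type} [Zero F] (f : S3 → F) {c : ℝ} (hc : 0 < c) (x : E4) :
    radialExt f (c • x) = radialExt f x := by
  by_cases h : x ≠ 0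
  · have h' : c • x ≠ 0 := smul_ne_zero hc.ne' h
    rw [radialExt_of_ne f h, radialExt_of_ne f h', toS3_smul hc h h']
  · push Not at h
    simp [h]

/-- Integration in polar coordinates. -/
theorem integral_polar (w : ℝ → ℝ) (g : S3 → ℝ) :
    ∫ x : E4, w ‖x‖ * radialExt g x =
      (∫ r in Ioi (0 : ℝ), r ^ 3 * w r) * ∫ p, g p ∂sphereMeasure := by
  have hd : Module.finrank ℝ E4 - 1 = 3 := by simp
  calc
    ∫ x : E4, w ‖x‖ * radialExt g x
      = ∫ x : ({(0)}ᶜ : Set E4), w ‖x.1‖ * radialExt g x.1 ∂((volume : Measure E4).comap Subtype.val) := by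
        rw [integral_subtype_comap (measurableSet_singleton _).compl
          fun x ↦ w ‖x‖ * radialExt g x, restrict_compl_singleton]
    _ = ∫ x : S3 × Ioi (0 : ℝ), w x.2 * g x.1 ∂sphereMeasure.prod (.volumeIoiPow (Module.finrank ℝ E4 - 1)) := by
        rw [← (volume : Measure E4).measurePreserving_homeomorphUnitSphereProd.integral_comp
          (Homeomorph.measurableEmbedding _) (fun x : S3 × Ioi (0 : ℝ) => w x.2 * g x.1)]
        refine integral_congr_ae (.of_forall fun x => ?_)
        have : g ((homeomorphUnitSphereProd E4) x).1 = radialExt g x.1 := by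
          rw [radialExt_of_ne g x.2]
          congr 1
          ext1
          simp [toS3]
        simp only [this, homeomorphUnitSphereProd_apply_snd_coe]
    _ = ∫ x : S3 × Ioi (0 : ℝ), g x.1 * w x.2 ∂sphereMeasure.prod (.volumeIoiPow (Module.finrank ℝ E4 - 1)) := by
        simp only [mul_comm]
    _ = (∫ p, g p ∂sphereMeasure) *
          ∫ r : Ioi (0 : ℝ), w r ∂.volumeIoiPow (Module.finrank ℝ E4 - 1) :=
        integral_prod_mul g (fun r : Ioi (0 : ℝ) => w r)
    _ = _ := by
      rw [mul_comm, hd]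
      congr 1
      simp only [Measure.volumeIoiPow, ENNReal.ofReal]
      rw [integral_withDensity_eq_integral_smul,
        integral_subtype_comap measurableSet_Ioi fun a ↦ Real.toNNReal (a ^ 3) • w a,
        setIntegral_congr_fun measurableSet_Ioi fun x hx ↦ ?_]
      · rw [NNReal.smul_def, Real.coe_toNNReal _ (pow_nonneg hx.out.le _), smul_eq_mul]
      · exact (measurable_subtype_coe.pow_const _).real_toNNReal

/-- The action of a linear isometry on the sphere. -/
def sphereMap (g : E4 ≃ₗᵢ[ℝ] E4) (p : S3) : S3 :=
  ⟨g p, by rw [mem_sphere_zero_iff_norm, g.norm_map]; exact p.norm_eq⟩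

theorem continuous_sphereMap (g : E4 ≃ₗᵢ[ℝ] E4) : Continuous (sphereMap g) :=
  Continuous.subtype_mk (g.continuous.comp continuous_subtype_val) _

/-- The surface measure of `s` is a constant times the volume of the cone `Ioo 0 1 • s`. A linear
isometry maps cones to cones and preserves volume. -/
theorem measurePreserving_sphereMap (g : E4 ≃ₗᵢ[ℝ] E4) :
    MeasurePreserving (sphereMap g) sphereMeasure sphereMeasure := by
  refine ⟨(continuous_sphereMap g).measurable, ?_⟩
  ext s hs
  rw [Measure.map_apply (continuous_sphereMap g).measurable hs, Measure.toSphere_apply' _ hs,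
    Measure.toSphere_apply' _ ((continuous_sphereMap g).measurable hs)]
  congr 1
  rw [← (g.measurePreserving).measure_preimage_emb g.toHomeomorph.measurableEmbedding
    (Ioo (0 : ℝ) 1 • (Subtype.val '' s))]
  congr 1
  ext x
  simp only [Set.mem_smul, mem_preimage, mem_image, exists_exists_and_eq_and]
  constructor
  · rintro ⟨r, hr, p, hp, rfl⟩
    exact ⟨r, hr, _, hp, by simp [sphereMap]⟩
  · rintro ⟨r, hr, p, hp, h⟩
    refine ⟨r, hr, sphereMap g.symm p, ?_, ?_⟩
    · have : sphereMap g (sphereMap g.symm p) = p := by ext1; simp [sphereMap]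
      rwa [this]
    · apply g.injective
      rw [← h]; simp [sphereMap]

theorem integral_comp_sphereMap {F : Type*} [NormedAddCommGroup F] [NormedSpace ℝ F]
    (g : E4 ≃ₗᵢ[ℝ] E4) (f : S3 → F) :
    ∫ p, f (sphereMap g p) ∂sphereMeasure = ∫ p, f p ∂sphereMeasure := by
  refine (measurePreserving_sphereMap g).integral_comp ?_ f
  have hl : Function.LeftInverse (sphereMap g.symm) (sphereMap g) := fun p => by
    ext1; simp [sphereMap]
  have hr : Function.RightInverse (sphereMap g.symm) (sphereMap g) := fun p => by
    ext1; simp [sphereMap]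
  exact (Homeomorph.mk ⟨sphereMap g, sphereMap g.symm, hl, hr⟩ (continuous_sphereMap g)
    (continuous_sphereMap g.symm)).measurableEmbedding

theorem integrable_of_continuous {F : Type*} [NormedAddCommGroup F] {f : S3 → F}
    (hf : Continuous f) : Integrable f sphereMeasure :=
  (integrableOn_univ (μ := sphereMeasure)).mp (hf.continuousOn.integrableOn_compact isCompact_univ)

/-! ### Differential calculus of radially constant extensions. -/

/-- The radially constant extension of a smooth function is smooth away from the origin. -/
theorem contDiffAt_radialExt {f : S3 → ℝ} (hf : ContMDiff (𝓡 3) 𝓘(ℝ, ℝ) ∞ f) {x : E4}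
    (hx : x ≠ 0) : ContDiffAt ℝ ∞ (radialExt f) x := by
  -- Smoothness on the sphere is a statement about manifolds, so the composition with normalization
  -- is formed on the punctured space, viewed as an open submanifold, and only then read as ordinary
  -- smoothness.
  let U : TopologicalSpace.Opens E4 := ⟨{0}ᶜ, isOpen_compl_singleton⟩
  have h1 : ContMDiff 𝓘(ℝ, E4) 𝓘(ℝ, E4) ∞ (fun y : U => ‖(y : E4)‖⁻¹ • (y : E4)) := by
    intro y
    refine (contMDiffAt_subtype_iff (f := fun y : E4 => ‖y‖⁻¹ • y)).mpr ?_
    refine ContDiffAt.contMDiffAt ?_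
    have hy : (y : E4) ≠ 0 := y.2
    exact ((contDiffAt_norm ℝ hy).inv (norm_ne_zero_iff.mpr hy)).smul contDiffAt_id
  have h2 : ContMDiff 𝓘(ℝ, E4) 𝓘(ℝ, ℝ) ∞ (fun y : U => f (toS3 y y.2)) :=
    hf.comp (h1.codRestrict_sphere (fun y => (toS3 y y.2).2))
  have h3 : ContMDiffAt 𝓘(ℝ, E4) 𝓘(ℝ, ℝ) ∞ (fun y : U => radialExt f y) ⟨x, hx⟩ := by
    have : (fun y : U => radialExt f y) = fun y : U => f (toS3 y y.2) :=
      funext fun y => radialExt_of_ne f y.2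
    rw [this]; exact h2 _
  exact (contMDiffAt_subtype_iff.mp h3).contDiffAt

/-- The extension is homogeneous of degree 0, so its derivative has degree -1. The chain rule for a
dilation is unconditional, so differentiability of `V` plays no role. -/
theorem fderiv_radialExt_smul {F : Type} [NormedAddCommGroup F] [NormedSpace ℝ F] (V : S3 → F)
    {c : ℝ} (hc : 0 < c) (x : E4) :
    fderiv ℝ (radialExt V) (c • x) = c⁻¹ • fderiv ℝ (radialExt V) x := by
  have h : (fun y => radialExt V (c • y)) = radialExt V := funext (radialExt_smul V hc)
  have h2 := fderiv_comp_smul (f := radialExt V) (x := x) (c := c) (𝕜 := ℝ)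
  rw [h] at h2
  rw [h2, smul_smul, inv_mul_cancel₀ hc.ne', one_smul]

theorem fderiv_radialExt {F : Type} [NormedAddCommGroup F] [NormedSpace ℝ F] (V : S3 → F)
    {x : E4} (hx : x ≠ 0) :
    fderiv ℝ (radialExt V) x = ‖x‖⁻¹ • fderiv ℝ (radialExt V) (toS3 x hx) := by
  have hn : 0 < ‖x‖ := norm_pos_iff.mpr hx
  conv_lhs => rw [show x = ‖x‖ • (toS3 x hx : E4) by simp [toS3, smul_smul, hn.ne']]
  rw [fderiv_radialExt_smul V hn]

theorem fderiv_radialExt_self {F : Type} [NormedAddCommGroup F] [NormedSpace ℝ F] (V : S3 → F)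
    {x : E4} (hd : DifferentiableAt ℝ (radialExt V) x) : fderiv ℝ (radialExt V) x x = 0 := by
  have h1 : HasDerivAt (fun t : ℝ => radialExt V (x + t • x)) (fderiv ℝ (radialExt V) x x) 0 :=
    hd.hasFDerivAt.hasLineDerivAt x
  have h2 : (fun t : ℝ => radialExt V (x + t • x)) =ᶠ[𝓝 0] fun _ => radialExt V x := by
    filter_upwards [lt_mem_nhds (show (-1 : ℝ) < 0 by norm_num)] with t ht
    rw [show x + t • x = (1 + t) • x by rw [add_smul, one_smul], radialExt_smul V (by linarith)]
  exact (h1.congr_of_eventuallyEq h2.symm).unique (hasDerivAt_const _ _)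

/-- The left side is homogeneous of degree 0 by construction and the Euclidean gradient has degree
-1; the factor `‖x‖` compensates. -/
theorem gradient_radialExt (f : S3 → ℝ) {x : E4} (hx : x ≠ 0) :
    radialExt (sphereGradient f) x = ‖x‖ • gradient (radialExt f) x := by
  rw [radialExt_of_ne _ hx, sphereGradient, gradient, gradient, fderiv_radialExt f hx, map_smulₛₗ,
    smul_smul]
  simp [norm_ne_zero_iff.mpr hx]

theorem trace_fderiv_radialExt (V : S3 → E4) {x : E4} (hx : x ≠ 0) :
    LinearMap.trace ℝ E4 (fderiv ℝ (radialExt V) x : E4 →ₗ[ℝ] E4) =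
      ‖x‖⁻¹ * radialExt (sphereDivergence V) x := by
  rw [radialExt_of_ne _ hx, sphereDivergence, fderiv_radialExt V hx]
  simp

theorem contDiffAt_gradient {h : E4 → ℝ} {x : E4} (hh : ContDiffAt ℝ ∞ h x) :
    ContDiffAt ℝ ∞ (gradient h) x :=
  (InnerProductSpace.toDual ℝ E4).symm.contDiff.contDiffAt.comp x (hh.fderiv_right le_rfl)

theorem contDiffAt_radialExt_sphereGradient {f : S3 → ℝ} {x : E4} (hx : x ≠ 0)
    (hf : ContDiffAt ℝ ∞ (radialExt f) x) :
    ContDiffAt ℝ ∞ (radialExt (sphereGradient f)) x := by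
  have h1 : ContDiffAt ℝ ∞ (fun y => ‖y‖ • gradient (radialExt f) y) x :=
    (contDiffAt_norm ℝ hx).smul (contDiffAt_gradient hf)
  refine h1.congr_of_eventuallyEq ?_
  filter_upwards [isOpen_ne.mem_nhds hx] with y hy using gradient_radialExt f hy

/-! ### The divergence theorem and Green's identity on the sphere. -/

/-- The integral of the divergence of a compactly supported field vanishes. -/
theorem integral_trace_fderiv_eq_zero {X : E4 → E4} (hX : ContDiff ℝ ∞ X)
    (hc : HasCompactSupport X) :
    ∫ x, LinearMap.trace ℝ E4 (fderiv ℝ X x : E4 →ₗ[ℝ] E4) = 0 := by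
  have hcont : Continuous (fderiv ℝ X) := hX.continuous_fderiv (by simp)
  have hint : ∀ v, Integrable (fun x => fderiv ℝ X x v) := fun v =>
    (hcont.clm_apply continuous_const).integrable_of_hasCompactSupport
      ((hc.fderiv ℝ).comp_left (g := fun L : E4 →L[ℝ] E4 => L v) rfl)
  have hz : ∀ v, ∫ x, fderiv ℝ X x v = 0 := by
    intro v
    -- Integration by parts against the constant function 1, whose derivative is zero.
    have := integral_smul_fderiv_eq_neg_fderiv_smul_of_integrable (μ := (volume : Measure E4))
      (f := fun _ => (1 : ℝ)) (g := X) (v := v) (by simp) (by simpa using hint v)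
      (by simpa using hX.continuous.integrable_of_hasCompactSupport hc)
      (fun _ _ => differentiableAt_const _) (fun x _ => hX.differentiable (by simp) x)
    simpa using this
  let b := EuclideanSpace.basisFun (Fin 4) ℝ
  have ht : ∀ x, LinearMap.trace ℝ E4 (fderiv ℝ X x : E4 →ₗ[ℝ] E4) =
      ∑ i, inner ℝ (b i) (fderiv ℝ X x (b i)) := fun x => by
    rw [LinearMap.trace_eq_sum_inner _ b]; rfl
  simp only [ht]
  rw [integral_finsetSum _ fun i _ => (hint (b i)).const_inner (b i)]
  refine Finset.sum_eq_zero fun i _ => ?_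
  rw [integral_inner (hint (b i)), hz, inner_zero_right]

theorem trace_fderiv_smul {φ : E4 → ℝ} {X : E4 → E4} {x : E4} (hφ : DifferentiableAt ℝ φ x)
    (hX : DifferentiableAt ℝ X x) :
    LinearMap.trace ℝ E4 (fderiv ℝ (fun y => φ y • X y) x : E4 →ₗ[ℝ] E4) =
      φ x * LinearMap.trace ℝ E4 (fderiv ℝ X x : E4 →ₗ[ℝ] E4) + fderiv ℝ φ x (X x) := by
  rw [fderiv_fun_smul hφ hX]
  rw [ContinuousLinearMap.toLinearMap_add, map_add]
  congr 1
  · simp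
  · exact LinearMap.trace_smulRight (fderiv ℝ φ x : E4 →ₗ[ℝ] ℝ) (X x)

/-- A smooth bump in the squared radius, supported away from the origin. -/
def radialBump : ContDiffBump (2 : ℝ) := ⟨1 / 2, 1, by norm_num, by norm_num⟩

theorem radialBump_eq_zero {t : ℝ} (h : t ≤ 1 ∨ 3 ≤ t) : radialBump t = 0 := by
  apply radialBump.zero_of_le_dist
  rw [Real.dist_eq]
  show (1 : ℝ) ≤ _
  rcases h with h | h
  · rw [abs_of_neg (by linarith)]; linarith
  · rw [abs_of_pos (by linarith)]; linarith

/-- This is the radial factor of the polar integral in Green's identity. Its positivity allows that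
factor to be cancelled. -/
theorem integral_radialBump_pos : 0 < ∫ r in Ioi (0 : ℝ), r ^ 3 * (radialBump (r ^ 2) * r⁻¹) := by
  have h0 : ∫ r in Ioi (0 : ℝ), r ^ 3 * (radialBump (r ^ 2) * r⁻¹) =
      ∫ r in Ioi (0 : ℝ), r ^ 2 * radialBump (r ^ 2) := by
    refine setIntegral_congr_fun measurableSet_Ioi fun r hr => ?_
    have : r ≠ 0 := ne_of_gt hr
    field_simp
  rw [h0]
  have hcont : Continuous fun r : ℝ => r ^ 2 * radialBump (r ^ 2) :=
    (continuous_pow 2).mul (radialBump.continuous.comp (continuous_pow 2))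
  have hsupp : HasCompactSupport fun r : ℝ => r ^ 2 * radialBump (r ^ 2) := by
    refine HasCompactSupport.intro (isCompact_Icc (a := (-2 : ℝ)) (b := 2)) fun r hr => ?_
    rw [radialBump_eq_zero, mul_zero]
    right
    by_contra h
    push Not at h
    exact hr ⟨by nlinarith, by nlinarith⟩
  have hint := hcont.integrable_of_hasCompactSupport (μ := volume) hsupp
  rw [setIntegral_pos_iff_support_of_nonneg_ae
    (.of_forall fun r => mul_nonneg (sq_nonneg r) radialBump.nonneg) hint.integrableOn]
  -- For `r` in this interval `r ^ 2` lies between 25/16 and 9/4, inside the closed ball of radius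
  -- 1/2 about 2 where the bump equals 1.
  refine lt_of_lt_of_le ?_ (measure_mono (s := Ioo (5 / 4 : ℝ) (3 / 2)) ?_)
  · simp only [Real.volume_Ioo, ENNReal.ofReal_pos]; norm_num
  · intro r hr
    refine ⟨?_, ?_⟩
    · have h1 : radialBump (r ^ 2) = 1 := by
        apply radialBump.one_of_mem_closedBall
        rw [Metric.mem_closedBall, Real.dist_eq, abs_le]
        show -(1 / 2 : ℝ) ≤ _ ∧ _ ≤ (1 / 2 : ℝ)
        constructor <;> nlinarith [hr.1, hr.2]
      have : (0 : ℝ) < r := by linarith [hr.1]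
      simp only [Function.mem_support, h1]
      positivity
    · exact lt_trans (by norm_num) hr.1

/-- The cut-off field whose divergence gives Green's identity. -/
def greenField (f g : S3 → ℝ) (x : E4) : E4 :=
  radialBump (‖x‖ ^ 2) • (radialExt f x • radialExt (sphereGradient g) x -
    radialExt g x • radialExt (sphereGradient f) x)

theorem radialBump_eventually_zero : ∀ᶠ y : E4 in 𝓝 0, radialBump (‖y‖ ^ 2) = 0 := by
  filter_upwards [Metric.ball_mem_nhds (0 : E4) one_pos] with y hy
  apply radialBump_eq_zero
  left
  have : ‖y‖ < 1 := by simpa using hy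
  nlinarith [norm_nonneg y]

theorem greenField_eventually_zero (f g : S3 → ℝ) : greenField f g =ᶠ[𝓝 0] fun _ => 0 := by
  filter_upwards [radialBump_eventually_zero] with y hy
  simp [greenField, hy]

theorem contDiff_greenField {f g : S3 → ℝ} (hf : ContMDiff (𝓡 3) 𝓘(ℝ, ℝ) ∞ f)
    (hg : ContMDiff (𝓡 3) 𝓘(ℝ, ℝ) ∞ g) : ContDiff ℝ ∞ (greenField f g) := by
  rw [contDiff_iff_contDiffAt]
  intro x
  by_cases hx : x = 0
  · subst hx
    exact contDiffAt_const.congr_of_eventuallyEq (greenField_eventually_zero f g)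
  · have hF := contDiffAt_radialExt hf hx
    have hG := contDiffAt_radialExt hg hx
    have hφ : ContDiff ℝ ∞ (fun y : E4 => radialBump (‖y‖ ^ 2)) :=
      radialBump.contDiff.comp (contDiff_norm_sq ℝ)
    exact hφ.contDiffAt.smul ((hF.smul (contDiffAt_radialExt_sphereGradient hx hG)).sub
      (hG.smul (contDiffAt_radialExt_sphereGradient hx hF)))

theorem hasCompactSupport_greenField (f g : S3 → ℝ) : HasCompactSupport (greenField f g) := by
  refine HasCompactSupport.intro (isCompact_closedBall (0 : E4) 2) fun x hx => ?_
  rw [greenField, radialBump_eq_zero, zero_smul]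
  right
  have : 2 < ‖x‖ := by simpa using hx
  nlinarith

theorem fderiv_eq_inner_gradient {f : E4 → ℝ} {x v : E4} :
    fderiv ℝ f x v = inner ℝ (gradient f x) v := by
  rw [gradient, InnerProductSpace.toDual_symm_apply]

/-- The derivative of the cut-off is radial while the spherical gradients are tangential, so the
cut-off contributes no derivative term. The two mixed terms pairing the gradients of `f` and `g`
cancel by symmetry. What remains are the two divergences, each carrying `‖x‖⁻¹` because the
divergence of a field of degree 0 has degree -1. -/
theorem trace_fderiv_greenField {f g : S3 → ℝ} (hf : ContMDiff (𝓡 3) 𝓘(ℝ, ℝ) ∞ f)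
    (hg : ContMDiff (𝓡 3) 𝓘(ℝ, ℝ) ∞ g) (x : E4) :
    LinearMap.trace ℝ E4 (fderiv ℝ (greenField f g) x : E4 →ₗ[ℝ] E4) =
      (radialBump (‖x‖ ^ 2) * ‖x‖⁻¹) *
        radialExt (fun p => f p * sphereLaplacian g p - g p * sphereLaplacian f p) x := by
  by_cases hx : x = 0
  · subst hx
    rw [(greenField_eventually_zero f g).fderiv_eq]
    simp
  · have hF := contDiffAt_radialExt hf hx
    have hG := contDiffAt_radialExt hg hx
    have dF := hF.differentiableAt (by simp)
    have dG := hG.differentiableAt (by simp)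
    have dRF := (contDiffAt_radialExt_sphereGradient hx hF).differentiableAt (by simp)
    have dRG := (contDiffAt_radialExt_sphereGradient hx hG).differentiableAt (by simp)
    have dφ : HasFDerivAt (fun y : E4 => radialBump (‖y‖ ^ 2))
        (deriv radialBump (‖x‖ ^ 2) • (2 • innerSL ℝ x)) x :=
      ((radialBump.contDiff (n := 1)).differentiable (by simp) _).hasDerivAt.comp_hasFDerivAt x
        (hasStrictFDerivAt_norm_sq x).hasFDerivAt
    have hself : ∀ h : S3 → ℝ, DifferentiableAt ℝ (radialExt h) x →
        inner ℝ x (radialExt (sphereGradient h) x) = 0 := by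
      intro h hd
      rw [gradient_radialExt h hx, inner_smul_right, real_inner_comm, ← fderiv_eq_inner_gradient,
        fderiv_radialExt_self h hd, mul_zero]
    have hlap : ∀ h : S3 → ℝ, LinearMap.trace ℝ E4
        (fderiv ℝ (radialExt (sphereGradient h)) x : E4 →ₗ[ℝ] E4) =
          ‖x‖⁻¹ * radialExt (sphereLaplacian h) x := fun h =>
      trace_fderiv_radialExt (sphereGradient h) hx
    have e1 : fderiv ℝ (fun y => radialExt f y • radialExt (sphereGradient g) y -
        radialExt g y • radialExt (sphereGradient f) y) x =
        fderiv ℝ (fun y => radialExt f y • radialExt (sphereGradient g) y) x -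
        fderiv ℝ (fun y => radialExt g y • radialExt (sphereGradient f) y) x :=
      fderiv_fun_sub (dF.smul dRG) (dG.smul dRF)
    unfold greenField
    rw [trace_fderiv_smul (X := fun y => radialExt f y • radialExt (sphereGradient g) y -
        radialExt g y • radialExt (sphereGradient f) y) dφ.differentiableAt
        ((dF.smul dRG).sub (dG.smul dRF)), e1,
      ContinuousLinearMap.toLinearMap_sub, map_sub, trace_fderiv_smul dF dRG,
      trace_fderiv_smul dG dRF, dφ.fderiv, hlap, hlap]
    have e2 : fderiv ℝ (radialExt f) x (radialExt (sphereGradient g) x) =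
        fderiv ℝ (radialExt g) x (radialExt (sphereGradient f) x) := by
      rw [fderiv_eq_inner_gradient, fderiv_eq_inner_gradient, gradient_radialExt f hx,
        gradient_radialExt g hx, inner_smul_right, inner_smul_right, real_inner_comm]
    have e3 : (deriv radialBump (‖x‖ ^ 2) • (2 • innerSL ℝ x))
        (radialExt f x • radialExt (sphereGradient g) x -
          radialExt g x • radialExt (sphereGradient f) x) = 0 := by
      simp [inner_sub_right, inner_smul_right, hself f dF, hself g dG]
    rw [e2, e3]
    simp only [radialExt_of_ne _ hx]
    ring

/-- Green's identity: the Laplacian of the sphere is symmetric. -/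
theorem sphereInner_laplacian_comm {f g : S3 → ℝ} (hf : ContMDiff (𝓡 3) 𝓘(ℝ, ℝ) ∞ f)
    (hg : ContMDiff (𝓡 3) 𝓘(ℝ, ℝ) ∞ g) :
    ∫ p, (f p * sphereLaplacian g p - g p * sphereLaplacian f p) ∂sphereMeasure = 0 := by
  have h1 := integral_trace_fderiv_eq_zero (contDiff_greenField hf hg)
    (hasCompactSupport_greenField f g)
  simp only [trace_fderiv_greenField hf hg] at h1
  rw [integral_polar (fun r => radialBump (r ^ 2) * r⁻¹)] at h1
  exact (mul_eq_zero.mp h1).resolve_left integral_radialBump_pos.ne'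

/-- Eigenfunctions of the Laplacian with distinct eigenvalues are orthogonal. -/
theorem integral_mul_eq_zero_of_eigenvalue_ne {f g : S3 → ℝ}
    (hf : ContMDiff (𝓡 3) 𝓘(ℝ, ℝ) ∞ f) (hg : ContMDiff (𝓡 3) 𝓘(ℝ, ℝ) ∞ g) {a b : ℝ}
    (ha : ∀ p, sphereLaplacian f p = a * f p) (hb : ∀ p, sphereLaplacian g p = b * g p)
    (hab : a ≠ b) : ∫ p, f p * g p ∂sphereMeasure = 0 := by
  have h := sphereInner_laplacian_comm hf hg
  have h2 : ∀ p, f p * sphereLaplacian g p - g p * sphereLaplacian f p = (b - a) * (f p * g p) :=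
    fun p => by rw [ha, hb]; ring
  simp only [h2] at h
  rw [integral_const_mul] at h
  exact (mul_eq_zero.mp h).resolve_left (sub_ne_zero.mpr hab.symm)

/-! ### Homogeneous harmonic functions and their eigenvalue. -/

/-- Restrictions to the sphere of smooth harmonic functions, homogeneous of degree `k`. -/
structure IsHarmonicExt (k : ℕ) (h : E4 → ℝ) : Prop where
  contDiff : ContDiff ℝ ∞ h
  homogeneous : ∀ (c : ℝ) (x : E4), 0 < c → h (c • x) = c ^ k * h x
  harmonic : ∀ x, LinearMap.trace ℝ E4 (fderiv ℝ (gradient h) x : E4 →ₗ[ℝ] E4) = 0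

theorem hasFDerivAt_norm_sphere (p : S3) :
    HasFDerivAt (fun x : E4 => ‖x‖) (innerSL ℝ (p : E4)) (p : E4) := by
  have h1 := (hasStrictFDerivAt_norm_sq (p : E4)).hasFDerivAt.sqrt (by simp [p.norm_eq])
  have h2 : (fun x : E4 => √(‖x‖ ^ 2)) = fun x => ‖x‖ :=
    funext fun x => Real.sqrt_sq (norm_nonneg x)
  rw [h2] at h1
  have h3 : (1 / (2 * √(‖(p : E4)‖ ^ 2))) • 2 • innerSL ℝ (p : E4) = innerSL ℝ (p : E4) := by
    ext v
    simp [p.norm_eq]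
  rwa [h3] at h1

theorem hasFDerivAt_inv_norm_pow (p : S3) (m : ℕ) :
    HasFDerivAt (fun x : E4 => (‖x‖⁻¹) ^ m) (-(m : ℝ) • innerSL ℝ (p : E4)) (p : E4) := by
  have h1 : HasDerivAt (fun r : ℝ => (r⁻¹) ^ m) (-(m : ℝ)) ‖(p : E4)‖ := by
    rw [p.norm_eq]
    simpa using (hasDerivAt_inv (one_ne_zero (α := ℝ))).fun_pow m
  exact h1.comp_hasFDerivAt (p : E4) (hasFDerivAt_norm_sphere p)

namespace IsHarmonicExt

variable {k : ℕ} {h : E4 → ℝ}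

/-- Euler's identity, from differentiating along the ray through `p`. -/
theorem fderiv_self (H : IsHarmonicExt k h) (p : E4) : fderiv ℝ h p p = k * h p := by
  have h1 : HasDerivAt (fun t : ℝ => h (p + t • p)) (fderiv ℝ h p p) 0 :=
    (H.contDiff.differentiable (by simp) p).hasFDerivAt.hasLineDerivAt p
  have h2 : (fun t : ℝ => h (p + t • p)) =ᶠ[𝓝 0] fun t => (1 + t) ^ k * h p := by
    filter_upwards [lt_mem_nhds (show (-1 : ℝ) < 0 by norm_num)] with t ht
    rw [show p + t • p = (1 + t) • p by rw [add_smul, one_smul], H.homogeneous _ _ (by linarith)]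
  have h3 : HasDerivAt (fun t : ℝ => (1 + t) ^ k * h p) (k * h p) 0 := by
    have := (((hasDerivAt_id (0 : ℝ)).const_add 1).fun_pow k).mul_const (h p)
    simpa using this
  exact (h1.congr_of_eventuallyEq h2.symm).unique h3

theorem gradient_smul (H : IsHarmonicExt k h) {c : ℝ} (hc : 0 < c) (x : E4) :
    c • gradient h (c • x) = c ^ k • gradient h x := by
  have h1 : (fun y => h (c • y)) = fun y => c ^ k * h y :=
    funext fun y => H.homogeneous c y hc
  have h2 := fderiv_comp_smul (f := h) (x := x) (c := c) (𝕜 := ℝ)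
  rw [h1, fderiv_const_mul (H.contDiff.differentiable (by simp) x)] at h2
  rw [gradient, gradient, ← map_smul, ← h2, map_smul]

theorem radialExt_eq (H : IsHarmonicExt k h) {x : E4} (hx : x ≠ 0) :
    radialExt (fun p : S3 => h p) x = (‖x‖⁻¹) ^ k * h x := by
  rw [radialExt_of_ne _ hx]
  exact H.homogeneous _ _ (inv_pos.mpr (norm_pos_iff.mpr hx))

/-- The spherical gradient is the tangential part of the Euclidean one, whose normal component on
the sphere is `k * h p` by Euler's identity. Here it appears from the product rule for `‖x‖⁻¹ ^ k *
h x`. -/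
theorem sphereGradient_eq (H : IsHarmonicExt k h) (p : S3) :
    sphereGradient (fun p : S3 => h p) p = gradient h p - (k * h p) • (p : E4) := by
  have h1 : radialExt (fun p : S3 => h p) =ᶠ[𝓝 (p : E4)] fun x => (‖x‖⁻¹) ^ k * h x := by
    filter_upwards [isOpen_ne.mem_nhds p.ne_zero] with x hx using H.radialExt_eq hx
  have h2 := (hasFDerivAt_inv_norm_pow p k).mul
    (H.contDiff.differentiable (by simp) (p : E4)).hasFDerivAt
  rw [sphereGradient, gradient, h1.fderiv_eq]
  erw [h2.fderiv]
  apply (InnerProductSpace.toDual ℝ E4).injective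
  ext v
  simp [p.norm_eq, gradient]
  ring

/-- An explicit formula off the origin, of total degree 0, to which the product rule for the
divergence can be applied. -/
theorem radialExt_gradient_eq (H : IsHarmonicExt k h) {x : E4} (hx : x ≠ 0) :
    radialExt (sphereGradient (fun p : S3 => h p)) x =
      (‖x‖⁻¹) ^ (k + 1) • (‖x‖ ^ 2 • gradient h x - (k * h x) • x) := by
  have hn : 0 < ‖x‖ := norm_pos_iff.mpr hx
  have hi : 0 < ‖x‖⁻¹ := inv_pos.mpr hn
  rw [radialExt_of_ne _ hx, H.sphereGradient_eq]
  have h1 := H.gradient_smul hi x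
  have h2 : gradient h (‖x‖⁻¹ • x) = ‖x‖ • (‖x‖⁻¹ ^ k • gradient h x) := by
    rw [← h1, smul_smul, mul_inv_cancel₀ hn.ne', one_smul]
  simp only [toS3]
  rw [h2, H.homogeneous _ _ hi, smul_sub, smul_smul, smul_smul, smul_smul, smul_smul]
  congr 2
  · rw [pow_succ]; field_simp
  · rw [pow_succ]; field_simp

/-- A spherical harmonic of degree `k` has Laplace eigenvalue `-k (k + 2)`. -/
theorem sphereLaplacian_eq (H : IsHarmonicExt k h) (p : S3) :
    sphereLaplacian (fun p : S3 => h p) p = -((k : ℝ) * (k + 2)) * h p := by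
  have h1 : radialExt (sphereGradient (fun p : S3 => h p)) =ᶠ[𝓝 (p : E4)] fun x =>
      (‖x‖⁻¹) ^ (k + 1) • (‖x‖ ^ 2 • gradient h x - (k * h x) • x) := by
    filter_upwards [isOpen_ne.mem_nhds p.ne_zero] with x hx using H.radialExt_gradient_eq hx
  have dh : DifferentiableAt ℝ h p := H.contDiff.differentiable (by simp) _
  have dg : DifferentiableAt ℝ (gradient h) p :=
    (contDiffAt_gradient H.contDiff.contDiffAt).differentiableAt (by simp)
  have dn := (hasStrictFDerivAt_norm_sq (p : E4)).hasFDerivAt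
  have dk : DifferentiableAt ℝ (fun x => k * h x) (p : E4) := dh.const_mul _
  have d1 : DifferentiableAt ℝ (fun x : E4 => ‖x‖ ^ 2 • gradient h x) p := dn.differentiableAt.smul dg
  have d2 : DifferentiableAt ℝ (fun x : E4 => (k * h x) • x) p := dk.smul differentiableAt_id
  have e1 : fderiv ℝ (fun x : E4 => ‖x‖ ^ 2 • gradient h x - (k * h x) • x) p =
      fderiv ℝ (fun x : E4 => ‖x‖ ^ 2 • gradient h x) p - fderiv ℝ (fun x : E4 => (k * h x) • x) p :=
    fderiv_fun_sub d1 d2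
  have hpg : inner ℝ (p : E4) (gradient h p) = k * h p := by
    rw [real_inner_comm, ← fderiv_eq_inner_gradient, H.fderiv_self]
  have e2 := trace_fderiv_smul (x := (p : E4)) (φ := fun x => k * h x) (X := id) dk
    differentiableAt_id
  rw [fderiv_const_mul dh] at e2
  simp only [id] at e2
  -- On the sphere the bracket is tangent, so the derivative of the prefactor contributes 0. The
  -- divergence of `‖x‖ ^ 2 • gradient h` is `2 k h`, by harmonicity and Euler, and that of `(k * h
  -- x) • x` is `4 k h + k ^ 2 h`. The difference is `-k (k + 2) h`.
  rw [sphereLaplacian, sphereDivergence, h1.fderiv_eq,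
    trace_fderiv_smul (X := fun x : E4 => ‖x‖ ^ 2 • gradient h x - (k * h x) • x)
      (hasFDerivAt_inv_norm_pow p (k + 1)).differentiableAt (d1.sub d2),
    e1, (hasFDerivAt_inv_norm_pow p (k + 1)).fderiv, ContinuousLinearMap.toLinearMap_sub, map_sub,
    trace_fderiv_smul (φ := fun x : E4 => ‖x‖ ^ 2) dn.differentiableAt dg, H.harmonic, dn.fderiv, e2]
  simp [p.norm_eq, inner_sub_right, inner_smul_right, hpg, H.fderiv_self]
  ring

theorem contMDiff (H : IsHarmonicExt k h) : ContMDiff (𝓡 3) 𝓘(ℝ, ℝ) ∞ (fun p : S3 => h p) :=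
  H.contDiff.contMDiff.comp contMDiff_coe_sphere

theorem add {g : E4 → ℝ} (H : IsHarmonicExt k h) (G : IsHarmonicExt k g) :
    IsHarmonicExt k (h + g) where
  contDiff := H.contDiff.add G.contDiff
  homogeneous c x hc := by
    simp only [Pi.add_apply, H.homogeneous c x hc, G.homogeneous c x hc]; ring
  harmonic x := by
    have e : gradient (h + g) = gradient h + gradient g := by
      funext y
      simp only [gradient, Pi.add_apply]
      rw [fderiv_add (H.contDiff.differentiable (by simp) y)
        (G.contDiff.differentiable (by simp) y), map_add]
    rw [e, fderiv_add ((contDiffAt_gradient H.contDiff.contDiffAt).differentiableAt (by simp))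
      ((contDiffAt_gradient G.contDiff.contDiffAt).differentiableAt (by simp)),
      ContinuousLinearMap.toLinearMap_add, map_add, H.harmonic, G.harmonic, add_zero]

theorem const_smul (H : IsHarmonicExt k h) (c : ℝ) : IsHarmonicExt k (c • h) where
  contDiff := contDiff_const.smul H.contDiff
  homogeneous c x hc := by
    simp only [Pi.smul_apply, H.homogeneous c x hc, smul_eq_mul]; ring
  harmonic x := by
    have e : gradient (c • h) = c • gradient h := by
      funext y
      simp only [gradient, Pi.smul_apply]
      rw [fderiv_const_smul (H.contDiff.differentiable (by simp) y), map_smul]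
    rw [e, fderiv_const_smul ((contDiffAt_gradient H.contDiff.contDiffAt).differentiableAt (by simp)),
      ContinuousLinearMap.toLinearMap_smul, map_smul, H.harmonic, smul_zero]

end IsHarmonicExt

/-- The spherical harmonics of degree `k`. -/
def sphericalHarmonics (k : ℕ) : Submodule ℝ (S3 → ℝ) where
  carrier := {f | ∃ h, IsHarmonicExt k h ∧ ∀ p : S3, f p = h p}
  zero_mem' := ⟨0, ⟨contDiff_const, by simp, by
    have e : gradient (0 : E4 → ℝ) = 0 := by
      funext y
      simp [gradient]
    simp [e]⟩, by simp⟩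
  add_mem' := by
    rintro f g ⟨h, H, hf⟩ ⟨h', H', hg⟩
    exact ⟨h + h', H.add H', fun p => by simp [hf p, hg p]⟩
  smul_mem' := by
    rintro c f ⟨h, H, hf⟩
    exact ⟨c • h, H.const_smul c, fun p => by simp [hf p]⟩

theorem contMDiff_of_mem_sphericalHarmonics {k : ℕ} {f : S3 → ℝ} (hf : f ∈ sphericalHarmonics k) :
    ContMDiff (𝓡 3) 𝓘(ℝ, ℝ) ∞ f := by
  obtain ⟨h, H, e⟩ := hf
  obtain rfl : f = fun p : S3 => h p := funext e
  exact H.contMDiff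

theorem sphereLaplacian_of_mem_sphericalHarmonics {k : ℕ} {f : S3 → ℝ}
    (hf : f ∈ sphericalHarmonics k) (p : S3) :
    sphereLaplacian f p = -((k : ℝ) * (k + 2)) * f p := by
  obtain ⟨h, H, e⟩ := hf
  obtain rfl : f = fun p : S3 => h p := funext e
  exact H.sphereLaplacian_eq p

/-! ### Complex coordinates and the harmonic polynomials `mode`. -/

/-- The first complex coordinate `x + i y`. -/
def zFst : E4 →L[ℝ] ℂ :=
  Complex.ofRealCLM ∘L EuclideanSpace.proj 0 +
    Complex.I • (Complex.ofRealCLM ∘L EuclideanSpace.proj 1)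

/-- The second complex coordinate `z + i w`. -/
def zSnd : E4 →L[ℝ] ℂ :=
  Complex.ofRealCLM ∘L EuclideanSpace.proj 2 +
    Complex.I • (Complex.ofRealCLM ∘L EuclideanSpace.proj 3)

theorem zFst_apply (x : E4) : zFst x = x 0 + Complex.I * x 1 := by simp [zFst]

theorem zSnd_apply (x : E4) : zSnd x = x 2 + Complex.I * x 3 := by simp [zSnd]

/-- The complex conjugate of a complex-valued continuous linear map. -/
def conjMap (L : E4 →L[ℝ] ℂ) : E4 →L[ℝ] ℂ := Complex.conjCLE.toContinuousLinearMap ∘L L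

@[simp] theorem conjMap_apply (L : E4 →L[ℝ] ℂ) (x : E4) : conjMap L x = conj (L x) := rfl

/-- The monomials in the complex coordinates and their conjugates. -/
def mono (p q r s : ℕ) (x : E4) : ℂ :=
  zFst x ^ p * conjMap zFst x ^ q * zSnd x ^ r * conjMap zSnd x ^ s

/-- The derivative of a monomial. -/
def monoDeriv (p q r s : ℕ) (x : E4) : E4 →L[ℝ] ℂ :=
  (p * mono (p - 1) q r s x) • zFst + (q * mono p (q - 1) r s x) • conjMap zFst +
    (r * mono p q (r - 1) s x) • zSnd + (s * mono p q r (s - 1) x) • conjMap zSnd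

/-- The truncated exponents such as `p - 1` are harmless, since the coefficient `p` vanishes when
truncation occurs. -/
theorem hasFDerivAt_mono (p q r s : ℕ) (x : E4) :
    HasFDerivAt (mono p q r s) (monoDeriv p q r s x) x := by
  have hp : ∀ (L : E4 →L[ℝ] ℂ) (n : ℕ), HasFDerivAt (fun y => L y ^ n)
      ((n * L x ^ (n - 1)) • L) x := fun L n => by
    simpa [nsmul_eq_mul] using HasFDerivAt.pow (L.hasFDerivAt (x := x)) n
  have h := (((hp zFst p).mul (hp (conjMap zFst) q)).mul (hp zSnd r)).mul (hp (conjMap zSnd) s)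
  refine h.congr_fderiv ?_
  ext v
  simp only [monoDeriv, mono, add_apply, smul_apply,
    smul_eq_mul, Pi.mul_apply]
  ring

theorem contDiff_mono (p q r s : ℕ) : ContDiff ℝ ∞ (mono p q r s) :=
  (((zFst.contDiff.pow p).mul ((conjMap zFst).contDiff.pow q)).mul (zSnd.contDiff.pow r)).mul
    ((conjMap zSnd).contDiff.pow s)

theorem mono_smul (p q r s : ℕ) (c : ℝ) (x : E4) :
    mono p q r s (c • x) = (c : ℂ) ^ (p + q + r + s) * mono p q r s x := by
  simp only [mono, map_smul, Complex.real_smul, mul_pow, pow_add]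
  ring

/-- The standard basis vectors. -/
abbrev stdVec (i : Fin 4) : E4 := EuclideanSpace.basisFun (Fin 4) ℝ i

/-- The Laplacian of a complex-valued function on Euclidean space. -/
def complexLaplacian (G : E4 → ℂ) (x : E4) : ℂ :=
  ∑ i, fderiv ℝ (fun y => fderiv ℝ G y (stdVec i)) x (stdVec i)

theorem fderiv_fderiv_mono (p q r s : ℕ) (x v : E4) :
    fderiv ℝ (fun y => fderiv ℝ (mono p q r s) y v) x v =
      p * zFst v * monoDeriv (p - 1) q r s x v + q * conj (zFst v) * monoDeriv p (q - 1) r s x v +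
      r * zSnd v * monoDeriv p q (r - 1) s x v + s * conj (zSnd v) * monoDeriv p q r (s - 1) x v := by
  have e : (fun y => fderiv ℝ (mono p q r s) y v) = fun y =>
      p * zFst v * mono (p - 1) q r s y + q * conj (zFst v) * mono p (q - 1) r s y +
      r * zSnd v * mono p q (r - 1) s y + s * conj (zSnd v) * mono p q r (s - 1) y := by
    funext y
    rw [(hasFDerivAt_mono p q r s y).fderiv]
    simp only [monoDeriv, add_apply, smul_apply,
      smul_eq_mul, conjMap_apply]
    ring
  rw [e, (((((hasFDerivAt_mono (p - 1) q r s x).const_mul _).fun_add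
    ((hasFDerivAt_mono p (q - 1) r s x).const_mul _)).fun_add
    ((hasFDerivAt_mono p q (r - 1) s x).const_mul _)).fun_add
    ((hasFDerivAt_mono p q r (s - 1) x).const_mul _)).fderiv]
  simp only [add_apply, smul_apply, smul_eq_mul]

/-- In complex coordinates the Laplacian is four times the sum of the mixed second derivatives in
each coordinate and its conjugate. -/
theorem complexLaplacian_mono (p q r s : ℕ) (x : E4) :
    complexLaplacian (mono p q r s) x =
      4 * (p * q * mono (p - 1) (q - 1) r s x + r * s * mono p q (r - 1) (s - 1) x) := by
  simp only [complexLaplacian, fderiv_fderiv_mono, Fin.sum_univ_four, monoDeriv,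
    add_apply, smul_apply, smul_eq_mul, conjMap_apply]
  simp [zFst_apply, zSnd_apply, stdVec]
  ring_nf
  simp only [Complex.I_sq]
  ring

theorem contDiff_dirDeriv {G : E4 → ℂ} (hG : ContDiff ℝ ∞ G) (v : E4) :
    ContDiff ℝ ∞ (fun y => fderiv ℝ G y v) :=
  (hG.fderiv_right le_rfl).clm_apply contDiff_const

theorem complexLaplacian_sum {ι : Type*} (t : Finset ι) (c : ι → ℂ) {G : ι → E4 → ℂ}
    (hG : ∀ i, ContDiff ℝ ∞ (G i)) (x : E4) :
    complexLaplacian (fun y => ∑ i ∈ t, c i * G i y) x =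
      ∑ i ∈ t, c i * complexLaplacian (G i) x := by
  have e1 : ∀ v : E4, (fun y => fderiv ℝ (fun y => ∑ i ∈ t, c i * G i y) y v) =
      fun y => ∑ i ∈ t, c i * fderiv ℝ (G i) y v := by
    intro v
    funext y
    rw [fderiv_fun_sum fun i _ => ((hG i).differentiable (by simp) y).const_mul _]
    simp only [sum_apply]
    refine Finset.sum_congr rfl fun i _ => ?_
    rw [fderiv_const_mul ((hG i).differentiable (by simp) y)]
    simp
  have e2 : ∀ v : E4, fderiv ℝ (fun y => ∑ i ∈ t, c i * fderiv ℝ (G i) y v) x v =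
      ∑ i ∈ t, c i * fderiv ℝ (fun y => fderiv ℝ (G i) y v) x v := by
    intro v
    have hd : ∀ i, DifferentiableAt ℝ (fun y => fderiv ℝ (G i) y v) x := fun i =>
      (contDiff_dirDeriv (hG i) v).differentiable (by simp) x
    rw [fderiv_fun_sum fun i _ => (hd i).const_mul _]
    simp only [sum_apply]
    refine Finset.sum_congr rfl fun i _ => ?_
    rw [fderiv_const_mul (hd i)]
    simp
  simp only [complexLaplacian, e1, e2, Finset.mul_sum]
  exact Finset.sum_comm

/-- Real-linear images of complex harmonic homogeneous functions. -/
theorem IsHarmonicExt.of_complex {k : ℕ} {G : E4 → ℂ} (hG : ContDiff ℝ ∞ G)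
    (hk : ∀ (c : ℝ) (x : E4), G (c • x) = (c : ℂ) ^ k * G x)
    (hl : ∀ x, complexLaplacian G x = 0) (L : ℂ →L[ℝ] ℝ) : IsHarmonicExt k (fun x => L (G x)) where
  contDiff := L.contDiff.comp hG
  homogeneous c x _ := by
    rw [hk, ← Complex.ofReal_pow, ← Complex.real_smul, map_smul, smul_eq_mul]
  harmonic x := by
    rw [LinearMap.trace_eq_sum_inner _ (EuclideanSpace.basisFun (Fin 4) ℝ)]
    have hc : ContDiff ℝ ∞ (fun x => L (G x)) := L.contDiff.comp hG
    have hd : DifferentiableAt ℝ (gradient fun x => L (G x)) x :=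
      (contDiffAt_gradient hc.contDiffAt).differentiableAt (by simp)
    have e : ∀ v : E4, inner ℝ v (fderiv ℝ (gradient fun x => L (G x)) x v) =
        L (fderiv ℝ (fun y => fderiv ℝ G y v) x v) := by
      intro v
      have h1 := ((innerSL ℝ v).hasFDerivAt.comp x hd.hasFDerivAt)
      have h2 : (fun y => L (fderiv ℝ G y v)) = (innerSL ℝ v) ∘ (gradient fun x => L (G x)) := by
        funext y
        simp only [Function.comp, innerSL_apply_apply]
        rw [real_inner_comm, ← fderiv_eq_inner_gradient]
        have := L.hasFDerivAt.comp y (hG.differentiable (by simp) y).hasFDerivAt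
        erw [this.fderiv]
        rfl
      rw [← h2] at h1
      have h3 := L.hasFDerivAt.comp x
        ((contDiff_dirDeriv hG v).differentiable (by simp) x).hasFDerivAt
      exact congrArg (fun T : E4 →L[ℝ] ℝ => T v) (h1.unique h3)
    have e2 := congrArg L (hl x)
    rw [complexLaplacian, map_sum, map_zero] at e2
    rw [← e2]
    exact Finset.sum_congr rfl fun i _ => e (stdVec i)

/-- The coefficients of the complex eigenmodes. -/
def modeCoeff (d a b i : ℕ) : ℝ := (-1) ^ (d - i) * (a + d).choose i * (b + d).choose (d - i)

/-- The complex eigenmodes, as homogeneous polynomials on Euclidean 4-space. -/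
def mode (d : ℕ) (ℓ m : ℤ) (x : E4) : ℂ :=
  ∑ i ∈ Finset.range (d + 1), (modeCoeff d m.natAbs ℓ.natAbs i : ℂ) *
    mono (ℓ.toNat + i) ((-ℓ).toNat + i) (m.toNat + (d - i)) ((-m).toNat + (d - i)) x

theorem contDiff_mode (d : ℕ) (ℓ m : ℤ) : ContDiff ℝ ∞ (mode d ℓ m) :=
  ContDiff.sum fun _ _ => contDiff_const.mul (contDiff_mono _ _ _ _)

theorem mode_smul (d : ℕ) (ℓ m : ℤ) (c : ℝ) (x : E4) :
    mode d ℓ m (c • x) = (c : ℂ) ^ (ℓ.natAbs + m.natAbs + 2 * d) * mode d ℓ m x := by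
  rw [mode, mode, Finset.mul_sum]
  refine Finset.sum_congr rfl fun i hi => ?_
  have hi' := Finset.mem_range.mp hi
  rw [mono_smul, show ℓ.toNat + i + ((-ℓ).toNat + i) + (m.toNat + (d - i)) + ((-m).toNat + (d - i)) =
    ℓ.natAbs + m.natAbs + 2 * d by omega]
  ring

/-- The ratio of consecutive binomial coefficients. It states that the coefficient of a single
monomial in the Laplacian of a mode is zero; writing the degree as `j + 1 + e` removes subtractions.
-/
theorem modeCoeff_recurrence (a b j e : ℕ) :
    modeCoeff (j + 1 + e) a b (j + 1) * ((j + 1) * (b + j + 1)) +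
      modeCoeff (j + 1 + e) a b j * ((e + 1) * (a + e + 1)) = 0 := by
  have h1 := Nat.choose_succ_right_eq (a + (j + 1 + e)) j
  have h2 := Nat.choose_succ_right_eq (b + (j + 1 + e)) e
  rw [show a + (j + 1 + e) - j = a + e + 1 by omega] at h1
  rw [show b + (j + 1 + e) - e = b + j + 1 by omega] at h2
  have h1' : ((a + (j + 1 + e)).choose (j + 1) : ℝ) * (j + 1) =
      (a + (j + 1 + e)).choose j * (a + e + 1) := by exact_mod_cast h1
  have h2' : ((b + (j + 1 + e)).choose (e + 1) : ℝ) * (e + 1) =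
      (b + (j + 1 + e)).choose e * (b + j + 1) := by exact_mod_cast h2
  simp only [modeCoeff]
  rw [show j + 1 + e - (j + 1) = e by omega, show j + 1 + e - j = e + 1 by omega, pow_succ]
  linear_combination (-1) ^ e * ((b + (j + 1 + e)).choose e : ℝ) * (b + j + 1) * h1' -
    (-1) ^ e * ((a + (j + 1 + e)).choose j : ℝ) * (a + e + 1) * h2'

/-- One of the positive and negative parts of `ℓ` is zero and the other is `|ℓ|`, so the sign of `ℓ`
does not matter for harmonicity. -/
theorem toNat_mul_toNat_neg_add (ℓ : ℤ) (i : ℕ) :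
    (((ℓ.toNat + i : ℕ) : ℂ) * ((-ℓ).toNat + i : ℕ)) = i * (ℓ.natAbs + i) := by
  rcases le_total 0 ℓ with h | h
  · rw [show (-ℓ).toNat = 0 by omega, show ℓ.toNat = ℓ.natAbs by omega]
    push_cast; ring
  · rw [show ℓ.toNat = 0 by omega, show (-ℓ).toNat = ℓ.natAbs by omega]
    push_cast; ring

theorem complexLaplacian_mode (d : ℕ) (ℓ m : ℤ) (x : E4) : complexLaplacian (mode d ℓ m) x = 0 := by
  unfold mode
  rw [complexLaplacian_sum _ _ fun i => contDiff_mono _ _ _ _]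
  simp only [complexLaplacian_mono, toNat_mul_toNat_neg_add, mul_add, Finset.sum_add_distrib]
  -- The Laplacian lowers either `i` or `d - i`. The `i = 0` term of the first sum and the `i = d`
  -- term of the second have coefficient zero; after this shift both sums run over the same
  -- monomials and cancel term by term.
  rw [Finset.sum_range_succ', Finset.sum_range_succ (n := d)]
  simp only [Nat.cast_zero, zero_mul, mul_zero, add_zero, Nat.sub_self]
  rw [← Finset.sum_add_distrib]
  refine Finset.sum_eq_zero fun j hj => ?_
  obtain ⟨e, rfl⟩ : ∃ e, d = j + 1 + e := ⟨d - (j + 1), by have := Finset.mem_range.mp hj; omega⟩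
  have h := congrArg (fun t : ℝ => (t : ℂ)) (modeCoeff_recurrence m.natAbs ℓ.natAbs j e)
  push_cast at h
  rw [show j + 1 + e - (j + 1) = e by omega, show j + 1 + e - j = e + 1 by omega]
  rw [show ℓ.toNat + (j + 1) - 1 = ℓ.toNat + j by omega,
    show (-ℓ).toNat + (j + 1) - 1 = (-ℓ).toNat + j by omega,
    show m.toNat + (e + 1) - 1 = m.toNat + e by omega,
    show (-m).toNat + (e + 1) - 1 = (-m).toNat + e by omega]
  push_cast
  linear_combination 4 * mono (ℓ.toNat + j) ((-ℓ).toNat + j) (m.toNat + e) ((-m).toNat + e) x * h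

theorem mode_mem_sphericalHarmonics (d : ℕ) (ℓ m : ℤ) (L : ℂ →L[ℝ] ℝ) :
    (fun p : S3 => L (mode d ℓ m p)) ∈ sphericalHarmonics (ℓ.natAbs + m.natAbs + 2 * d) :=
  ⟨_, .of_complex (contDiff_mode d ℓ m) (mode_smul d ℓ m) (complexLaplacian_mode d ℓ m) L,
    fun _ => rfl⟩

/-! ### Symmetries of the modes -/

theorem conj_mono (p q r s : ℕ) (x : E4) : conj (mono p q r s x) = mono q p s r x := by
  simp only [mono, map_mul, map_pow, conjMap_apply, Complex.conj_conj]
  ring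

theorem conj_mode (d : ℕ) (ℓ m : ℤ) (x : E4) : conj (mode d ℓ m x) = mode d (-ℓ) (-m) x := by
  simp only [mode, map_sum, map_mul, Complex.conj_ofReal, conj_mono, Int.natAbs_neg, neg_neg]

theorem zFst_corkscrew (t : ℝ) (x : E4) :
    zFst (corkscrew t x) = Complex.exp (t * Complex.I) * zFst x := by
  rw [Complex.exp_mul_I, zFst_apply, zFst_apply]
  simp [corkscrew]
  linear_combination (-x.ofLp 1 * Complex.sin t : ℂ) * Complex.I_sq

theorem zSnd_corkscrew (t : ℝ) (x : E4) :
    zSnd (corkscrew t x) = Complex.exp (t * Complex.I) * zSnd x := by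
  rw [Complex.exp_mul_I, zSnd_apply, zSnd_apply]
  simp [corkscrew]
  linear_combination (-x.ofLp 3 * Complex.sin t : ℂ) * Complex.I_sq

theorem zFst_quarterTurn (x : E4) : zFst (quarterTurn x) = conj (zSnd x) := by
  simp [zFst_apply, zSnd_apply, quarterTurn]

theorem zSnd_quarterTurn (x : E4) : zSnd (quarterTurn x) = -conj (zFst x) := by
  simp [zFst_apply, zSnd_apply, quarterTurn]
  ring

theorem mono_corkscrew (p q r s : ℕ) (t : ℝ) (x : E4) :
    mono p q r s (corkscrew t x) =
      Complex.exp (((p : ℤ) - q + (r - s) : ℤ) * (t * Complex.I)) * mono p q r s x := by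
  simp only [mono, conjMap_apply, zFst_corkscrew, zSnd_corkscrew, map_mul, ← Complex.exp_conj,
    Complex.conj_ofReal, Complex.conj_I, mul_pow, ← Complex.exp_nat_mul]
  have e : (((p : ℤ) - q + (r - s) : ℤ) : ℂ) * (t * Complex.I) = p * (t * Complex.I) +
      q * (t * -Complex.I) + r * (t * Complex.I) + s * (t * -Complex.I) := by push_cast; ring
  rw [e, Complex.exp_add, Complex.exp_add, Complex.exp_add]
  ring

/-- All monomials of a mode have the same weight `ℓ + m` under the diagonal circle action. -/
theorem mode_corkscrew (d : ℕ) (ℓ m : ℤ) (t : ℝ) (x : E4) :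
    mode d ℓ m (corkscrew t x) =
      Complex.exp ((ℓ + m : ℤ) * (t * Complex.I)) * mode d ℓ m x := by
  rw [mode, mode, Finset.mul_sum]
  refine Finset.sum_congr rfl fun i _ => ?_
  rw [mono_corkscrew]
  have e : (((ℓ.toNat + i : ℕ) : ℤ) - ((-ℓ).toNat + i : ℕ) +
      ((m.toNat + (d - i) : ℕ) - ((-m).toNat + (d - i) : ℕ))) = ℓ + m := by omega
  rw [e]
  ring

theorem mono_quarterTurn (p q r s : ℕ) (x : E4) :
    mono p q r s (quarterTurn x) = (-1) ^ (r + s) * mono s r q p x := by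
  simp only [mono, conjMap_apply, zFst_quarterTurn, zSnd_quarterTurn, map_neg, Complex.conj_conj]
  rw [neg_pow (conj (zFst x)), neg_pow (zFst x), pow_add]
  ring

theorem modeCoeff_reflect (d a b i : ℕ) (hi : i ≤ d) :
    modeCoeff d a b (d - i) = (-1) ^ d * modeCoeff d b a i := by
  simp only [modeCoeff]
  rw [show d - (d - i) = i by omega]
  have : ((-1 : ℝ)) ^ d * (-1) ^ (d - i) = (-1) ^ i := by
    rw [← pow_add]
    exact neg_one_pow_congr (by rw [Nat.even_iff, Nat.even_iff]; omega)
  linear_combination (-((b + d).choose i : ℝ) * (a + d).choose (d - i)) * this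

/-- The quarter turn sends the coordinates `(z, u)` to `(conj u, -conj z)`, so the roles of `i` and
`d - i` are exchanged. Reflecting the coefficients gives the sign `(-1) ^ d`, and the minus sign in
the second coordinate gives `(-1) ^ |m|`. -/
theorem mode_quarterTurn (d : ℕ) (ℓ m : ℤ) (x : E4) :
    mode d ℓ m (quarterTurn x) = (-1) ^ (d + m.natAbs) * mode d (-m) (-ℓ) x := by
  rw [mode, mode, Finset.mul_sum, ← Finset.sum_range_reflect]
  refine Finset.sum_congr rfl fun i hi => ?_
  have hi' : i ≤ d := by have := Finset.mem_range.mp hi; omega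
  rw [show d + 1 - 1 - i = d - i by omega, show d - (d - i) = i by omega, mono_quarterTurn,
    modeCoeff_reflect _ _ _ _ hi', Int.natAbs_neg, Int.natAbs_neg, neg_neg, neg_neg,
    show m.toNat + i + ((-m).toNat + i) = m.natAbs + 2 * i by omega, pow_add _ m.natAbs, pow_mul]
  push_cast
  rw [pow_add]
  simp only [even_two, Even.neg_pow, one_pow, mul_one]
  ring

/-! ### Totality of the modes: Jacobi polynomials and Stone-Weierstrass. -/

theorem norm_sq_complex (p : S3) :
    zFst p * conj (zFst p) + zSnd p * conj (zSnd p) = 1 := by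
  have h2 : ‖p.1‖ ^ 2 = 1 := by rw [p.norm_eq]; norm_num
  rw [EuclideanSpace.norm_sq_eq] at h2
  simp only [Fin.sum_univ_four, Real.norm_eq_abs, sq_abs] at h2
  have h3 := congrArg (fun t : ℝ => (t : ℂ)) h2
  push_cast at h3
  simp only [zFst_apply, zSnd_apply, map_add, map_mul, Complex.conj_ofReal, Complex.conj_I]
  linear_combination h3 - ((p.1 1 : ℂ) ^ 2 + (p.1 3 : ℂ) ^ 2) * Complex.I_sq

/-- The Jacobi polynomial, in the variable `cos² χ`. -/
def jacobiPoly (a b d : ℕ) : Polynomial ℂ :=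
  ∑ i ∈ Finset.range (d + 1),
    Polynomial.C (modeCoeff d a b i : ℂ) * (Polynomial.X ^ i * (1 - Polynomial.X) ^ (d - i))

theorem natDegree_X_pow_mul_le (d i : ℕ) (hi : i ≤ d) :
    ((Polynomial.X : Polynomial ℂ) ^ i * (1 - Polynomial.X) ^ (d - i)).natDegree ≤ d := by
  refine Polynomial.natDegree_mul_le.trans ?_
  have h1 : (1 - Polynomial.X : Polynomial ℂ).natDegree ≤ 1 :=
    (Polynomial.natDegree_sub_le _ _).trans (by simp)
  have h2 := Polynomial.natDegree_pow_le_of_le (d - i) h1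
  rw [Polynomial.natDegree_X_pow]
  omega

/-- Vandermonde's identity. It gives both the leading coefficient of the Jacobi polynomial and,
later, its norm. -/
theorem sum_choose_mul_choose (a b d : ℕ) :
    ∑ i ∈ Finset.range (d + 1), (a + d).choose i * (b + d).choose (d - i) =
      (a + b + 2 * d).choose d := by
  rw [show a + b + 2 * d = (a + d) + (b + d) by ring, Nat.add_choose_eq,
    Finset.Nat.sum_antidiagonal_eq_sum_range_succ
      (fun i j => (a + d).choose i * (b + d).choose j)]

/-- The leading sign `(-1) ^ (d - i)` of `(1 - X) ^ (d - i)` cancels the sign in `modeCoeff`, so the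
terms add without cancellation. -/
theorem coeff_jacobiPoly (a b d : ℕ) :
    (jacobiPoly a b d).coeff d = (a + b + 2 * d).choose d := by
  rw [← sum_choose_mul_choose, jacobiPoly, Polynomial.finsetSum_coeff]
  push_cast
  refine Finset.sum_congr rfl fun i hi => ?_
  obtain ⟨e, rfl⟩ : ∃ e, d = i + e := ⟨d - i, by have := Finset.mem_range.mp hi; omega⟩
  have h1 : (1 - Polynomial.X : Polynomial ℂ).natDegree ≤ 1 :=
    (Polynomial.natDegree_sub_le _ _).trans (by simp)
  have h2 := Polynomial.coeff_pow_of_natDegree_le (m := e) h1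
  rw [mul_one] at h2
  rw [Polynomial.coeff_C_mul, show i + e - i = e by omega, add_comm i e, Polynomial.coeff_X_pow_mul,
    h2]
  simp only [Polynomial.coeff_sub, Polynomial.coeff_one, Polynomial.coeff_X, modeCoeff, if_true,
    one_ne_zero, if_false, zero_sub]
  rw [show e + i - i = e by omega]
  have : ((-1 : ℂ) ^ e) * (-1) ^ e = 1 := by rw [← mul_pow]; simp
  push_cast
  linear_combination ((a + (e + i)).choose i : ℂ) * (b + (e + i)).choose e * this

theorem degree_jacobiPoly (a b d : ℕ) : (jacobiPoly a b d).degree = d := by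
  refine Polynomial.degree_eq_of_le_of_coeff_ne_zero ?_ ?_
  · rw [← Polynomial.natDegree_le_iff_degree_le]
    refine Polynomial.natDegree_sum_le_of_forall_le _ _ fun i hi => ?_
    exact (Polynomial.natDegree_C_mul_le _ _).trans
      (natDegree_X_pow_mul_le d i (by have := Finset.mem_range.mp hi; omega))
  · rw [coeff_jacobiPoly, Nat.cast_ne_zero]
    exact (Nat.choose_pos (by omega)).ne'

/-- The Jacobi polynomials of all degrees. -/
def jacobiSeq (a b : ℕ) : Polynomial.Sequence ℂ := ⟨jacobiPoly a b, degree_jacobiPoly a b⟩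

/-- One polynomial of each exact degree, with invertible leading coefficient, spans all polynomials;
orthogonality is not involved. -/
theorem span_jacobiPoly (a b : ℕ) : Submodule.span ℂ (range (jacobiPoly a b)) = ⊤ :=
  (jacobiSeq a b).span fun i =>
    (Polynomial.leadingCoeff_ne_zero.mpr ((jacobiSeq a b).ne_zero i)).isUnit

theorem mono_add_eq (p q r s i j : ℕ) (x : S3) :
    mono (p + i) (q + i) (r + j) (s + j) x = mono p q r s x *
      (Polynomial.X ^ i * (1 - Polynomial.X) ^ j : Polynomial ℂ).eval (zFst x * conj (zFst x)) := by
  have h : 1 - zFst x * conj (zFst x) = zSnd x * conj (zSnd x) := by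
    rw [← norm_sq_complex x]; ring
  simp only [Polynomial.eval_mul, Polynomial.eval_pow, Polynomial.eval_sub, Polynomial.eval_X,
    Polynomial.eval_one, h, mono, conjMap_apply]
  ring

/-- On the sphere the two squared moduli sum to 1, so a mode is an angular monomial depending only
on `ℓ` and `m`, times a polynomial in one squared modulus. -/
theorem mode_eq_eval (d : ℕ) (ℓ m : ℤ) (x : S3) :
    mode d ℓ m x = mono ℓ.toNat (-ℓ).toNat m.toNat (-m).toNat x *
      (jacobiPoly m.natAbs ℓ.natAbs d).eval (zFst x * conj (zFst x)) := by
  rw [mode, jacobiPoly, Polynomial.eval_finsetSum, Finset.mul_sum]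
  refine Finset.sum_congr rfl fun i _ => ?_
  rw [mono_add_eq, Polynomial.eval_mul (p := Polynomial.C _), Polynomial.eval_C]
  ring

theorem continuous_mono (p q r s : ℕ) : Continuous fun x : S3 => mono p q r s x :=
  (contDiff_mono p q r s).continuous.comp continuous_subtype_val

theorem continuous_mode (d : ℕ) (ℓ m : ℤ) : Continuous fun x : S3 => mode d ℓ m x :=
  (contDiff_mode d ℓ m).continuous.comp continuous_subtype_val

/-- For fixed weights `p - q` and `r - s`, integrating `f` times the angular monomial against `P` of
the squared modulus is linear in `P`. It vanishes on all Jacobi polynomials, hence identically, and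
`X ^ min p q * (1 - X) ^ min r s` recovers the given monomial. -/
theorem integral_mono_eq_zero {f : S3 → ℂ} (hf : Continuous f)
    (h : ∀ d ℓ m, ∫ x, f x * mode d ℓ m x ∂sphereMeasure = 0) (p q r s : ℕ) :
    ∫ x, f x * mono p q r s x ∂sphereMeasure = 0 := by
  let ℓ : ℤ := p - q
  let m : ℤ := r - s
  let g : S3 → ℂ := fun x => f x * mono ℓ.toNat (-ℓ).toNat m.toNat (-m).toNat x
  have hg : Continuous g := hf.mul (continuous_mono _ _ _ _)
  have hi : ∀ P : Polynomial ℂ,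
      Integrable (fun x : S3 => g x * P.eval (zFst x * conj (zFst x))) sphereMeasure := fun P =>
    integrable_of_continuous (hg.mul (P.continuous.comp ((zFst.continuous.comp
      continuous_subtype_val).mul ((conjMap zFst).continuous.comp continuous_subtype_val))))
  let Λ : Polynomial ℂ →ₗ[ℂ] ℂ :=
    { toFun := fun P => ∫ x : S3, g x * P.eval (zFst x * conj (zFst x)) ∂sphereMeasure
      map_add' := fun P Q => by
        simp only [Polynomial.eval_add, mul_add]
        exact integral_add (hi P) (hi Q)
      map_smul' := fun c P => by
        simp only [Polynomial.eval_smul, smul_eq_mul, RingHom.id_apply]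
        rw [← integral_const_mul]
        exact integral_congr_ae (.of_forall fun x => by ring) }
  have hΛ : Λ = 0 := by
    refine LinearMap.ext_on (span_jacobiPoly m.natAbs ℓ.natAbs) ?_
    rintro _ ⟨d, rfl⟩
    refine Eq.trans (integral_congr_ae (.of_forall fun x => ?_)) (h d ℓ m)
    simp only [g]
    rw [mode_eq_eval]
    ring
  have h2 := congrArg (fun T => T (Polynomial.X ^ (min p q) * (1 - Polynomial.X) ^ (min r s))) hΛ
  simp only [LinearMap.zero_apply] at h2
  rw [← h2]
  refine integral_congr_ae (.of_forall fun x => ?_)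
  simp only [g]
  rw [mul_assoc, ← mono_add_eq, show ℓ.toNat + min p q = p by omega,
    show (-ℓ).toNat + min p q = q by omega, show m.toNat + min r s = r by omega,
    show (-m).toNat + min r s = s by omega]

/-- The first complex coordinate as a continuous function on the sphere. -/
def zFstMap : C(S3, ℂ) := ⟨fun x => zFst x, zFst.continuous.comp continuous_subtype_val⟩

/-- The second complex coordinate as a continuous function on the sphere. -/
def zSndMap : C(S3, ℂ) := ⟨fun x => zSnd x, zSnd.continuous.comp continuous_subtype_val⟩

theorem adjoin_closure_eq_top :
    (StarAlgebra.adjoin ℂ {zFstMap, zSndMap}).topologicalClosure = ⊤ := by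
  apply ContinuousMap.starSubalgebra_topologicalClosure_eq_top_of_separatesPoints
  intro x y hxy
  by_contra hne
  push Not at hne
  have h1 : zFst x = zFst y := hne _ ⟨zFstMap, StarAlgebra.subset_adjoin _ _ (by simp), rfl⟩
  have h2 : zSnd x = zSnd y := hne _ ⟨zSndMap, StarAlgebra.subset_adjoin _ _ (by simp), rfl⟩
  apply hxy
  ext i
  have e1 := congrArg Complex.re h1
  have e2 := congrArg Complex.im h1
  have e3 := congrArg Complex.re h2
  have e4 := congrArg Complex.im h2
  simp [zFst_apply, zSnd_apply] at e1 e2 e3 e4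
  fin_cases i <;> assumption

theorem exists_mono_of_mem_closure {g : C(S3, ℂ)}
    (hg : g ∈ Submonoid.closure ({zFstMap, zSndMap} ∪ star {zFstMap, zSndMap} : Set C(S3, ℂ))) :
    ∃ p q r s, ∀ x : S3, g x = mono p q r s x := by
  induction hg using Submonoid.closure_induction with
  | one => exact ⟨0, 0, 0, 0, fun x => by simp [mono]⟩
  | mem g hg =>
    rcases hg with hg | hg
    · rcases hg with rfl | rfl
      · exact ⟨1, 0, 0, 0, fun x => by simp [mono, zFstMap]⟩
      · exact ⟨0, 0, 1, 0, fun x => by simp [mono, zSndMap]⟩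
    · rw [Set.mem_star] at hg
      rcases hg with hg | hg
      · obtain rfl := star_eq_iff_star_eq.mp hg
        exact ⟨0, 1, 0, 0, fun x => by simp [mono, zFstMap]⟩
      · obtain rfl := star_eq_iff_star_eq.mp hg
        exact ⟨0, 0, 0, 1, fun x => by simp [mono, zSndMap]⟩
  | mul g h _ _ hg hh =>
    obtain ⟨p, q, r, s, hg⟩ := hg
    obtain ⟨p', q', r', s', hh⟩ := hh
    refine ⟨p + p', q + q', r + r', s + s', fun x => ?_⟩
    rw [ContinuousMap.mul_apply, hg, hh]
    simp only [mono]
    ring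

/-- A continuous function on the sphere orthogonal to all modes vanishes. -/
theorem eq_zero_of_integral_mode_eq_zero {f : S3 → ℝ} (hf : Continuous f)
    (h : ∀ d ℓ m, ∫ x, (f x : ℂ) * mode d ℓ m x ∂sphereMeasure = 0) : f = 0 := by
  have hfc : Continuous fun x => (f x : ℂ) := Complex.continuous_ofReal.comp hf
  let F : C(S3, ℂ) := ⟨_, hfc⟩
  let Λ : C(S3, ℂ) →ₗ[ℂ] ℂ :=
    { toFun := fun g => ∫ x, (f x : ℂ) * g x ∂sphereMeasure
      map_add' := fun g₁ g₂ => by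
        simp only [ContinuousMap.add_apply, mul_add]
        exact integral_add (integrable_of_continuous (hfc.mul g₁.continuous))
          (integrable_of_continuous (hfc.mul g₂.continuous))
      map_smul' := fun c g => by
        simp only [ContinuousMap.smul_apply, smul_eq_mul, RingHom.id_apply]
        rw [← integral_const_mul]
        exact integral_congr_ae (.of_forall fun x => by ring) }
  have hbound : ∀ g, ‖Λ g‖ ≤ (‖F‖ * sphereMeasure.real univ) * ‖g‖ := by
    intro g
    have := norm_integral_le_of_norm_le_const (μ := sphereMeasure)
      (f := fun x => (f x : ℂ) * g x) (C := ‖F‖ * ‖g‖) (.of_forall fun x => by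
        rw [norm_mul]
        exact mul_le_mul (F.norm_coe_le_norm x) (g.norm_coe_le_norm x) (norm_nonneg _)
          (norm_nonneg _))
    refine this.trans (le_of_eq ?_)
    ring
  let Λc := Λ.mkContinuous _ hbound
  have hker : ∀ g ∈ StarAlgebra.adjoin ℂ {zFstMap, zSndMap}, Λc g = 0 := by
    intro g hg
    have h1 : g ∈ Submodule.span ℂ ((Submonoid.closure
        ({zFstMap, zSndMap} ∪ star {zFstMap, zSndMap} : Set C(S3, ℂ)) : Set C(S3, ℂ))) := by
      have := StarAlgebra.adjoin_eq_span (R := ℂ) ({zFstMap, zSndMap} : Set C(S3, ℂ))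
      exact this ▸ hg
    have h2 : Submodule.span ℂ ((Submonoid.closure
        ({zFstMap, zSndMap} ∪ star {zFstMap, zSndMap} : Set C(S3, ℂ)) : Set C(S3, ℂ))) ≤
        LinearMap.ker Λ := by
      rw [Submodule.span_le]
      intro g hg
      obtain ⟨p, q, r, s, e⟩ := exists_mono_of_mem_closure hg
      show ∫ x, (f x : ℂ) * g x ∂sphereMeasure = 0
      simp only [e]
      exact integral_mono_eq_zero hfc h p q r s
    exact h2 h1
  have hall : ∀ g, Λc g = 0 := by
    intro g
    have hg : g ∈ closure ((StarAlgebra.adjoin ℂ {zFstMap, zSndMap} : StarSubalgebra ℂ C(S3, ℂ)) :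
        Set C(S3, ℂ)) := by
      rw [← StarSubalgebra.topologicalClosure_coe, adjoin_closure_eq_top]
      trivial
    exact closure_minimal (fun g hg => hker g hg)
      (isClosed_singleton.preimage Λc.continuous) hg
  -- The functional vanishes on a dense subalgebra and is continuous, so it may be evaluated at `f`
  -- itself.
  have h0 : ∫ x, f x * f x ∂sphereMeasure = 0 := by
    have h1 : ∫ x, (f x : ℂ) * (f x : ℂ) ∂sphereMeasure = 0 := hall F
    simp only [← Complex.ofReal_mul] at h1
    rw [integral_complex_ofReal] at h1
    exact_mod_cast h1
  rw [integral_eq_zero_iff_of_nonneg (fun x => mul_self_nonneg (f x))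
    (integrable_of_continuous (hf.mul hf)), Continuous.ae_eq_iff_eq sphereMeasure
    (show Continuous fun x => f x * f x from hf.mul hf) continuous_zero] at h0
  funext x
  exact mul_self_eq_zero.mp (congrFun h0 x)

/-! ### Moments of the Jacobi polynomials -/

/-- A polynomial of degree `j + e` interpolating a quotient of factorials. -/
def momentPoly (a b j e : ℕ) : Polynomial ℝ :=
  (ascPochhammer ℝ j).comp (Polynomial.X + Polynomial.C ((b + 1 : ℕ) : ℝ)) *
    (ascPochhammer ℝ e).comp (-Polynomial.X + Polynomial.C ((a + (j + e) + 1 : ℕ) : ℝ))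

theorem natDegree_neg_X_add_C (c : ℝ) : (-Polynomial.X + Polynomial.C c).natDegree = 1 := by
  rw [Polynomial.natDegree_add_C, Polynomial.natDegree_neg, Polynomial.natDegree_X]

theorem leadingCoeff_neg_X_add_C (c : ℝ) : (-Polynomial.X + Polynomial.C c).leadingCoeff = -1 := by
  rw [Polynomial.leadingCoeff, natDegree_neg_X_add_C]
  simp

theorem leadingCoeff_momentPoly (a b j e : ℕ) : (momentPoly a b j e).leadingCoeff = (-1) ^ e := by
  rw [momentPoly, Polynomial.leadingCoeff_mul, Polynomial.leadingCoeff_comp (by rw [Polynomial.natDegree_X_add_C]; simp),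
    Polynomial.leadingCoeff_comp (by rw [natDegree_neg_X_add_C]; simp), leadingCoeff_neg_X_add_C,
    (monic_ascPochhammer ℝ j).leadingCoeff, (monic_ascPochhammer ℝ e).leadingCoeff,
    ascPochhammer_natDegree, ascPochhammer_natDegree, Polynomial.leadingCoeff_X_add_C]
  simp

theorem natDegree_momentPoly (a b j e : ℕ) : (momentPoly a b j e).natDegree = j + e := by
  have h : momentPoly a b j e ≠ 0 := by
    rw [← Polynomial.leadingCoeff_ne_zero, leadingCoeff_momentPoly]
    exact pow_ne_zero _ (by norm_num)
  rw [momentPoly] at h ⊢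
  rw [Polynomial.natDegree_mul (left_ne_zero_of_mul h) (right_ne_zero_of_mul h),
    Polynomial.natDegree_comp, Polynomial.natDegree_comp, natDegree_neg_X_add_C,
    Polynomial.natDegree_X_add_C, ascPochhammer_natDegree, ascPochhammer_natDegree, mul_one, mul_one]

/-- With `d = j + e`, the two rising factorials are `(b+i+j)! / (b+i)!` and `(a+d-i+e)! / (a+d-i)!`;
the denominators are cleared. -/
theorem eval_momentPoly (a b j e i : ℕ) (hi : i ≤ j + e) :
    (momentPoly a b j e).eval (i : ℝ) * ((b + i).factorial * (a + (j + e) - i).factorial : ℕ) =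
      ((b + i + j).factorial * (a + (j + e) - i + e).factorial : ℕ) := by
  have h1 : ((momentPoly a b j e).eval (i : ℝ)) =
      (((b + i + 1).ascFactorial j * (a + (j + e) - i + 1).ascFactorial e : ℕ) : ℝ) := by
    rw [momentPoly, Polynomial.eval_mul, Polynomial.eval_comp, Polynomial.eval_comp]
    simp only [Polynomial.eval_add, Polynomial.eval_neg, Polynomial.eval_X, Polynomial.eval_C]
    rw [show (i : ℝ) + ((b + 1 : ℕ) : ℝ) = ((b + i + 1 : ℕ) : ℝ) by push_cast; ring,
      show -(i : ℝ) + ((a + (j + e) + 1 : ℕ) : ℝ) = ((a + (j + e) - i + 1 : ℕ) : ℝ) by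
        rw [Nat.cast_add (a + (j + e) - i), Nat.cast_sub (by omega)]; push_cast; ring,
      ← ascPochhammer_eval_cast, ← ascPochhammer_eval_cast, ascPochhammer_nat_eq_ascFactorial,
      ascPochhammer_nat_eq_ascFactorial]
    push_cast; ring
  rw [h1, ← Nat.factorial_mul_ascFactorial (b + i) j,
    ← Nat.factorial_mul_ascFactorial (a + (j + e) - i) e]
  push_cast; ring

/-- The factorials `(b+i)!` and `(a+d-i)!` turn the product of binomials into `(a+d)! (b+d)! / d!`
times `d.choose i`. The sum is thus a multiple of the `d`-th finite difference of `momentPoly`,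
which has degree `d`, and that difference is `d!` times the leading coefficient `(-1) ^ (d - j)`. -/
theorem sum_modeCoeff_moment (a b d j : ℕ) (hj : j ≤ d) :
    ∑ i ∈ Finset.range (d + 1), modeCoeff d a b i *
      ((b + i + j).factorial * (a + (d - i) + (d - j)).factorial : ℕ) =
      (-1) ^ (d - j) * ((a + d).factorial * (b + d).factorial : ℕ) := by
  obtain ⟨e, rfl⟩ : ∃ e, d = j + e := ⟨d - j, by omega⟩
  have h1 := congrFun ((momentPoly a b j e).fwdDiff_iter_degree_eq_factorial) 0
  rw [natDegree_momentPoly, leadingCoeff_momentPoly, fwdDiff_iter_eq_sum_shift] at h1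
  simp only [Pi.smul_apply, Pi.natCast_apply, smul_eq_mul, nsmul_eq_mul, zero_add, mul_one,
    zsmul_eq_mul] at h1
  rw [show j + e - j = e by omega]
  have hfac : (((j + e).factorial : ℕ) : ℝ) ≠ 0 := by
    exact_mod_cast (Nat.factorial_pos _).ne'
  have h2 : ((-1) ^ e * ((a + (j + e)).factorial * (b + (j + e)).factorial : ℕ) : ℝ) =
      ((a + (j + e)).factorial * (b + (j + e)).factorial : ℕ) / ((j + e).factorial : ℕ) *
        ((-1) ^ e * ((j + e).factorial : ℕ)) := by
    field_simp
  rw [h2, ← h1, Finset.mul_sum]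
  refine Finset.sum_congr rfl fun i hi => ?_
  have hi' : i ≤ j + e := by have := Finset.mem_range.mp hi; omega
  have h3 := eval_momentPoly a b j e i hi'
  rw [show a + (j + e) - i + e = a + (j + e - i) + e by omega,
    show a + (j + e) - i = a + (j + e - i) by omega] at h3
  rw [← h3]
  have c1 := Nat.choose_mul_factorial_mul_factorial (n := a + (j + e)) (k := i) (by omega)
  have c2 := Nat.choose_mul_factorial_mul_factorial (n := b + (j + e)) (k := j + e - i) (by omega)
  have c3 := Nat.choose_mul_factorial_mul_factorial (n := j + e) (k := i) hi'
  rw [show a + (j + e) - i = a + (j + e - i) by omega] at c1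
  rw [show b + (j + e) - (j + e - i) = b + i by omega] at c2
  have key : ((a + (j + e)).choose i : ℝ) * (b + (j + e)).choose (j + e - i) *
      ((b + i).factorial * (a + (j + e - i)).factorial : ℕ) =
      ((a + (j + e)).factorial * (b + (j + e)).factorial : ℕ) / ((j + e).factorial : ℕ) *
        (j + e).choose i := by
    rw [← c1, ← c2]
    rw [div_mul_eq_mul_div, eq_div_iff hfac, ← c3]
    push_cast
    ring
  simp only [modeCoeff]
  push_cast at key ⊢
  linear_combination (-1) ^ (j + e - i) * (momentPoly a b j e).eval (i : ℝ) * key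

/-- The squared norm of a Jacobi polynomial in terms of factorial moments. The inner moment depends
on the other index only through a sign, which cancels the sign of the remaining coefficient;
Vandermonde sums what is left. -/
theorem sum_sum_modeCoeff_moment (a b d : ℕ) :
    ∑ i ∈ Finset.range (d + 1), ∑ j ∈ Finset.range (d + 1), modeCoeff d a b i * modeCoeff d a b j *
      ((b + i + j).factorial * (a + (d - i) + (d - j)).factorial : ℕ) =
      ((a + d).factorial * (b + d).factorial * (a + b + 2 * d).choose d : ℕ) := by
  rw [Finset.sum_comm, ← sum_choose_mul_choose]
  push_cast
  rw [Finset.mul_sum]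
  refine Finset.sum_congr rfl fun j hj => ?_
  have hj' : j ≤ d := by have := Finset.mem_range.mp hj; omega
  have h := sum_modeCoeff_moment a b d j hj'
  push_cast at h
  have : ∀ i, modeCoeff d a b i * modeCoeff d a b j *
      (((b + i + j).factorial : ℝ) * ((a + (d - i) + (d - j)).factorial : ℝ)) = modeCoeff d a b j *
      (modeCoeff d a b i * (((b + i + j).factorial : ℝ) * ((a + (d - i) + (d - j)).factorial : ℝ))) :=
    fun i => by ring
  simp only [this]
  rw [← Finset.mul_sum, h]
  simp only [modeCoeff]
  have s : ((-1 : ℝ) ^ (d - j)) * (-1) ^ (d - j) = 1 := by rw [← mul_pow]; simp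
  linear_combination ((a + d).choose j : ℝ) * (b + d).choose (d - j) * (a + d).factorial *
    (b + d).factorial * s

/-! ### Trigonometric integrals -/

theorem integral_cos_int_mul (n : ℤ) :
    ∫ t in (-Real.pi)..Real.pi, Real.cos (n * t) = if n = 0 then 2 * Real.pi else 0 := by
  split_ifs with h
  · subst h; simp; ring
  · have h' : (n : ℝ) ≠ 0 := by exact_mod_cast h
    rw [intervalIntegral.integral_comp_mul_left _ h', integral_cos, mul_neg, Real.sin_neg,
      Real.sin_int_mul_pi]
    simp

theorem integral_sin_int_mul (n : ℤ) :
    ∫ t in (-Real.pi)..Real.pi, Real.sin (n * t) = 0 := by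
  by_cases h : n = 0
  · subst h; simp
  · have h' : (n : ℝ) ≠ 0 := by exact_mod_cast h
    rw [intervalIntegral.integral_comp_mul_left _ h', integral_sin, mul_neg, Real.cos_neg]
    simp

theorem circ_eq (j : ℤ) (t : ℝ) :
    circ j t = if 0 ≤ j then Real.cos (j * t) else -Real.sin (j * t) := by
  rcases le_or_gt 0 j with h | h
  · have : ((j.natAbs : ℕ) : ℝ) = j := by
      rw [Nat.cast_natAbs, abs_of_nonneg h]
    rw [circ, if_pos h, if_pos h, this]
  · have : ((j.natAbs : ℕ) : ℝ) = -j := by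
      rw [Nat.cast_natAbs, abs_of_neg h]; simp
    rw [circ, if_neg (by omega), if_neg (by omega), this, neg_mul, Real.sin_neg]

theorem continuous_circ (j : ℤ) : Continuous (circ j) := by
  have : circ j = fun t => if 0 ≤ j then Real.cos (j * t) else -Real.sin (j * t) :=
    funext (circ_eq j)
  rw [this]
  split_ifs <;> fun_prop

theorem integral_circ_mul_circ (i j : ℤ) :
    ∫ t in (-Real.pi)..Real.pi, circ i t * circ j t =
      if i = j then 2 ^ hat i * Real.pi else 0 := by
  have hc : ∀ n : ℤ, IntervalIntegrable (fun t : ℝ => Real.cos (n * t)) volume (-Real.pi) Real.pi :=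
    fun n => Continuous.intervalIntegrable (by fun_prop) _ _
  have hs : ∀ n : ℤ, IntervalIntegrable (fun t : ℝ => Real.sin (n * t)) volume (-Real.pi) Real.pi :=
    fun n => Continuous.intervalIntegrable (by fun_prop) _ _
  -- The value `ε = 1` serves products of two cosines and `ε = -1` products of two sines. For `i = j
  -- = 0` both frequencies vanish, which is the extra factor 2 recorded by `hat`.
  have key : ∀ ε : ℝ, ∫ t in (-Real.pi)..Real.pi,
      (Real.cos ((i - j : ℤ) * t) + ε * Real.cos ((i + j : ℤ) * t)) / 2 =
      ((if i - j = 0 then 2 * Real.pi else 0) + ε * (if i + j = 0 then 2 * Real.pi else 0)) / 2 := by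
    intro ε
    rw [intervalIntegral.integral_div, intervalIntegral.integral_add (hc _) ((hc _).const_mul _),
      intervalIntegral.integral_const_mul, integral_cos_int_mul, integral_cos_int_mul]
  have key2 : ∀ ε : ℝ, ∫ t in (-Real.pi)..Real.pi,
      (Real.sin ((i + j : ℤ) * t) + ε * Real.sin ((i - j : ℤ) * t)) / 2 = 0 := by
    intro ε
    rw [intervalIntegral.integral_div, intervalIntegral.integral_add (hs _) ((hs _).const_mul _),
      intervalIntegral.integral_const_mul, integral_sin_int_mul, integral_sin_int_mul]
    simp
  have eC : ∀ t : ℝ, Real.cos ((i - j : ℤ) * t) =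
      Real.cos (i * t) * Real.cos (j * t) + Real.sin (i * t) * Real.sin (j * t) := fun t => by
    push_cast; rw [sub_mul, Real.cos_sub]
  have eC' : ∀ t : ℝ, Real.cos ((i + j : ℤ) * t) =
      Real.cos (i * t) * Real.cos (j * t) - Real.sin (i * t) * Real.sin (j * t) := fun t => by
    push_cast; rw [add_mul, Real.cos_add]
  have eS : ∀ t : ℝ, Real.sin ((i + j : ℤ) * t) =
      Real.sin (i * t) * Real.cos (j * t) + Real.cos (i * t) * Real.sin (j * t) := fun t => by
    push_cast; rw [add_mul, Real.sin_add]
  have eS' : ∀ t : ℝ, Real.sin ((i - j : ℤ) * t) =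
      Real.sin (i * t) * Real.cos (j * t) - Real.cos (i * t) * Real.sin (j * t) := fun t => by
    push_cast; rw [sub_mul, Real.sin_sub]
  rcases le_or_gt 0 i with hi | hi <;> rcases le_or_gt 0 j with hj | hj
  · have e : ∀ t : ℝ, circ i t * circ j t =
        (Real.cos ((i - j : ℤ) * t) + 1 * Real.cos ((i + j : ℤ) * t)) / 2 := fun t => by
      rw [circ_eq, circ_eq, if_pos hi, if_pos hj, eC, eC']; ring
    simp only [e, key]
    by_cases h : i = j
    · subst h
      by_cases h0 : i = 0
      · simp [h0, hat]
      · simp [h0, hat, show i + i ≠ 0 by omega]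
    · simp [h, show i - j ≠ 0 by omega, show i + j ≠ 0 by omega]
  · have e : ∀ t : ℝ, circ i t * circ j t =
        -((Real.sin ((i + j : ℤ) * t) + -1 * Real.sin ((i - j : ℤ) * t)) / 2) := fun t => by
      rw [circ_eq, circ_eq, if_pos hi, if_neg (by omega), eS, eS']; ring
    simp only [e, intervalIntegral.integral_neg, key2]
    simp [show i ≠ j by omega]
  · have e : ∀ t : ℝ, circ i t * circ j t =
        -((Real.sin ((i + j : ℤ) * t) + 1 * Real.sin ((i - j : ℤ) * t)) / 2) := fun t => by
      rw [circ_eq, circ_eq, if_neg (by omega), if_pos hj, eS, eS']; ring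
    simp only [e, intervalIntegral.integral_neg, key2]
    simp [show i ≠ j by omega]
  · have e : ∀ t : ℝ, circ i t * circ j t =
        (Real.cos ((i - j : ℤ) * t) + -1 * Real.cos ((i + j : ℤ) * t)) / 2 := fun t => by
      rw [circ_eq, circ_eq, if_neg (by omega), if_neg (by omega), eC, eC']; ring
    simp only [e, key]
    by_cases h : i = j
    · subst h
      simp [hat, show i + i ≠ 0 by omega, show i ≠ 0 by omega]
    · simp [h, show i - j ≠ 0 by omega, show i + j ≠ 0 by omega]

/-! ### Gaussian integrals over the complex plane -/

/-- The radial Gaussian moments. -/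
def gaussMoment (n : ℕ) : ℝ := ∫ r in Ioi (0 : ℝ), r ^ n * Real.exp (-r ^ 2)

theorem gaussMoment_odd (n : ℕ) : gaussMoment (2 * n + 1) = n.factorial / 2 := by
  have h := integral_rpow_mul_exp_neg_rpow (p := 2) (q := 2 * n + 1) (by norm_num)
    (by have : (0 : ℝ) ≤ n := n.cast_nonneg
        linarith)
  rw [show ((2 : ℝ) * n + 1 + 1) / 2 = n + 1 by ring, Real.Gamma_nat_eq_factorial] at h
  rw [gaussMoment, div_eq_inv_mul, ← one_div, ← h]
  refine setIntegral_congr_fun measurableSet_Ioi fun r _ => ?_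
  rw [← Real.rpow_natCast r (2 * n + 1), ← Real.rpow_two]
  push_cast
  rfl

theorem integrableOn_gaussMoment (n : ℕ) :
    IntegrableOn (fun r : ℝ => r ^ n * Real.exp (-r ^ 2)) (Ioi 0) := by
  have := integrableOn_rpow_mul_exp_neg_mul_sq one_pos (s := n)
    (lt_of_lt_of_le (by norm_num) n.cast_nonneg)
  simpa [Real.rpow_natCast] using this

/-- The Gaussian weight times a homogeneous angular function. -/
def planeFun (n : ℕ) (i j : ℤ) (z : ℂ) : ℝ :=
  ‖z‖ ^ n * Real.exp (-‖z‖ ^ 2) * (circ i z.arg * circ j z.arg)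

theorem abs_circ_le_one (j : ℤ) (t : ℝ) : |circ j t| ≤ 1 := by
  unfold circ
  split_ifs
  · exact Real.abs_cos_le_one _
  · exact Real.abs_sin_le_one _

theorem integrable_planeFun (n : ℕ) (i j : ℤ) : Integrable (planeFun n i j) := by
  have h1 : Integrable (fun z : ℂ => ‖z‖ ^ n * Real.exp (-‖z‖ ^ 2)) := by
    rw [integrable_fun_norm_addHaar (volume : Measure ℂ)
      (f := fun r : ℝ => r ^ n * Real.exp (-r ^ 2))]
    have := integrableOn_gaussMoment (n + 1)
    refine this.congr_fun (fun r _ => ?_) measurableSet_Ioi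
    simp only [Complex.finrank_real_complex, smul_eq_mul]
    rw [pow_succ]
    norm_num
    ring
  refine h1.mul_bdd (c := 1) ?_ ?_
  · exact (((continuous_circ i).measurable.comp Complex.measurable_arg).mul
      ((continuous_circ j).measurable.comp Complex.measurable_arg)).aestronglyMeasurable
  · refine .of_forall fun z => ?_
    rw [Real.norm_eq_abs, abs_mul]
    exact mul_le_one₀ (abs_circ_le_one _ _) (abs_nonneg _) (abs_circ_le_one _ _)

theorem integral_planeFun (n : ℕ) (i j : ℤ) :
    ∫ z, planeFun n i j z = gaussMoment (n + 1) * if i = j then 2 ^ hat i * Real.pi else 0 := by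
  rw [← Complex.integral_comp_polarCoord_symm, ← integral_circ_mul_circ,
    intervalIntegral.integral_of_le (by linarith [Real.pi_pos]), integral_Ioc_eq_integral_Ioo,
    gaussMoment, show polarCoord.target = Ioi 0 ×ˢ Ioo (-Real.pi) Real.pi from rfl,
    Measure.volume_eq_prod, ← setIntegral_prod_mul]
  refine setIntegral_congr_fun (measurableSet_Ioi.prod measurableSet_Ioo) fun p hp => ?_
  have hr : 0 < p.1 := hp.1
  have harg : (Complex.polarCoord.symm p).arg = p.2 := by
    rw [Complex.polarCoord_symm_apply, Complex.ofReal_cos, Complex.ofReal_sin,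
      Complex.arg_mul_cos_add_sin_mul_I hr
      (Ioo_subset_Ioc_self hp.2)]
  have hn : ‖Complex.polarCoord.symm p‖ = p.1 := by
    rw [Complex.norm_polarCoord_symm, abs_of_pos hr]
  simp only [planeFun, harg, hn, smul_eq_mul]
  ring

/-- Euclidean 4-space as the complex plane squared. -/
def complexPair : E4 ≃ₗᵢ[ℝ] WithLp 2 (ℂ × ℂ) :=
  LinearIsometry.toLinearIsometryEquiv
    { toFun := fun x => WithLp.toLp 2 (zFst x, zSnd x)
      map_add' := fun x y => by simp [← WithLp.toLp_add]
      map_smul' := fun c x => by simp [← WithLp.toLp_smul]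
      norm_map' := fun x => by
        rw [WithLp.prod_norm_eq_of_L2, EuclideanSpace.norm_eq]
        congr 1
        simp only [zFst_apply, zSnd_apply, Fin.sum_univ_four, ← Complex.normSq_eq_norm_sq,
          Real.norm_eq_abs, sq_abs]
        simp [Complex.normSq_apply]
        ring }
    (by
      rw [(WithLp.linearEquiv 2 ℝ (ℂ × ℂ)).finrank_eq]
      simp [Complex.finrank_real_complex])

theorem integral_E4_eq (F : ℂ × ℂ → ℝ) : ∫ x : E4, F (zFst x, zSnd x) = ∫ z, F z := by
  have h := (WithLp.volume_preserving_symm_measurableEquiv_toLp_prod ℂ ℂ).comp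
    complexPair.measurePreserving
  exact h.integral_comp ((MeasurableEquiv.toLp 2 (ℂ × ℂ)).symm.measurableEmbedding.comp
    complexPair.toHomeomorph.measurableEmbedding) F

/-! ### Toroidal coordinates in complex form and orthonormality of `Psi`. -/

theorem zFst_eq_mk (x : E4) : zFst x = ⟨x 0, x 1⟩ := by
  rw [zFst_apply]
  apply Complex.ext <;> simp

theorem zSnd_eq_mk (x : E4) : zSnd x = ⟨x 2, x 3⟩ := by
  rw [zSnd_apply]
  apply Complex.ext <;> simp

theorem norm_sq_eq_add (x : E4) : ‖x‖ ^ 2 = ‖zFst x‖ ^ 2 + ‖zSnd x‖ ^ 2 := by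
  rw [← complexPair.norm_map, WithLp.prod_norm_sq_eq_of_L2]
  rfl

theorem cos_chi (p : S3) : Real.cos (chi p) = ‖zFst p‖ := by
  have h := norm_sq_eq_add p
  rw [p.norm_eq] at h
  rw [chi, ← zFst_eq_mk]
  apply Real.cos_arccos
  · linarith [norm_nonneg (zFst p)]
  · nlinarith [norm_nonneg (zFst p), sq_nonneg ‖zSnd p‖]

theorem sin_chi (p : S3) : Real.sin (chi p) = ‖zSnd p‖ := by
  have h := norm_sq_eq_add p
  rw [p.norm_eq] at h
  rw [chi, ← zFst_eq_mk, Real.sin_arccos, ← Real.sqrt_sq (norm_nonneg (zSnd p))]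
  congr 1
  linarith

theorem theta_eq (p : S3) : theta p = (zFst p).arg := by rw [theta, zFst_eq_mk]

theorem phi_eq (p : S3) : phi p = (zSnd p).arg := by rw [phi, zSnd_eq_mk]

/-- By the double-angle formulas the two factors are `2 cos² χ` and `-2 sin² χ`; the powers of 2
cancel the normalization and the sign enters `modeCoeff`. -/
theorem jacobi_cos_two_mul (a b d : ℕ) (χ : ℝ) :
    jacobi a b d (Real.cos (2 * χ)) = ∑ i ∈ Finset.range (d + 1),
      modeCoeff d a b i * Real.cos χ ^ (2 * i) * Real.sin χ ^ (2 * (d - i)) := by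
  rw [jacobi, Finset.mul_sum]
  refine Finset.sum_congr rfl fun i hi => ?_
  have hi' : i ≤ d := by have := Finset.mem_range.mp hi; omega
  have h1 : Real.cos (2 * χ) + 1 = 2 * Real.cos χ ^ 2 := by rw [Real.cos_two_mul]; ring
  have h2 : Real.cos (2 * χ) - 1 = 2 * (-1 * Real.sin χ ^ 2) := by
    rw [Real.cos_two_mul, Real.cos_sq']; ring
  rw [h1, h2, mul_pow, mul_pow 2, mul_pow (-1), modeCoeff, pow_mul, pow_mul]
  have h3 : (2 : ℝ) ^ d = 2 ^ i * 2 ^ (d - i) := by rw [← pow_add]; congr 1; omega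
  rw [h3]
  field_simp

/-- The real eigenmodes as homogeneous functions on Euclidean 4-space. -/
def realMode (d : ℕ) (ℓ m : ℤ) (x : E4) : ℝ :=
  (∑ i ∈ Finset.range (d + 1), modeCoeff d m.natAbs ℓ.natAbs i *
    ‖zFst x‖ ^ (ℓ.natAbs + 2 * i) * ‖zSnd x‖ ^ (m.natAbs + 2 * (d - i))) *
    (circ ℓ (zFst x).arg * circ m (zSnd x).arg)

theorem psiTilde_eq_realMode (k : ℕ) (ℓ m : ℤ) (p : S3) :
    psiTilde k ℓ m (chi p) (theta p) (phi p) = realMode (dNum k ℓ m) ℓ m p := by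
  rw [psiTilde, realMode, jacobi_cos_two_mul, cos_chi, sin_chi, theta_eq, phi_eq, Finset.mul_sum,
    mul_assoc (Finset.sum _ _)]
  congr 1
  refine Finset.sum_congr rfl fun i _ => ?_
  rw [pow_add, pow_add]
  ring

theorem realMode_smul (d : ℕ) (ℓ m : ℤ) {c : ℝ} (hc : 0 < c) (x : E4) :
    realMode d ℓ m (c • x) = c ^ (ℓ.natAbs + m.natAbs + 2 * d) * realMode d ℓ m x := by
  simp only [realMode, map_smul, Complex.real_smul, Complex.arg_real_mul _ hc, norm_mul,
    Complex.norm_real, Real.norm_eq_abs, abs_of_pos hc]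
  rw [← mul_assoc (c ^ _), Finset.mul_sum]
  congr 1
  refine Finset.sum_congr rfl fun i hi => ?_
  have hi' : i ≤ d := by have := Finset.mem_range.mp hi; omega
  rw [show ℓ.natAbs + m.natAbs + 2 * d = ℓ.natAbs + 2 * i + (m.natAbs + 2 * (d - i)) by omega,
    pow_add c, mul_pow, mul_pow]
  ring

/-- The Gaussian weight splits over the two complex coordinates, so the integral over 4-space is a
finite sum of products of planar integrals. This replaces integration over the sphere in toroidal
coordinates. -/
theorem integral_realMode_mul (d d' : ℕ) (ℓ m ℓ' m' : ℤ) :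
    ∫ x : E4, Real.exp (-‖x‖ ^ 2) * (realMode d ℓ m x * realMode d' ℓ' m' x) =
      ∑ i ∈ Finset.range (d + 1), ∑ j ∈ Finset.range (d' + 1),
        modeCoeff d m.natAbs ℓ.natAbs i * modeCoeff d' m'.natAbs ℓ'.natAbs j *
        ((gaussMoment (ℓ.natAbs + 2 * i + (ℓ'.natAbs + 2 * j) + 1) *
            if ℓ = ℓ' then 2 ^ hat ℓ * Real.pi else 0) *
          (gaussMoment (m.natAbs + 2 * (d - i) + (m'.natAbs + 2 * (d' - j)) + 1) *
            if m = m' then 2 ^ hat m * Real.pi else 0)) := by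
  let F : ℂ × ℂ → ℝ := fun z => ∑ i ∈ Finset.range (d + 1), ∑ j ∈ Finset.range (d' + 1),
        modeCoeff d m.natAbs ℓ.natAbs i * modeCoeff d' m'.natAbs ℓ'.natAbs j *
        (planeFun (ℓ.natAbs + 2 * i + (ℓ'.natAbs + 2 * j)) ℓ ℓ' z.1 *
          planeFun (m.natAbs + 2 * (d - i) + (m'.natAbs + 2 * (d' - j))) m m' z.2)
  have h1 : ∀ x : E4, Real.exp (-‖x‖ ^ 2) * (realMode d ℓ m x * realMode d' ℓ' m' x) =
      F (zFst x, zSnd x) := by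
    intro x
    have e : -‖x‖ ^ 2 = -‖zFst x‖ ^ 2 + -‖zSnd x‖ ^ 2 := by rw [norm_sq_eq_add]; ring
    simp only [F, realMode]
    rw [e, Real.exp_add, mul_mul_mul_comm (Finset.sum _ _) _ (Finset.sum _ _) _, Finset.sum_mul_sum, Finset.sum_mul, Finset.mul_sum]
    refine Finset.sum_congr rfl fun i _ => ?_
    rw [Finset.sum_mul, Finset.mul_sum]
    refine Finset.sum_congr rfl fun j _ => ?_
    simp only [planeFun, pow_add]
    ring
  have hi : ∀ n n', Integrable (fun z : ℂ × ℂ => planeFun n ℓ ℓ' z.1 * planeFun n' m m' z.2) :=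
    fun n n' => (integrable_planeFun n ℓ ℓ').mul_prod (integrable_planeFun n' m m')
  simp only [h1]
  rw [integral_E4_eq F]
  simp only [F]
  rw [integral_finsetSum _ fun i _ => integrable_finsetSum _ fun j _ => (hi _ _).const_mul _]
  refine Finset.sum_congr rfl fun i _ => ?_
  rw [integral_finsetSum _ fun j _ => (hi _ _).const_mul _]
  refine Finset.sum_congr rfl fun j _ => ?_
  rw [integral_const_mul, ← integral_planeFun, ← integral_planeFun, ← integral_prod_mul]
  rfl

/-- By homogeneity the radial integral of `r ^ (2k + 3) * exp (-r ^ 2)` splits off, with value `(k +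
1)! / 2`. -/
theorem integral_exp_mul_eq_sphere {k : ℕ} {h g : E4 → ℝ}
    (hh : ∀ (c : ℝ) (x : E4), 0 < c → h (c • x) = c ^ k * h x)
    (hg : ∀ (c : ℝ) (x : E4), 0 < c → g (c • x) = c ^ k * g x) :
    ∫ x : E4, Real.exp (-‖x‖ ^ 2) * (h x * g x) =
      ((k + 1).factorial / 2) * ∫ p : S3, h p * g p ∂sphereMeasure := by
  have h1 := integral_polar (fun r => r ^ (2 * k) * Real.exp (-r ^ 2)) (fun p : S3 => h p * g p)
  have h2 : ∫ r in Ioi (0 : ℝ), r ^ 3 * (r ^ (2 * k) * Real.exp (-r ^ 2)) =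
      (k + 1).factorial / 2 := by
    rw [← gaussMoment_odd, gaussMoment]
    congr 1
    funext r
    ring
  rw [← h2, ← h1]
  refine integral_congr_ae ?_
  have hne : ∀ᵐ x : E4, x ≠ 0 := by
    simp [ae_iff, measure_singleton]
  filter_upwards [hne] with x hx
  have hn : 0 < ‖x‖ := norm_pos_iff.mpr hx
  rw [radialExt_of_ne _ hx]
  simp only [toS3]
  rw [hh _ _ (inv_pos.mpr hn), hg _ _ (inv_pos.mpr hn), two_mul, pow_add]
  have hk : ‖x‖ ^ k * ‖x‖⁻¹ ^ k = 1 := by rw [← mul_pow, mul_inv_cancel₀ hn.ne', one_pow]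
  linear_combination (-Real.exp (-‖x‖ ^ 2) * h x * g x * (‖x‖ ^ k * ‖x‖⁻¹ ^ k + 1)) * hk

theorem ModeExists.add_eq {k : ℕ} {ℓ m : ℤ} (h : ModeExists k ℓ m) :
    ℓ.natAbs + m.natAbs + 2 * dNum k ℓ m = k := by
  obtain ⟨h1, h2⟩ := h
  rw [Int.abs_eq_natAbs, Int.abs_eq_natAbs] at h1
  have h3 := h2.dvd
  unfold dNum
  omega

theorem psiNorm_pos (k : ℕ) (ℓ m : ℤ) : 0 < psiNorm k ℓ m := by
  unfold psiNorm
  have := Real.pi_pos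
  positivity

theorem psiNorm_sq (k : ℕ) (ℓ m : ℤ) : psiNorm k ℓ m ^ 2 =
    2 ^ (hat ℓ + hat m) * Real.pi ^ 2 *
      (((ℓ.natAbs + dNum k ℓ m).factorial * (m.natAbs + dNum k ℓ m).factorial : ℝ) /
      (2 * ((k : ℝ) + 1) * (dNum k ℓ m).factorial *
        (ℓ.natAbs + m.natAbs + dNum k ℓ m).factorial)) := by
  rw [psiNorm, mul_pow, mul_pow, Real.sq_sqrt (by positivity), Real.sq_sqrt (by positivity)]

/-- The modes of the 3-sphere are orthonormal. -/
theorem integral_Psi_mul_Psi {k : ℕ} {ℓ m ℓ' m' : ℤ} (h : ModeExists k ℓ m)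
    (h' : ModeExists k ℓ' m') :
    ∫ p, Psi k ℓ m p * Psi k ℓ' m' p ∂sphereMeasure = if ℓ = ℓ' ∧ m = m' then 1 else 0 := by
  set d := dNum k ℓ m with hd
  set d' := dNum k ℓ' m' with hd'
  have e1 := integral_exp_mul_eq_sphere (k := k) (h := realMode d ℓ m) (g := realMode d' ℓ' m')
    (fun c x hc => by rw [realMode_smul d ℓ m hc, h.add_eq])
    (fun c x hc => by rw [realMode_smul d' ℓ' m' hc, h'.add_eq])
  rw [integral_realMode_mul] at e1
  have hfac : (((k + 1).factorial : ℝ) / 2) ≠ 0 := by positivity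
  have e2 : ∫ p, Psi k ℓ m p * Psi k ℓ' m' p ∂sphereMeasure =
      (psiNorm k ℓ m * psiNorm k ℓ' m')⁻¹ *
        ∫ p : S3, realMode d ℓ m p * realMode d' ℓ' m' p ∂sphereMeasure := by
    rw [← integral_const_mul]
    refine integral_congr_ae (.of_forall fun p => ?_)
    simp only [Psi, psiTilde_eq_realMode]
    rw [mul_inv, div_eq_mul_inv, div_eq_mul_inv]
    ring
  rw [e2]
  split_ifs with heq
  · obtain ⟨rfl, rfl⟩ := heq
    have hs := sum_sum_modeCoeff_moment m.natAbs ℓ.natAbs d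
    have e3 : ∀ i ∈ Finset.range (d + 1), ∀ j ∈ Finset.range (d + 1),
        modeCoeff d m.natAbs ℓ.natAbs i * modeCoeff d m.natAbs ℓ.natAbs j *
        ((gaussMoment (ℓ.natAbs + 2 * i + (ℓ.natAbs + 2 * j) + 1) *
            if ℓ = ℓ then 2 ^ hat ℓ * Real.pi else 0) *
          (gaussMoment (m.natAbs + 2 * (d - i) + (m.natAbs + 2 * (d - j)) + 1) *
            if m = m then 2 ^ hat m * Real.pi else 0)) =
        2 ^ (hat ℓ + hat m) * Real.pi ^ 2 / 4 *
        (modeCoeff d m.natAbs ℓ.natAbs i * modeCoeff d m.natAbs ℓ.natAbs j *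
          ((ℓ.natAbs + i + j).factorial * (m.natAbs + (d - i) + (d - j)).factorial : ℕ)) := by
      intro i _ j _
      rw [if_pos rfl, if_pos rfl,
        show ℓ.natAbs + 2 * i + (ℓ.natAbs + 2 * j) + 1 = 2 * (ℓ.natAbs + i + j) + 1 by ring,
        show m.natAbs + 2 * (d - i) + (m.natAbs + 2 * (d - j)) + 1 =
          2 * (m.natAbs + (d - i) + (d - j)) + 1 by ring, gaussMoment_odd, gaussMoment_odd, pow_add]
      push_cast
      ring
    rw [Finset.sum_congr rfl fun i hi => Finset.sum_congr rfl fun j hj => e3 i hi j hj] at e1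
    simp only [← Finset.mul_sum] at e1
    rw [hs] at e1
    have hN := psiNorm_sq k ℓ m
    have hk := h.add_eq
    rw [← hd] at hN hk
    have hch := Nat.choose_mul_factorial_mul_factorial (n := m.natAbs + ℓ.natAbs + 2 * d) (k := d)
      (by omega)
    rw [show m.natAbs + ℓ.natAbs + 2 * d - d = ℓ.natAbs + m.natAbs + d by omega,
      show m.natAbs + ℓ.natAbs + 2 * d = k by omega] at hch
    rw [show m.natAbs + ℓ.natAbs + 2 * d = k by omega] at e1
    -- Here `k.choose d` equals `k! / (d! (|ℓ| + |m| + d)!)`, and dividing by `(k + 1)!` leaves the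
    -- factor `k + 1` of the normalizing constant.
    have hI : ∫ p : S3, realMode d ℓ m p * realMode d ℓ m p ∂sphereMeasure =
        psiNorm k ℓ m ^ 2 := by
      apply mul_left_cancel₀ hfac
      rw [← e1, hN, Nat.factorial_succ, ← hch]
      push_cast
      field_simp
      ring
    rw [hI, ← sq, inv_mul_cancel₀]
    exact pow_ne_zero _ (psiNorm_pos k ℓ m).ne'
  -- One of the two angular integrals vanishes. Orthogonality of Jacobi polynomials of different
  -- degrees is not needed, because `k`, `ℓ` and `m` determine `d`.
  · have hz : ∫ p : S3, realMode d ℓ m p * realMode d' ℓ' m' p ∂sphereMeasure = 0 := by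
      apply mul_left_cancel₀ hfac
      rw [← e1, mul_zero]
      refine Finset.sum_eq_zero fun i _ => Finset.sum_eq_zero fun j _ => ?_
      rcases not_and_or.mp heq with h0 | h0 <;> simp [h0]
    rw [hz, mul_zero]

/-! ### Real modes in terms of complex modes -/

theorem mono_eq_exp (ℓ m : ℤ) (x : E4) :
    mono ℓ.toNat (-ℓ).toNat m.toNat (-m).toNat x =
      ((‖zFst x‖ ^ ℓ.natAbs * ‖zSnd x‖ ^ m.natAbs : ℝ) : ℂ) *
        Complex.exp ((ℓ * (zFst x).arg + m * (zSnd x).arg : ℝ) * Complex.I) := by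
  have key : ∀ (j : ℤ) (z : ℂ), z ^ j.toNat * conj z ^ (-j).toNat =
      (‖z‖ ^ j.natAbs : ℝ) * Complex.exp ((j * z.arg : ℝ) * Complex.I) := by
    intro j z
    have hz := (Complex.norm_mul_exp_arg_mul_I z).symm
    rcases le_total 0 j with h | h
    · obtain ⟨n, rfl⟩ := Int.eq_ofNat_of_zero_le h
      rw [show (-(n : ℤ)).toNat = 0 by omega, show (n : ℤ).toNat = n by omega, Int.natAbs_natCast,
        pow_zero, mul_one]
      conv_lhs => rw [hz]
      rw [mul_pow, ← Complex.exp_nat_mul]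
      push_cast
      ring_nf
    · obtain ⟨n, rfl⟩ : ∃ n : ℕ, j = -n := ⟨j.natAbs, by omega⟩
      rw [show (-(n : ℤ)).toNat = 0 by omega, neg_neg, show (n : ℤ).toNat = n by omega,
        Int.natAbs_neg, Int.natAbs_natCast, pow_zero, one_mul]
      conv_lhs => rw [hz]
      rw [map_mul, ← Complex.exp_conj, map_mul, Complex.conj_ofReal, Complex.conj_ofReal,
        Complex.conj_I, mul_pow, ← Complex.exp_nat_mul]
      push_cast
      ring_nf
  rw [mono, conjMap_apply, conjMap_apply, key, mul_assoc, key]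
  push_cast
  rw [add_mul, Complex.exp_add]
  ring

/-- The common radial factor of the modes. -/
def radialFactor (d : ℕ) (ℓ m : ℤ) (x : E4) : ℝ :=
  ∑ i ∈ Finset.range (d + 1), modeCoeff d m.natAbs ℓ.natAbs i *
    ‖zFst x‖ ^ (ℓ.natAbs + 2 * i) * ‖zSnd x‖ ^ (m.natAbs + 2 * (d - i))

theorem mode_eq_exp (d : ℕ) (ℓ m : ℤ) (x : E4) :
    mode d ℓ m x = radialFactor d ℓ m x *
      Complex.exp ((ℓ * (zFst x).arg + m * (zSnd x).arg : ℝ) * Complex.I) := by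
  rw [mode, radialFactor, Complex.ofReal_sum, Finset.sum_mul]
  refine Finset.sum_congr rfl fun i _ => ?_
  have h : mono (ℓ.toNat + i) ((-ℓ).toNat + i) (m.toNat + (d - i)) ((-m).toNat + (d - i)) x =
      mono ℓ.toNat (-ℓ).toNat m.toNat (-m).toNat x * (zFst x * conj (zFst x)) ^ i *
        (zSnd x * conj (zSnd x)) ^ (d - i) := by
    simp only [mono, conjMap_apply]
    ring
  rw [h, mono_eq_exp, Complex.mul_conj, Complex.mul_conj, Complex.normSq_eq_norm_sq,
    Complex.normSq_eq_norm_sq]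
  push_cast
  ring

theorem mode_re (d : ℕ) (ℓ m : ℤ) (x : E4) : (mode d ℓ m x).re = radialFactor d ℓ m x *
    Real.cos (ℓ * (zFst x).arg + m * (zSnd x).arg) := by
  rw [mode_eq_exp, Complex.re_ofReal_mul, Complex.exp_ofReal_mul_I_re]

theorem mode_im (d : ℕ) (ℓ m : ℤ) (x : E4) : (mode d ℓ m x).im = radialFactor d ℓ m x *
    Real.sin (ℓ * (zFst x).arg + m * (zSnd x).arg) := by
  rw [mode_eq_exp, Complex.im_ofReal_mul, Complex.exp_ofReal_mul_I_im]

theorem circ_natCast (n : ℕ) (t : ℝ) : circ n t = Real.cos (n * t) := by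
  simp [circ]

theorem circ_neg_natCast (n : ℕ) (hn : 0 < n) (t : ℝ) : circ (-n) t = Real.sin (n * t) := by
  rw [circ, if_neg (by omega)]
  simp

theorem Psi_eq (k : ℕ) (ℓ m : ℤ) (p : S3) : Psi k ℓ m p = radialFactor (dNum k ℓ m) ℓ m p *
    (circ ℓ (zFst p).arg * circ m (zSnd p).arg) / psiNorm k ℓ m := by
  rw [Psi, psiTilde_eq_realMode]; rfl

@[simp] theorem dNum_neg_left (k : ℕ) (ℓ m : ℤ) : dNum k (-ℓ) m = dNum k ℓ m := by simp [dNum]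

@[simp] theorem dNum_neg_right (k : ℕ) (ℓ m : ℤ) : dNum k ℓ (-m) = dNum k ℓ m := by simp [dNum]

theorem dNum_comm (k : ℕ) (ℓ m : ℤ) : dNum k ℓ m = dNum k m ℓ := by simp [dNum, add_comm]

@[simp] theorem hat_neg (j : ℤ) : hat (-j) = hat j := by simp [hat]

@[simp] theorem psiNorm_neg_left (k : ℕ) (ℓ m : ℤ) : psiNorm k (-ℓ) m = psiNorm k ℓ m := by
  simp [psiNorm]

@[simp] theorem psiNorm_neg_right (k : ℕ) (ℓ m : ℤ) : psiNorm k ℓ (-m) = psiNorm k ℓ m := by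
  simp [psiNorm]

theorem psiNorm_comm (k : ℕ) (ℓ m : ℤ) : psiNorm k ℓ m = psiNorm k m ℓ := by
  rw [psiNorm, psiNorm, dNum_comm k ℓ m, add_comm (hat ℓ), add_comm ℓ.natAbs m.natAbs]
  congr 3
  ring

@[simp] theorem radialFactor_neg_left (d : ℕ) (ℓ m : ℤ) (x : E4) :
    radialFactor d (-ℓ) m x = radialFactor d ℓ m x := by simp [radialFactor]

@[simp] theorem radialFactor_neg_right (d : ℕ) (ℓ m : ℤ) (x : E4) :
    radialFactor d ℓ (-m) x = radialFactor d ℓ m x := by simp [radialFactor]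

/-- The modes `(ℓ, m)` and `(ℓ, -m)` share their radial factor, so product-to-sum formulas express
all four sign patterns of `Psi` by their real and imaginary parts. In the patterns containing a sine
the corresponding label must be positive, since label 0 denotes the cosine. -/
theorem Psi_nat_nat (k ℓ m : ℕ) (p : S3) : Psi k ℓ m p =
    ((mode (dNum k ℓ m) ℓ m p).re + (mode (dNum k ℓ m) ℓ (-m) p).re) / (2 * psiNorm k ℓ m) := by
  have := (psiNorm_pos k ℓ m).ne'
  rw [Psi_eq, circ_natCast, circ_natCast, mode_re, mode_re, radialFactor_neg_right]
  push_cast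
  rw [neg_mul, ← sub_eq_add_neg, Real.cos_add, Real.cos_sub]
  field_simp
  ring

theorem Psi_neg_neg (k ℓ m : ℕ) (hℓ : 0 < ℓ) (hm : 0 < m) (p : S3) : Psi k (-ℓ) (-m) p =
    ((mode (dNum k ℓ m) ℓ (-m) p).re - (mode (dNum k ℓ m) ℓ m p).re) / (2 * psiNorm k ℓ m) := by
  have := (psiNorm_pos k ℓ m).ne'
  rw [Psi_eq, circ_neg_natCast _ hℓ, circ_neg_natCast _ hm, mode_re, mode_re]
  simp only [radialFactor_neg_right, radialFactor_neg_left, dNum_neg_left, dNum_neg_right,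
    psiNorm_neg_left, psiNorm_neg_right]
  push_cast
  rw [neg_mul, ← sub_eq_add_neg, Real.cos_add, Real.cos_sub]
  field_simp
  ring

theorem Psi_nat_neg (k ℓ m : ℕ) (hm : 0 < m) (p : S3) : Psi k ℓ (-m) p =
    ((mode (dNum k ℓ m) ℓ m p).im - (mode (dNum k ℓ m) ℓ (-m) p).im) / (2 * psiNorm k ℓ m) := by
  have := (psiNorm_pos k ℓ m).ne'
  rw [Psi_eq, circ_natCast, circ_neg_natCast _ hm, mode_im, mode_im]
  simp only [radialFactor_neg_right, dNum_neg_right, psiNorm_neg_right]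
  push_cast
  rw [neg_mul, ← sub_eq_add_neg, Real.sin_add, Real.sin_sub]
  field_simp
  ring

theorem Psi_neg_nat (k ℓ m : ℕ) (hℓ : 0 < ℓ) (p : S3) : Psi k (-ℓ) m p =
    ((mode (dNum k ℓ m) ℓ m p).im + (mode (dNum k ℓ m) ℓ (-m) p).im) / (2 * psiNorm k ℓ m) := by
  have := (psiNorm_pos k ℓ m).ne'
  rw [Psi_eq, circ_natCast, circ_neg_natCast _ hℓ, mode_im, mode_im]
  simp only [radialFactor_neg_right, radialFactor_neg_left, dNum_neg_left, psiNorm_neg_left]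
  push_cast
  rw [neg_mul, ← sub_eq_add_neg, Real.sin_add, Real.sin_sub]
  field_simp
  ring

/-! ### The basis vectors as symmetrized modes -/

/-- The frequencies of the mode from which a basis vector is obtained by symmetrization. -/
def Label.freq : Label → ℤ × ℤ
  | .zero => (0, 0)
  | .axisEven₁ ℓ => (ℓ, 0)
  | .axisEven₂ ℓ => (ℓ, 0)
  | .axisOdd₁ ℓ => (ℓ, 0)
  | .axisOdd₂ ℓ => (ℓ, 0)
  | .diag₁ ℓ => (ℓ, -ℓ)
  | .diag₂ ℓ => (ℓ, -ℓ)
  | .diag₃ ℓ => (ℓ, ℓ)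
  | .diag₄ ℓ => (ℓ, ℓ)
  | .samePos₁ ℓ m => (ℓ, -m)
  | .samePos₂ ℓ m => (ℓ, -m)
  | .sameNeg₁ ℓ m => (ℓ, -m)
  | .sameNeg₂ ℓ m => (ℓ, -m)
  | .oppPos₁ ℓ m => (ℓ, m)
  | .oppPos₂ ℓ m => (ℓ, m)
  | .oppNeg₁ ℓ m => (ℓ, m)
  | .oppNeg₂ ℓ m => (ℓ, m)

/-- The part, real or imaginary, of the mode from which a basis vector is obtained. -/
def Label.part : Label → ℂ →L[ℝ] ℝ
  | .zero => Complex.reCLM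
  | .axisEven₁ _ => Complex.reCLM
  | .axisEven₂ _ => Complex.imCLM
  | .axisOdd₁ _ => Complex.reCLM
  | .axisOdd₂ _ => Complex.imCLM
  | .diag₁ _ => Complex.reCLM
  | .diag₂ _ => Complex.imCLM
  | .diag₃ _ => Complex.reCLM
  | .diag₄ _ => Complex.imCLM
  | .samePos₁ _ _ => Complex.reCLM
  | .samePos₂ _ _ => Complex.imCLM
  | .sameNeg₁ _ _ => Complex.reCLM
  | .sameNeg₂ _ _ => Complex.imCLM
  | .oppPos₁ _ _ => Complex.reCLM
  | .oppPos₂ _ _ => Complex.imCLM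
  | .oppNeg₁ _ _ => Complex.reCLM
  | .oppNeg₂ _ _ => Complex.imCLM

/-- The sum of a part of a mode and its translate under the quarter turn. -/
def symMode (L : ℂ →L[ℝ] ℝ) (d : ℕ) (ℓ m : ℤ) (p : S3) : ℝ :=
  L (mode d ℓ m p) + L (mode d ℓ m (quarterTurn p))

theorem symMode_of_even (L : ℂ →L[ℝ] ℝ) {d : ℕ} {m : ℤ} (h : Even (d + m.natAbs)) (ℓ : ℤ) (p : S3) :
    symMode L d ℓ m p = L (mode d ℓ m p) + L (mode d (-m) (-ℓ) p) := by
  rw [symMode, mode_quarterTurn, h.neg_one_pow, one_mul]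

theorem symMode_of_odd (L : ℂ →L[ℝ] ℝ) {d : ℕ} {m : ℤ} (h : Odd (d + m.natAbs)) (ℓ : ℤ) (p : S3) :
    symMode L d ℓ m p = L (mode d ℓ m p) - L (mode d (-m) (-ℓ) p) := by
  rw [symMode, mode_quarterTurn, h.neg_one_pow, neg_one_mul, map_neg, sub_eq_add_neg]

theorem mode_neg_neg_re (d : ℕ) (ℓ m : ℤ) (x : E4) :
    (mode d (-ℓ) (-m) x).re = (mode d ℓ m x).re := by
  rw [← conj_mode, Complex.conj_re]

theorem mode_neg_neg_im (d : ℕ) (ℓ m : ℤ) (x : E4) :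
    (mode d (-ℓ) (-m) x).im = -(mode d ℓ m x).im := by
  rw [← conj_mode, Complex.conj_im]

/-- For nonnegative labels `sigma` is exactly the sign in `mode_quarterTurn`. -/
theorem sigma_natCast (k ℓ m : ℕ) : sigma k ℓ m = (-1) ^ (dNum k ℓ m + m) := by
  rw [sigma, if_pos (Int.natCast_nonneg ℓ), if_pos (Int.natCast_nonneg m), pow_add]
  simp only [Int.even_coe_nat]
  rcases Nat.even_or_odd (dNum k ℓ m) with h | h <;> rcases Nat.even_or_odd m with h' | h' <;>
    simp [h, h', h.neg_one_pow, h'.neg_one_pow, Nat.not_even_iff_odd.mpr]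

theorem even_of_sigma_pos {k ℓ m : ℕ} (h : 0 < sigma k ℓ m) : Even (dNum k ℓ m + m) := by
  rw [sigma_natCast] at h
  by_contra h'
  rw [(Nat.not_even_iff_odd.mp h').neg_one_pow] at h
  omega

theorem odd_of_sigma_neg {k ℓ m : ℕ} (h : sigma k ℓ m < 0) : Odd (dNum k ℓ m + m) := by
  rw [sigma_natCast] at h
  by_contra h'
  rw [(Nat.not_odd_iff_even.mp h').neg_one_pow] at h
  omega

theorem Psi_nat_zero (k ℓ : ℕ) (p : S3) :
    Psi k ℓ 0 p = (mode (dNum k ℓ 0) ℓ 0 p).re / psiNorm k ℓ 0 := by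
  have h := Psi_nat_nat k ℓ 0 p
  have := (psiNorm_pos k ℓ 0).ne'
  simp only [Nat.cast_zero, neg_zero] at h
  rw [h]
  field_simp
  ring

theorem Psi_neg_zero (k ℓ : ℕ) (hℓ : 0 < ℓ) (p : S3) :
    Psi k (-ℓ) 0 p = (mode (dNum k ℓ 0) ℓ 0 p).im / psiNorm k ℓ 0 := by
  have h := Psi_neg_nat k ℓ 0 hℓ p
  have := (psiNorm_pos k ℓ 0).ne'
  simp only [Nat.cast_zero, neg_zero] at h
  rw [h]
  field_simp
  ring

theorem Psi_zero_nat (k ℓ : ℕ) (p : S3) :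
    Psi k 0 ℓ p = (mode (dNum k ℓ 0) 0 ℓ p).re / psiNorm k ℓ 0 := by
  have h := Psi_nat_nat k 0 ℓ p
  have e := mode_neg_neg_re (dNum k ℓ 0) 0 ℓ p
  have := (psiNorm_pos k ℓ 0).ne'
  simp only [Nat.cast_zero, dNum_comm k 0 ℓ, psiNorm_comm k 0 ℓ] at h
  rw [neg_zero] at e
  rw [h, e]
  field_simp
  ring

theorem Psi_zero_neg (k ℓ : ℕ) (hℓ : 0 < ℓ) (p : S3) :
    Psi k 0 (-ℓ) p = (mode (dNum k ℓ 0) 0 ℓ p).im / psiNorm k ℓ 0 := by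
  have h := Psi_nat_neg k 0 ℓ hℓ p
  have e := mode_neg_neg_im (dNum k ℓ 0) 0 ℓ p
  have := (psiNorm_pos k ℓ 0).ne'
  simp only [Nat.cast_zero, dNum_comm k 0 ℓ, psiNorm_comm k 0 ℓ] at h
  rw [neg_zero] at e
  rw [h, e]
  field_simp
  ring

theorem Psi_neg_neg_swap (k ℓ m : ℕ) (hℓ : 0 < ℓ) (hm : 0 < m) (p : S3) : Psi k (-m) (-ℓ) p =
    ((mode (dNum k ℓ m) m (-ℓ) p).re - (mode (dNum k ℓ m) m ℓ p).re) / (2 * psiNorm k ℓ m) := by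
  rw [Psi_neg_neg k m ℓ hm hℓ, dNum_comm k m ℓ, psiNorm_comm k m ℓ]

theorem Psi_nat_nat_swap (k ℓ m : ℕ) (p : S3) : Psi k m ℓ p =
    ((mode (dNum k ℓ m) m ℓ p).re + (mode (dNum k ℓ m) m (-ℓ) p).re) / (2 * psiNorm k ℓ m) := by
  rw [Psi_nat_nat k m ℓ, dNum_comm k m ℓ, psiNorm_comm k m ℓ]

theorem Psi_nat_neg_swap (k ℓ m : ℕ) (hℓ : 0 < ℓ) (p : S3) : Psi k m (-ℓ) p =
    ((mode (dNum k ℓ m) m ℓ p).im - (mode (dNum k ℓ m) m (-ℓ) p).im) / (2 * psiNorm k ℓ m) := by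
  rw [Psi_nat_neg k m ℓ hℓ, dNum_comm k m ℓ, psiNorm_comm k m ℓ]

theorem Psi_neg_nat_swap (k ℓ m : ℕ) (hm : 0 < m) (p : S3) : Psi k (-m) ℓ p =
    ((mode (dNum k ℓ m) m ℓ p).im + (mode (dNum k ℓ m) m (-ℓ) p).im) / (2 * psiNorm k ℓ m) := by
  rw [Psi_neg_nat k m ℓ hm, dNum_comm k m ℓ, psiNorm_comm k m ℓ]

/-- On the diagonal the quarter-turn sign `(-1) ^ (d + ℓ)` is therefore `(-1) ^ (k / 2)`, which is
the source of the conditions on `k` modulo 4. -/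
theorem dNum_diag_add {k ℓ : ℕ} (h : ModeExists k ℓ ℓ) : 2 * (dNum k ℓ ℓ + ℓ) = k := by
  have := h.add_eq
  omega

/-- Every basis vector is a symmetrized mode, up to a nonzero factor. -/
theorem Label.vec_eq_symMode {n k : ℕ} (c : Label) (hc : c.Cond n k) : ∃ κ : ℝ, κ ≠ 0 ∧
    ∀ p, c.vec k p = κ * symMode c.part (dNum k c.freq.1 c.freq.2) c.freq.1 c.freq.2 p := by
  have hr : √(1 / 2 : ℝ) ≠ 0 := by positivity
  have hN : ∀ ℓ m : ℤ, (psiNorm k ℓ m)⁻¹ ≠ 0 := fun ℓ m => inv_ne_zero (psiNorm_pos k ℓ m).ne'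
  cases c with
  | zero =>
    obtain ⟨h1, h2⟩ := hc
    have hk := h1.add_eq
    have he : Even (dNum k 0 0 + (0 : ℤ).natAbs) := by
      rw [Nat.even_iff]; have h3 : k % 4 = 0 := h2; simp at hk ⊢; omega
    -- The quarter turn fixes this mode, so symmetrization doubles it; hence the division by 2.
    refine ⟨(psiNorm k 0 0)⁻¹ / 2, div_ne_zero (hN _ _) two_ne_zero, fun p => ?_⟩
    have h := Psi_nat_zero k 0 p
    simp only [Label.vec, Label.freq, Label.part, symMode_of_even _ he, Nat.cast_zero, neg_zero,
      Complex.reCLM_apply] at h ⊢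
    rw [h]
    ring
  | axisEven₁ ℓ =>
    obtain ⟨⟨h0, -⟩, he⟩ := hc
    have he' : Even (dNum k ℓ 0 + (0 : ℤ).natAbs) := he
    refine ⟨√(1 / 2) * (psiNorm k ℓ 0)⁻¹, mul_ne_zero hr (hN _ _), fun p => ?_⟩
    have e := mode_neg_neg_re (dNum k ℓ 0) 0 ℓ p
    simp only [Label.vec, Label.freq, Label.part, symMode_of_even _ he', Pi.smul_apply,
      Pi.add_apply, smul_eq_mul, Complex.reCLM_apply, Psi_nat_zero, Psi_zero_nat, e]
    ring
  | axisEven₂ ℓ =>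
    obtain ⟨⟨h0, -⟩, he⟩ := hc
    have he' : Even (dNum k ℓ 0 + (0 : ℤ).natAbs) := he
    refine ⟨√(1 / 2) * (psiNorm k ℓ 0)⁻¹, mul_ne_zero hr (hN _ _), fun p => ?_⟩
    have e := mode_neg_neg_im (dNum k ℓ 0) 0 ℓ p
    simp only [Label.vec, Label.freq, Label.part, symMode_of_even _ he', Pi.smul_apply,
      Pi.sub_apply, smul_eq_mul, Complex.imCLM_apply, Psi_neg_zero k ℓ h0, Psi_zero_neg k ℓ h0, e]
    ring
  | axisOdd₁ ℓ =>
    obtain ⟨⟨h0, -⟩, he⟩ := hc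
    have he' : Odd (dNum k ℓ 0 + (0 : ℤ).natAbs) := he
    refine ⟨√(1 / 2) * (psiNorm k ℓ 0)⁻¹, mul_ne_zero hr (hN _ _), fun p => ?_⟩
    have e := mode_neg_neg_re (dNum k ℓ 0) 0 ℓ p
    simp only [Label.vec, Label.freq, Label.part, symMode_of_odd _ he', Pi.smul_apply,
      Pi.sub_apply, smul_eq_mul, Complex.reCLM_apply, Psi_nat_zero, Psi_zero_nat, e]
    ring
  | axisOdd₂ ℓ =>
    obtain ⟨⟨h0, -⟩, he⟩ := hc
    have he' : Odd (dNum k ℓ 0 + (0 : ℤ).natAbs) := he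
    refine ⟨√(1 / 2) * (psiNorm k ℓ 0)⁻¹, mul_ne_zero hr (hN _ _), fun p => ?_⟩
    have e := mode_neg_neg_im (dNum k ℓ 0) 0 ℓ p
    simp only [Label.vec, Label.freq, Label.part, symMode_of_odd _ he', Pi.smul_apply,
      Pi.add_apply, smul_eq_mul, Complex.imCLM_apply, Psi_neg_zero k ℓ h0, Psi_zero_neg k ℓ h0, e]
    ring
  | diag₁ ℓ =>
    obtain ⟨⟨h0, h1⟩, h2⟩ := hc
    have hk := dNum_diag_add h1
    have he : Even (dNum k ℓ ℓ + (-(ℓ : ℤ)).natAbs) := by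
      rw [Nat.even_iff]; have h3 : k % 4 = 0 := h2; simp; omega
    -- The frequencies `(ℓ, -ℓ)` are fixed by the quarter turn, so symmetrization again doubles the
    -- mode.
    refine ⟨√(1 / 2) * (psiNorm k ℓ ℓ)⁻¹ / 2, div_ne_zero (mul_ne_zero hr (hN _ _)) two_ne_zero,
      fun p => ?_⟩
    simp only [Label.vec, Label.freq, Label.part, dNum_neg_right, symMode_of_even _ he,
      Pi.smul_apply, Pi.add_apply, smul_eq_mul, Complex.reCLM_apply, Psi_nat_nat,
      Psi_neg_neg k ℓ ℓ h0 h0, neg_neg]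
    ring
  | diag₂ ℓ =>
    obtain ⟨⟨h0, h1⟩, h2⟩ := hc
    have hk := dNum_diag_add h1
    have he : Even (dNum k ℓ ℓ + (-(ℓ : ℤ)).natAbs) := by
      rw [Nat.even_iff]; have h3 : k % 4 = 0 := h2; simp; omega
    refine ⟨√(1 / 2) * (psiNorm k ℓ ℓ)⁻¹ / 2, div_ne_zero (mul_ne_zero hr (hN _ _)) two_ne_zero,
      fun p => ?_⟩
    simp only [Label.vec, Label.freq, Label.part, dNum_neg_right, symMode_of_even _ he,
      Pi.smul_apply, Pi.sub_apply, smul_eq_mul, Complex.imCLM_apply, Psi_nat_neg k ℓ ℓ h0,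
      Psi_neg_nat k ℓ ℓ h0, neg_neg]
    ring
  | diag₃ ℓ =>
    obtain ⟨⟨h0, h1⟩, -, h2⟩ := hc
    have hk := dNum_diag_add h1
    have he : Even (dNum k ℓ ℓ + (ℓ : ℤ).natAbs) := by
      rw [Nat.even_iff]; have h3 : k % 4 = 0 := h2; simp; omega
    refine ⟨√(1 / 2) * (psiNorm k ℓ ℓ)⁻¹ / 2, div_ne_zero (mul_ne_zero hr (hN _ _)) two_ne_zero,
      fun p => ?_⟩
    simp only [Label.vec, Label.freq, Label.part, symMode_of_even _ he, mode_neg_neg_re,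
      Pi.smul_apply, Pi.sub_apply, smul_eq_mul, Complex.reCLM_apply, Psi_nat_nat,
      Psi_neg_neg k ℓ ℓ h0 h0]
    ring
  | diag₄ ℓ =>
    obtain ⟨⟨h0, h1⟩, -, h2⟩ := hc
    have hk := dNum_diag_add h1
    have he : Odd (dNum k ℓ ℓ + (ℓ : ℤ).natAbs) := by
      rw [Nat.odd_iff]; have h3 : k % 4 = 2 := h2; simp; omega
    refine ⟨√(1 / 2) * (psiNorm k ℓ ℓ)⁻¹ / 2, div_ne_zero (mul_ne_zero hr (hN _ _)) two_ne_zero,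
      fun p => ?_⟩
    simp only [Label.vec, Label.freq, Label.part, symMode_of_odd _ he, mode_neg_neg_im,
      Pi.smul_apply, Pi.add_apply, smul_eq_mul, Complex.imCLM_apply, Psi_nat_neg k ℓ ℓ h0,
      Psi_neg_nat k ℓ ℓ h0]
    ring
  | samePos₁ ℓ m =>
    obtain ⟨⟨hm, hlt, -⟩, -, hs⟩ := hc
    have hℓ : 0 < ℓ := hm.trans hlt
    have he : Even (dNum k ℓ m + (-(m : ℤ)).natAbs) := by simpa using even_of_sigma_pos hs
    refine ⟨(psiNorm k ℓ m)⁻¹ / 2, div_ne_zero (hN _ _) two_ne_zero, fun p => ?_⟩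
    simp only [Label.vec, Label.freq, Label.part, dNum_neg_right, symMode_of_even _ he,
      Pi.smul_apply, Pi.add_apply, smul_eq_mul, Complex.reCLM_apply, Psi_nat_nat k ℓ m,
      Psi_neg_neg k ℓ m hℓ hm, Psi_nat_nat_swap k ℓ m, Psi_neg_neg_swap k ℓ m hℓ hm, neg_neg]
    ring
  | samePos₂ ℓ m =>
    obtain ⟨⟨hm, hlt, -⟩, -, hs⟩ := hc
    have hℓ : 0 < ℓ := hm.trans hlt
    have he : Even (dNum k ℓ m + (-(m : ℤ)).natAbs) := by simpa using even_of_sigma_pos hs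
    -- The difference of `Psi k ℓ (-m)` and `Psi k (-ℓ) m` is minus the imaginary part of the mode
    -- `(ℓ, -m)`, up to normalization.
    refine ⟨-((psiNorm k ℓ m)⁻¹ / 2), neg_ne_zero.mpr (div_ne_zero (hN _ _) two_ne_zero),
      fun p => ?_⟩
    simp only [Label.vec, Label.freq, Label.part, dNum_neg_right, symMode_of_even _ he,
      Pi.smul_apply, Pi.sub_apply, smul_eq_mul, Complex.imCLM_apply, Psi_nat_neg k ℓ m hm,
      Psi_neg_nat k ℓ m hℓ, Psi_nat_neg_swap k ℓ m hℓ, Psi_neg_nat_swap k ℓ m hm, neg_neg]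
    ring
  | sameNeg₁ ℓ m =>
    obtain ⟨⟨hm, hlt, -⟩, -, hs⟩ := hc
    have hℓ : 0 < ℓ := hm.trans hlt
    have he : Odd (dNum k ℓ m + (-(m : ℤ)).natAbs) := by simpa using odd_of_sigma_neg hs
    refine ⟨(psiNorm k ℓ m)⁻¹ / 2, div_ne_zero (hN _ _) two_ne_zero, fun p => ?_⟩
    simp only [Label.vec, Label.freq, Label.part, dNum_neg_right, symMode_of_odd _ he,
      Pi.smul_apply, Pi.add_apply, Pi.sub_apply, smul_eq_mul, Complex.reCLM_apply,
      Psi_nat_nat k ℓ m, Psi_neg_neg k ℓ m hℓ hm, Psi_nat_nat_swap k ℓ m,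
      Psi_neg_neg_swap k ℓ m hℓ hm, neg_neg]
    ring
  | sameNeg₂ ℓ m =>
    obtain ⟨⟨hm, hlt, -⟩, -, hs⟩ := hc
    have hℓ : 0 < ℓ := hm.trans hlt
    have he : Odd (dNum k ℓ m + (-(m : ℤ)).natAbs) := by simpa using odd_of_sigma_neg hs
    refine ⟨-((psiNorm k ℓ m)⁻¹ / 2), neg_ne_zero.mpr (div_ne_zero (hN _ _) two_ne_zero),
      fun p => ?_⟩
    simp only [Label.vec, Label.freq, Label.part, dNum_neg_right, symMode_of_odd _ he,
      Pi.smul_apply, Pi.sub_apply, Pi.add_apply, smul_eq_mul, Complex.imCLM_apply,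
      Psi_nat_neg k ℓ m hm, Psi_neg_nat k ℓ m hℓ, Psi_nat_neg_swap k ℓ m hℓ,
      Psi_neg_nat_swap k ℓ m hm, neg_neg]
    ring
  | oppPos₁ ℓ m =>
    obtain ⟨⟨hm, hlt, -⟩, -, hs⟩ := hc
    have hℓ : 0 < ℓ := hm.trans hlt
    have he : Even (dNum k ℓ m + (m : ℤ).natAbs) := by simpa using even_of_sigma_pos hs
    refine ⟨(psiNorm k ℓ m)⁻¹ / 2, div_ne_zero (hN _ _) two_ne_zero, fun p => ?_⟩
    simp only [Label.vec, Label.freq, Label.part, symMode_of_even _ he, mode_neg_neg_re,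
      Pi.smul_apply, Pi.add_apply, Pi.sub_apply, smul_eq_mul, Complex.reCLM_apply,
      Psi_nat_nat k ℓ m, Psi_neg_neg k ℓ m hℓ hm, Psi_nat_nat_swap k ℓ m,
      Psi_neg_neg_swap k ℓ m hℓ hm]
    ring
  | oppPos₂ ℓ m =>
    obtain ⟨⟨hm, hlt, -⟩, -, hs⟩ := hc
    have hℓ : 0 < ℓ := hm.trans hlt
    have he : Even (dNum k ℓ m + (m : ℤ).natAbs) := by simpa using even_of_sigma_pos hs
    refine ⟨(psiNorm k ℓ m)⁻¹ / 2, div_ne_zero (hN _ _) two_ne_zero, fun p => ?_⟩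
    simp only [Label.vec, Label.freq, Label.part, symMode_of_even _ he, mode_neg_neg_im,
      Pi.smul_apply, Pi.sub_apply, Pi.add_apply, smul_eq_mul, Complex.imCLM_apply,
      Psi_nat_neg k ℓ m hm, Psi_neg_nat k ℓ m hℓ, Psi_nat_neg_swap k ℓ m hℓ,
      Psi_neg_nat_swap k ℓ m hm]
    ring
  | oppNeg₁ ℓ m =>
    obtain ⟨⟨hm, hlt, -⟩, -, hs⟩ := hc
    have hℓ : 0 < ℓ := hm.trans hlt
    have he : Odd (dNum k ℓ m + (m : ℤ).natAbs) := by simpa using odd_of_sigma_neg hs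
    refine ⟨(psiNorm k ℓ m)⁻¹ / 2, div_ne_zero (hN _ _) two_ne_zero, fun p => ?_⟩
    simp only [Label.vec, Label.freq, Label.part, symMode_of_odd _ he, mode_neg_neg_re,
      Pi.smul_apply, Pi.sub_apply, smul_eq_mul, Complex.reCLM_apply,
      Psi_nat_nat k ℓ m, Psi_neg_neg k ℓ m hℓ hm, Psi_nat_nat_swap k ℓ m,
      Psi_neg_neg_swap k ℓ m hℓ hm]
    ring
  | oppNeg₂ ℓ m =>
    obtain ⟨⟨hm, hlt, -⟩, -, hs⟩ := hc
    have hℓ : 0 < ℓ := hm.trans hlt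
    have he : Odd (dNum k ℓ m + (m : ℤ).natAbs) := by simpa using odd_of_sigma_neg hs
    refine ⟨(psiNorm k ℓ m)⁻¹ / 2, div_ne_zero (hN _ _) two_ne_zero, fun p => ?_⟩
    simp only [Label.vec, Label.freq, Label.part, symMode_of_odd _ he, mode_neg_neg_im,
      Pi.smul_apply, Pi.add_apply, smul_eq_mul, Complex.imCLM_apply,
      Psi_nat_neg k ℓ m hm, Psi_neg_nat k ℓ m hℓ, Psi_nat_neg_swap k ℓ m hℓ,
      Psi_neg_nat_swap k ℓ m hm]
    ring

/-! ### Invariance of the symmetrized modes under the group. -/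

theorem modeExists_neg_left {k : ℕ} {ℓ m : ℤ} : ModeExists k (-ℓ) m ↔ ModeExists k ℓ m := by
  simp only [ModeExists, abs_neg, Int.ModEq]
  omega

theorem modeExists_neg_right {k : ℕ} {ℓ m : ℤ} : ModeExists k ℓ (-m) ↔ ModeExists k ℓ m := by
  simp only [ModeExists, abs_neg, Int.ModEq]
  omega

theorem modeExists_comm {k : ℕ} {ℓ m : ℤ} : ModeExists k ℓ m ↔ ModeExists k m ℓ := by
  simp only [ModeExists, add_comm]

/-- The frequencies of a basis vector are those of an existing mode, fixed by the corkscrew. -/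
theorem Label.freq_spec {n k : ℕ} (c : Label) (hc : c.Cond n k) :
    ModeExists k c.freq.1 c.freq.2 ∧ (2 * n : ℤ) ∣ c.freq.1 + c.freq.2 := by
  cases c with
  | zero => exact ⟨hc.1, by simp [Label.freq]⟩
  | axisEven₁ ℓ => exact ⟨hc.1.2.1, by simpa [Label.freq] using hc.1.2.2.symm.dvd⟩
  | axisEven₂ ℓ => exact ⟨hc.1.2.1, by simpa [Label.freq] using hc.1.2.2.symm.dvd⟩
  | axisOdd₁ ℓ => exact ⟨hc.1.2.1, by simpa [Label.freq] using hc.1.2.2.symm.dvd⟩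
  | axisOdd₂ ℓ => exact ⟨hc.1.2.1, by simpa [Label.freq] using hc.1.2.2.symm.dvd⟩
  | diag₁ ℓ => exact ⟨modeExists_neg_right.mpr hc.1.2, by simp [Label.freq]⟩
  | diag₂ ℓ => exact ⟨modeExists_neg_right.mpr hc.1.2, by simp [Label.freq]⟩
  | diag₃ ℓ => exact ⟨hc.1.2, by simpa [Label.freq, two_mul] using hc.2.1.symm.dvd⟩
  | diag₄ ℓ => exact ⟨hc.1.2, by simpa [Label.freq, two_mul] using hc.2.1.symm.dvd⟩
  | samePos₁ ℓ m => exact ⟨modeExists_neg_right.mpr hc.1.2.2, hc.2.1.symm.dvd⟩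
  | samePos₂ ℓ m => exact ⟨modeExists_neg_right.mpr hc.1.2.2, hc.2.1.symm.dvd⟩
  | sameNeg₁ ℓ m => exact ⟨modeExists_neg_right.mpr hc.1.2.2, hc.2.1.symm.dvd⟩
  | sameNeg₂ ℓ m => exact ⟨modeExists_neg_right.mpr hc.1.2.2, hc.2.1.symm.dvd⟩
  | oppPos₁ ℓ m => exact ⟨hc.1.2.2, by simpa [Label.freq] using hc.2.1.symm.dvd⟩
  | oppPos₂ ℓ m => exact ⟨hc.1.2.2, by simpa [Label.freq] using hc.2.1.symm.dvd⟩
  | oppNeg₁ ℓ m => exact ⟨hc.1.2.2, by simpa [Label.freq] using hc.2.1.symm.dvd⟩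
  | oppNeg₂ ℓ m => exact ⟨hc.1.2.2, by simpa [Label.freq] using hc.2.1.symm.dvd⟩

theorem mode_mem_of_degree {k d : ℕ} {ℓ m : ℤ} (h : ℓ.natAbs + m.natAbs + 2 * d = k)
    (L : ℂ →L[ℝ] ℝ) : (fun p : S3 => L (mode d ℓ m p)) ∈ sphericalHarmonics k :=
  h ▸ mode_mem_sphericalHarmonics d ℓ m L

theorem symMode_mem_sphericalHarmonics {k d : ℕ} {ℓ m : ℤ}
    (h : ℓ.natAbs + m.natAbs + 2 * d = k) (L : ℂ →L[ℝ] ℝ) :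
    symMode L d ℓ m ∈ sphericalHarmonics k := by
  have h1 := mode_mem_of_degree h L
  have h2 := mode_mem_of_degree (ℓ := -m) (m := -ℓ) (d := d) (k := k) (by omega) L
  rcases Nat.even_or_odd (d + m.natAbs) with he | ho
  · rw [funext fun p => symMode_of_even L he ℓ p]
    exact Submodule.add_mem _ h1 h2
  · rw [funext fun p => symMode_of_odd L ho ℓ p]
    exact Submodule.sub_mem _ h1 h2

theorem mode_corkscrew_of_dvd {n : ℕ} (hn : 1 ≤ n) (d : ℕ) {ℓ m : ℤ} (h : (2 * n : ℤ) ∣ ℓ + m)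
    (x : E4) : mode d ℓ m (corkscrew (2 * Real.pi / (2 * (n : ℝ))) x) = mode d ℓ m x := by
  obtain ⟨j, hj⟩ := h
  have hn' : (n : ℂ) ≠ 0 := by exact_mod_cast (by omega : n ≠ 0)
  rw [mode_corkscrew, hj]
  have : (((2 * n * j : ℤ) : ℂ) * (((2 * Real.pi / (2 * (n : ℝ)) : ℝ) : ℂ) * Complex.I)) =
      j * (2 * Real.pi * Complex.I) := by
    push_cast
    field_simp
  rw [this, Complex.exp_int_mul_two_pi_mul_I, one_mul]

/-- The square of the quarter turn is the antipodal map, which acts on a mode by the parity of its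
degree. Corkscrew invariance, with period `2 n`, makes that parity even. -/
theorem mode_quarterTurn_quarterTurn {d : ℕ} {ℓ m : ℤ} (h : Even (ℓ.natAbs + m.natAbs)) (x : E4) :
    mode d ℓ m (quarterTurn (quarterTurn x)) = mode d ℓ m x := by
  rw [mode_quarterTurn, mode_quarterTurn, neg_neg, neg_neg, Int.natAbs_neg, ← mul_assoc, ← pow_add]
  have : Even (d + m.natAbs + (d + ℓ.natAbs)) := by
    rw [Nat.even_iff] at h ⊢; omega
  rw [this.neg_one_pow, one_mul]

theorem even_natAbs_add {n : ℕ} {ℓ m : ℤ} (h : (2 * n : ℤ) ∣ ℓ + m) :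
    Even (ℓ.natAbs + m.natAbs) := by
  obtain ⟨j, hj⟩ := h
  rw [mul_assoc] at hj
  rw [Nat.even_iff]
  omega

theorem symMode_corkscrew {n : ℕ} (hn : 1 ≤ n) (L : ℂ →L[ℝ] ℝ) (d : ℕ) {ℓ m : ℤ}
    (h : (2 * n : ℤ) ∣ ℓ + m) (p : S3) :
    symMode L d ℓ m (sphereMap (corkscrew (2 * Real.pi / (2 * (n : ℝ)))) p) = symMode L d ℓ m p := by
  have h' : (2 * n : ℤ) ∣ -m + -ℓ := by
    rw [← neg_add, dvd_neg, add_comm]; exact h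
  simp only [symMode, mode_quarterTurn, sphereMap]
  rw [mode_corkscrew_of_dvd hn d h, mode_corkscrew_of_dvd hn d h']

theorem symMode_quarterTurn (L : ℂ →L[ℝ] ℝ) (d : ℕ) {ℓ m : ℤ}
    (h : Even (ℓ.natAbs + m.natAbs)) (p : S3) :
    symMode L d ℓ m (sphereMap quarterTurn p) = symMode L d ℓ m p := by
  simp only [symMode, sphereMap]
  rw [mode_quarterTurn_quarterTurn h, add_comm]

/-! ### Functions on the prism space -/

theorem lift_sphereMap {n : ℕ} (f : PrismSpace n → ℝ) {g : E4 ≃ₗᵢ[ℝ] E4}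
    (hg : g ∈ binaryDihedral n) (p : S3) : lift f (sphereMap g p) = lift f p := by
  have : proj n (sphereMap g p) = proj n p :=
    (Quotient.sound (s := orbitSetoid n) ⟨g, hg, rfl⟩).symm
  rw [lift, lift, this]

theorem exists_lift_eq {n : ℕ} {h : S3 → ℝ}
    (h1 : ∀ p, h (sphereMap (corkscrew (2 * Real.pi / (2 * (n : ℝ)))) p) = h p)
    (h2 : ∀ p, h (sphereMap quarterTurn p) = h p) : ∃ f : PrismSpace n → ℝ, lift f = h := by
  have hinv : ∀ g ∈ binaryDihedral n, ∀ p, h (sphereMap g p) = h p := by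
    intro g hg
    induction hg using Subgroup.closure_induction with
    | mem g hg =>
      rcases hg with rfl | rfl
      · exact h1
      · exact h2
    | one => exact fun p => rfl
    | mul g g' _ _ hg hg' => exact fun p => (hg (sphereMap g' p)).trans (hg' p)
    | inv g _ hg =>
      intro p
      rw [← hg (sphereMap g⁻¹ p)]
      congr 1
      ext1
      exact g.apply_symm_apply (p : E4)
  refine ⟨Quotient.lift h ?_, rfl⟩
  rintro p q ⟨g, hg, e⟩
  rw [← hinv g hg p]
  congr 1
  ext1
  exact e

theorem lift_injective {n : ℕ} : Function.Injective (lift : (PrismSpace n → ℝ) → S3 → ℝ) := by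
  intro f g h
  funext x
  obtain ⟨p, rfl⟩ := Quotient.exists_rep x
  exact congrFun h p

theorem Label.vec_mem_sphericalHarmonics {n k : ℕ} (c : Label) (hc : c.Cond n k) :
    c.vec k ∈ sphericalHarmonics k := by
  obtain ⟨κ, -, h⟩ := c.vec_eq_symMode hc
  rw [funext h]
  exact Submodule.smul_mem _ κ (symMode_mem_sphericalHarmonics (c.freq_spec hc).1.add_eq c.part)

theorem Label.exists_lift_eq_vec {n k : ℕ} (hn : 1 ≤ n) (c : Label) (hc : c.Cond n k) :
    ∃ f : PrismSpace n → ℝ, lift f = c.vec k := by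
  obtain ⟨κ, -, h⟩ := c.vec_eq_symMode hc
  obtain ⟨-, h2⟩ := c.freq_spec hc
  refine exists_lift_eq (fun p => ?_) fun p => ?_
  · rw [h, h, symMode_corkscrew hn _ _ h2]
  · rw [h, h, symMode_quarterTurn _ _ (even_natAbs_add h2)]

/-! ### Completeness -/

/-- The Fourier coefficient of a function with respect to a mode. -/
def modeIntegral (f : S3 → ℝ) (d : ℕ) (ℓ m : ℤ) : ℂ :=
  ∫ p, (f p : ℂ) * mode d ℓ m p ∂sphereMeasure

section modeIntegral

variable {f : S3 → ℝ} {d : ℕ} {ℓ m : ℤ}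

theorem integral_mul_part (hf : Continuous f) (L : ℂ →L[ℝ] ℝ) :
    ∫ p : S3, f p * L (mode d ℓ m p) ∂sphereMeasure = L (modeIntegral f d ℓ m) := by
  have hc : Continuous fun p : S3 => (f p : ℂ) * mode d ℓ m p :=
    (Complex.continuous_ofReal.comp hf).mul (continuous_mode d ℓ m)
  rw [modeIntegral, ← L.integral_comp_comm (integrable_of_continuous hc)]
  refine integral_congr_ae (.of_forall fun p => ?_)
  simp only
  rw [← Complex.real_smul, map_smul, smul_eq_mul]

theorem modeIntegral_eq_zero_of_parts (hf : Continuous f)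
    (h1 : ∫ p : S3, f p * Complex.reCLM (mode d ℓ m p) ∂sphereMeasure = 0)
    (h2 : ∫ p : S3, f p * Complex.imCLM (mode d ℓ m p) ∂sphereMeasure = 0) :
    modeIntegral f d ℓ m = 0 := by
  rw [integral_mul_part hf] at h1 h2
  exact Complex.ext h1 h2

theorem modeIntegral_neg_neg : modeIntegral f d (-ℓ) (-m) = conj (modeIntegral f d ℓ m) := by
  rw [modeIntegral, modeIntegral, ← integral_conj]
  simp only [map_mul, Complex.conj_ofReal, conj_mode]

theorem modeIntegral_swap (h : ∀ p, f (sphereMap quarterTurn p) = f p) :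
    modeIntegral f d ℓ m = (-1) ^ (d + m.natAbs) * modeIntegral f d (-m) (-ℓ) := by
  rw [modeIntegral, modeIntegral, ← integral_comp_sphereMap quarterTurn, ← integral_const_mul]
  refine integral_congr_ae (.of_forall fun p => ?_)
  simp only [h]
  simp only [sphereMap, mode_quarterTurn]
  ring

/-- A change of variables by the corkscrew multiplies the coefficient by `exp(i(ℓ+m)π/n)`, which
equals 1 only if `2n` divides `ℓ + m`. -/
theorem modeIntegral_eq_zero_of_not_dvd {n : ℕ} (hn : 1 ≤ n)
    (h : ∀ p, f (sphereMap (corkscrew (2 * Real.pi / (2 * (n : ℝ)))) p) = f p)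
    (hd : ¬ (2 * n : ℤ) ∣ ℓ + m) : modeIntegral f d ℓ m = 0 := by
  set t := 2 * Real.pi / (2 * (n : ℝ)) with ht
  have e : modeIntegral f d ℓ m =
      Complex.exp ((ℓ + m : ℤ) * (t * Complex.I)) * modeIntegral f d ℓ m := by
    conv_lhs => rw [modeIntegral, ← integral_comp_sphereMap (corkscrew t)]
    rw [modeIntegral, ← integral_const_mul]
    refine integral_congr_ae (.of_forall fun p => ?_)
    simp only [h]
    simp only [sphereMap, mode_corkscrew]
    ring
  by_contra hJ
  have h1 : Complex.exp ((ℓ + m : ℤ) * (t * Complex.I)) = 1 := by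
    have : (Complex.exp ((ℓ + m : ℤ) * (t * Complex.I)) - 1) * modeIntegral f d ℓ m = 0 := by
      rw [sub_mul, ← e]; ring
    exact sub_eq_zero.mp ((mul_eq_zero.mp this).resolve_right hJ)
  obtain ⟨j, hj⟩ := Complex.exp_eq_one_iff.mp h1
  apply hd
  refine ⟨j, ?_⟩
  have hn' : (n : ℂ) ≠ 0 := by exact_mod_cast (by omega : n ≠ 0)
  have hpi : (Real.pi : ℂ) ≠ 0 := by exact_mod_cast Real.pi_ne_zero
  have h2 : ((ℓ + m : ℤ) : ℂ) * (Real.pi * Complex.I) =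
      ((2 * n * j : ℤ) : ℂ) * (Real.pi * Complex.I) := by
    have h3 : (t : ℂ) * n = Real.pi := by
      rw [ht]; push_cast; field_simp
    calc ((ℓ + m : ℤ) : ℂ) * (Real.pi * Complex.I)
        = ((ℓ + m : ℤ) * (t * Complex.I)) * n := by rw [← h3]; ring
      _ = _ := by rw [hj]; push_cast; ring
  exact_mod_cast mul_right_cancel₀ (mul_ne_zero hpi Complex.I_ne_zero) h2

/-- For an invariant `f` both summands of the symmetrization have the same integral. Orthogonality
to one basis vector thus kills the real or imaginary part of one Fourier coefficient. -/
theorem integral_mul_symMode (hf : Continuous f) (h : ∀ p, f (sphereMap quarterTurn p) = f p)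
    (L : ℂ →L[ℝ] ℝ) :
    ∫ p, f p * symMode L d ℓ m p ∂sphereMeasure = 2 * L (modeIntegral f d ℓ m) := by
  have e2 : ∫ p : S3, f p * L (mode d ℓ m (quarterTurn p)) ∂sphereMeasure =
      L (modeIntegral f d ℓ m) := by
    rw [← integral_mul_part hf L, ← integral_comp_sphereMap quarterTurn
      (fun p : S3 => f p * L (mode d ℓ m p))]
    simp only [h]
    rfl
  have c1 : Continuous fun p : S3 => f p * L (mode d ℓ m p) :=
    hf.mul (L.continuous.comp (continuous_mode d ℓ m))
  have c2 : Continuous fun p : S3 => f p * L (mode d ℓ m (quarterTurn p)) :=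
    hf.mul (L.continuous.comp ((contDiff_mode d ℓ m).continuous.comp
      (quarterTurn.continuous.comp continuous_subtype_val)))
  simp only [symMode, mul_add]
  rw [integral_add (integrable_of_continuous c1) (integrable_of_continuous c2), e2,
    integral_mul_part hf L, two_mul]

/-- This covers the parts that contribute no basis vector because their symmetrization cancels. -/
theorem part_modeIntegral_eq_zero_of_symMode (hf : Continuous f)
    (h : ∀ p, f (sphereMap quarterTurn p) = f p) (L : ℂ →L[ℝ] ℝ)
    (h0 : ∀ p, symMode L d ℓ m p = 0) : L (modeIntegral f d ℓ m) = 0 := by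
  have e := integral_mul_symMode (d := d) (ℓ := ℓ) (m := m) hf h L
  simp only [h0, mul_zero, integral_zero] at e
  linarith

theorem part_modeIntegral_eq_zero_of_label {n k : ℕ} (hf : Continuous f)
    (h : ∀ p, f (sphereMap quarterTurn p) = f p) (c : Label) (hc : c.Cond n k)
    (h0 : ∫ p, f p * c.vec k p ∂sphereMeasure = 0) :
    c.part (modeIntegral f (dNum k c.freq.1 c.freq.2) c.freq.1 c.freq.2) = 0 := by
  obtain ⟨κ, hκ, e⟩ := c.vec_eq_symMode hc
  have e2 := integral_mul_symMode (d := dNum k c.freq.1 c.freq.2) (ℓ := c.freq.1) (m := c.freq.2)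
    hf h c.part
  have e3 : ∀ p, f p * c.vec k p =
      κ * (f p * symMode c.part (dNum k c.freq.1 c.freq.2) c.freq.1 c.freq.2 p) := fun p => by
    rw [e]; ring
  simp only [e3] at h0
  rw [integral_const_mul, e2] at h0
  have := (mul_eq_zero.mp h0).resolve_left hκ
  linarith

end modeIntegral

theorem zmod_zero_of_dvd {a b : ℤ} (h : b ∣ a) : a ≡ 0 [ZMOD b] :=
  (Int.modEq_zero_iff_dvd).mpr h

/-- The hypotheses on a function under which all its Fourier coefficients of degree `k` vanish. -/
structure OrthogonalToBasis (n k : ℕ) (f : S3 → ℝ) : Prop where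
  continuous : Continuous f
  corkscrew : ∀ p, f (sphereMap (Prism.corkscrew (2 * Real.pi / (2 * (n : ℝ)))) p) = f p
  quarterTurn : ∀ p, f (sphereMap Prism.quarterTurn p) = f p
  orthogonal : ∀ c : Label, c.Cond n k → ∫ p, f p * c.vec k p ∂sphereMeasure = 0

namespace OrthogonalToBasis

variable {n k : ℕ} {f : S3 → ℝ}

theorem part_eq_zero (H : OrthogonalToBasis n k f) {L : ℂ →L[ℝ] ℝ} {ℓ m : ℤ} (c : Label)
    (hc : c.Cond n k) (hL : c.part = L) (hfreq : c.freq = (ℓ, m)) :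
    L (modeIntegral f (dNum k ℓ m) ℓ m) = 0 := by
  have := part_modeIntegral_eq_zero_of_label H.continuous H.quarterTurn c hc (H.orthogonal c hc)
  rwa [hL, hfreq] at this

theorem zero_zero (H : OrthogonalToBasis n k f) (he : ModeExists k 0 0) :
    modeIntegral f (dNum k 0 0) 0 0 = 0 := by
  have hk := he.add_eq
  refine Complex.ext ?_ ?_
  · rcases Nat.even_or_odd (dNum k 0 0) with hd | hd
    · refine H.part_eq_zero (L := Complex.reCLM) .zero ⟨he, ?_⟩ rfl rfl
      show k % 4 = 0 % 4
      rw [Nat.even_iff] at hd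
      simp at hk
      omega
    · refine part_modeIntegral_eq_zero_of_symMode H.continuous H.quarterTurn Complex.reCLM fun p => ?_
      rw [symMode_of_odd _ (by simpa using hd)]
      simp
  -- The coefficient at `(0, 0)` is its own conjugate, hence real.
  · have := congrArg Complex.im (modeIntegral_neg_neg (f := f) (d := dNum k 0 0) (ℓ := 0) (m := 0))
    simp only [neg_zero, Complex.conj_im] at this
    show (modeIntegral f (dNum k 0 0) 0 0).im = 0
    linarith

theorem axis (H : OrthogonalToBasis n k f) {ℓ : ℕ} (hℓ : 0 < ℓ) (he : ModeExists k ℓ 0)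
    (hd : (2 * n : ℤ) ∣ ℓ + 0) : modeIntegral f (dNum k ℓ 0) ℓ 0 = 0 := by
  have hA : AxisCond n k ℓ := ⟨hℓ, he, zmod_zero_of_dvd (by simpa using hd)⟩
  rcases Nat.even_or_odd (dNum k ℓ 0) with h | h
  · exact Complex.ext (H.part_eq_zero (L := Complex.reCLM) (.axisEven₁ ℓ) ⟨hA, h⟩ rfl rfl)
      (H.part_eq_zero (L := Complex.imCLM) (.axisEven₂ ℓ) ⟨hA, h⟩ rfl rfl)
  · exact Complex.ext (H.part_eq_zero (L := Complex.reCLM) (.axisOdd₁ ℓ) ⟨hA, h⟩ rfl rfl)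
      (H.part_eq_zero (L := Complex.imCLM) (.axisOdd₂ ℓ) ⟨hA, h⟩ rfl rfl)

/-- The quarter turn maps the frequencies `(ℓ, -ℓ)` to themselves with sign `(-1) ^ (k / 2)`: either
both parts give basis vectors or both symmetrizations vanish. -/
theorem antidiag (H : OrthogonalToBasis n k f) {ℓ : ℕ} (hℓ : 0 < ℓ) (he : ModeExists k ℓ ℓ) :
    modeIntegral f (dNum k ℓ (-ℓ)) ℓ (-ℓ) = 0 := by
  have hk := dNum_diag_add he
  rcases Nat.even_or_odd (dNum k ℓ ℓ + ℓ) with h | h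
  · have h4 : k ≡ 0 [MOD 4] := by
      show k % 4 = 0 % 4
      rw [Nat.even_iff] at h; omega
    exact Complex.ext (H.part_eq_zero (L := Complex.reCLM) (.diag₁ ℓ) ⟨⟨hℓ, he⟩, h4⟩ rfl rfl)
      (H.part_eq_zero (L := Complex.imCLM) (.diag₂ ℓ) ⟨⟨hℓ, he⟩, h4⟩ rfl rfl)
  · have h0 : ∀ L : ℂ →L[ℝ] ℝ, L (modeIntegral f (dNum k ℓ (-ℓ)) ℓ (-ℓ)) = 0 := fun L => by
      refine part_modeIntegral_eq_zero_of_symMode H.continuous H.quarterTurn L fun p => ?_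
      rw [symMode_of_odd _ (by simpa using h), neg_neg, sub_self]
    exact Complex.ext (h0 Complex.reCLM) (h0 Complex.imCLM)

/-- The quarter turn maps the mode `(ℓ, ℓ)` to its conjugate up to the sign `(-1) ^ (k / 2)`. For
either sign one of the real and imaginary parts gives a basis vector and the other cancels. -/
theorem diag (H : OrthogonalToBasis n k f) {ℓ : ℕ} (hℓ : 0 < ℓ) (he : ModeExists k ℓ ℓ)
    (hd : (2 * n : ℤ) ∣ ℓ + ℓ) : modeIntegral f (dNum k ℓ ℓ) ℓ ℓ = 0 := by
  have hk := dNum_diag_add he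
  have hz : (2 * ℓ : ℤ) ≡ 0 [ZMOD 2 * n] := zmod_zero_of_dvd (by rwa [two_mul (ℓ : ℤ)])
  rcases Nat.even_or_odd (dNum k ℓ ℓ + ℓ) with h | h
  · have h4 : k ≡ 0 [MOD 4] := by
      show k % 4 = 0 % 4
      rw [Nat.even_iff] at h; omega
    refine Complex.ext
      (H.part_eq_zero (L := Complex.reCLM) (.diag₃ ℓ) ⟨⟨hℓ, he⟩, hz, h4⟩ rfl rfl)
      (part_modeIntegral_eq_zero_of_symMode H.continuous H.quarterTurn Complex.imCLM fun p => ?_)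
    rw [symMode_of_even _ (by simpa using h), Complex.imCLM_apply, Complex.imCLM_apply,
      mode_neg_neg_im, add_neg_cancel]
  · have h4 : k ≡ 2 [MOD 4] := by
      show k % 4 = 2 % 4
      rw [Nat.odd_iff] at h; omega
    refine Complex.ext
      (part_modeIntegral_eq_zero_of_symMode H.continuous H.quarterTurn Complex.reCLM fun p => ?_)
      (H.part_eq_zero (L := Complex.imCLM) (.diag₄ ℓ) ⟨⟨hℓ, he⟩, hz, h4⟩ rfl rfl)
    rw [symMode_of_odd _ (by simpa using h), Complex.reCLM_apply, Complex.reCLM_apply,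
      mode_neg_neg_re, sub_self]

theorem sigma_pos_or_neg (k ℓ m : ℕ) : 0 < sigma k ℓ m ∨ sigma k ℓ m < 0 := by
  rw [sigma_natCast]
  rcases Nat.even_or_odd (dNum k ℓ m + m) with h | h <;> simp [h.neg_one_pow]

theorem generic_pos (H : OrthogonalToBasis n k f) {ℓ m : ℕ} (hG : GenericRange k ℓ m)
    (hd : (2 * n : ℤ) ∣ ℓ + m) : modeIntegral f (dNum k ℓ m) ℓ m = 0 := by
  have hz : (ℓ : ℤ) ≡ -m [ZMOD 2 * n] :=
    (Int.modEq_iff_dvd.mpr (by simpa using hd)).symm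
  rcases sigma_pos_or_neg k ℓ m with h | h
  · exact Complex.ext (H.part_eq_zero (L := Complex.reCLM) (.oppPos₁ ℓ m) ⟨hG, hz, h⟩ rfl rfl)
      (H.part_eq_zero (L := Complex.imCLM) (.oppPos₂ ℓ m) ⟨hG, hz, h⟩ rfl rfl)
  · exact Complex.ext (H.part_eq_zero (L := Complex.reCLM) (.oppNeg₁ ℓ m) ⟨hG, hz, h⟩ rfl rfl)
      (H.part_eq_zero (L := Complex.imCLM) (.oppNeg₂ ℓ m) ⟨hG, hz, h⟩ rfl rfl)

theorem generic_neg (H : OrthogonalToBasis n k f) {ℓ m : ℕ} (hG : GenericRange k ℓ m)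
    (hd : (2 * n : ℤ) ∣ ℓ + -m) : modeIntegral f (dNum k ℓ (-m)) ℓ (-m) = 0 := by
  have hz : (ℓ : ℤ) ≡ m [ZMOD 2 * n] := (Int.modEq_iff_dvd.mpr hd).symm
  rcases sigma_pos_or_neg k ℓ m with h | h
  · exact Complex.ext (H.part_eq_zero (L := Complex.reCLM) (.samePos₁ ℓ m) ⟨hG, hz, h⟩ rfl rfl)
      (H.part_eq_zero (L := Complex.imCLM) (.samePos₂ ℓ m) ⟨hG, hz, h⟩ rfl rfl)
  · exact Complex.ext (H.part_eq_zero (L := Complex.reCLM) (.sameNeg₁ ℓ m) ⟨hG, hz, h⟩ rfl rfl)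
      (H.part_eq_zero (L := Complex.imCLM) (.sameNeg₂ ℓ m) ⟨hG, hz, h⟩ rfl rfl)

theorem of_natAbs_le (H : OrthogonalToBasis n k f) (hn : 1 ≤ n) {ℓ : ℕ} {m : ℤ}
    (hm : m.natAbs ≤ ℓ) (he : ModeExists k ℓ m) : modeIntegral f (dNum k ℓ m) ℓ m = 0 := by
  by_cases hd : (2 * n : ℤ) ∣ ℓ + m
  swap
  · exact modeIntegral_eq_zero_of_not_dvd hn H.corkscrew hd
  rcases lt_trichotomy m 0 with h | rfl | h
  · obtain ⟨j, rfl⟩ : ∃ j : ℕ, m = -j := ⟨m.natAbs, by omega⟩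
    rw [Int.natAbs_neg, Int.natAbs_natCast] at hm
    rcases hm.lt_or_eq with h' | rfl
    · exact H.generic_neg ⟨by omega, h', modeExists_neg_right.mp he⟩ hd
    · exact H.antidiag (by omega) (modeExists_neg_right.mp he)
  · rcases Nat.eq_zero_or_pos ℓ with rfl | h'
    · exact H.zero_zero he
    · exact H.axis h' he hd
  · obtain ⟨j, rfl⟩ := Int.eq_ofNat_of_zero_le h.le
    rw [Int.natAbs_natCast] at hm
    rcases hm.lt_or_eq with h' | rfl
    · exact H.generic_pos ⟨by omega, h', he⟩ hd
    · exact H.diag (by omega) he hd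

/-- Conjugation sends `(ℓ, m)` to `(-ℓ, -m)` and the quarter turn sends it to `(-m, -ℓ)`. Together
they move every pair of frequencies to one with `|m| ≤ ℓ`. -/
theorem modeIntegral_eq_zero (H : OrthogonalToBasis n k f) (hn : 1 ≤ n) {ℓ m : ℤ}
    (he : ModeExists k ℓ m) : modeIntegral f (dNum k ℓ m) ℓ m = 0 := by
  have key : ∀ a b : ℤ, b.natAbs ≤ a.natAbs → ModeExists k a b →
      modeIntegral f (dNum k a b) a b = 0 := by
    intro a b hab hab'
    rcases le_total 0 a with h | h
    · obtain ⟨j, rfl⟩ := Int.eq_ofNat_of_zero_le h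
      exact H.of_natAbs_le hn (by simpa using hab) hab'
    · obtain ⟨j, rfl⟩ : ∃ j : ℕ, a = -j := ⟨a.natAbs, by omega⟩
      have h1 := H.of_natAbs_le hn (ℓ := j) (m := -b) (by simpa using hab)
        (modeExists_neg_right.mpr (modeExists_neg_left.mp hab'))
      have h2 := modeIntegral_neg_neg (f := f) (d := dNum k j (-b)) (ℓ := j) (m := -b)
      rw [h1, map_zero, neg_neg] at h2
      simpa using h2
  rcases le_total m.natAbs ℓ.natAbs with h | h
  · exact key ℓ m h he
  · have h1 := key (-m) (-ℓ) (by simpa using h)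
      (modeExists_neg_left.mpr (modeExists_neg_right.mpr (modeExists_comm.mp he)))
    rw [modeIntegral_swap H.quarterTurn]
    simp only [dNum_neg_left, dNum_neg_right, dNum_comm k m ℓ] at h1
    rw [h1, mul_zero]

end OrthogonalToBasis

theorem eigenvalue_injective {k k' : ℕ} (h : -((k : ℝ) * (k + 2)) = -((k' : ℝ) * (k' + 2))) :
    k = k' := by
  have h1 : ((k : ℝ) - k') * (k + k' + 2) = 0 := by linear_combination -h
  have h2 : ((k : ℝ) + k' + 2) ≠ 0 := by positivity
  have h3 := sub_eq_zero.mp ((mul_eq_zero.mp h1).resolve_right h2)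
  exact_mod_cast h3

/-- The coefficients of an eigenfunction at modes with another eigenvalue vanish. -/
theorem modeIntegral_eq_zero_of_eigenvalue_ne {f : S3 → ℝ} (hf : ContMDiff (𝓡 3) 𝓘(ℝ, ℝ) ∞ f)
    {lam : ℝ} (hl : ∀ p, sphereLaplacian f p = lam * f p) {d k : ℕ} {ℓ m : ℤ}
    (hk : ℓ.natAbs + m.natAbs + 2 * d = k) (hne : lam ≠ -((k : ℝ) * (k + 2))) :
    modeIntegral f d ℓ m = 0 := by
  have h : ∀ L : ℂ →L[ℝ] ℝ, ∫ p : S3, f p * L (mode d ℓ m p) ∂sphereMeasure = 0 := fun L =>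
    integral_mul_eq_zero_of_eigenvalue_ne hf
      (contMDiff_of_mem_sphericalHarmonics (mode_mem_of_degree hk L)) hl
      (sphereLaplacian_of_mem_sphericalHarmonics (mode_mem_of_degree hk L)) hne
  exact modeIntegral_eq_zero_of_parts hf.continuous (h _) (h _)

theorem modeExists_of_degree {d k : ℕ} {ℓ m : ℤ} (h : ℓ.natAbs + m.natAbs + 2 * d = k) :
    ModeExists k ℓ m ∧ dNum k ℓ m = d := by
  refine ⟨⟨?_, ?_⟩, ?_⟩
  · rw [Int.abs_eq_natAbs, Int.abs_eq_natAbs]; omega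
  · rw [Int.ModEq]; omega
  · unfold dNum; omega

/-! ### Orthonormality of the basis vectors -/

/-- The nonnegative frequencies that, with signs and order, occur in a basis vector. -/
def Label.pair : Label → ℕ × ℕ
  | .zero => (0, 0)
  | .axisEven₁ ℓ => (ℓ, 0)
  | .axisEven₂ ℓ => (ℓ, 0)
  | .axisOdd₁ ℓ => (ℓ, 0)
  | .axisOdd₂ ℓ => (ℓ, 0)
  | .diag₁ ℓ => (ℓ, ℓ)
  | .diag₂ ℓ => (ℓ, ℓ)
  | .diag₃ ℓ => (ℓ, ℓ)
  | .diag₄ ℓ => (ℓ, ℓ)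
  | .samePos₁ ℓ m => (ℓ, m)
  | .samePos₂ ℓ m => (ℓ, m)
  | .sameNeg₁ ℓ m => (ℓ, m)
  | .sameNeg₂ ℓ m => (ℓ, m)
  | .oppPos₁ ℓ m => (ℓ, m)
  | .oppPos₂ ℓ m => (ℓ, m)
  | .oppNeg₁ ℓ m => (ℓ, m)
  | .oppNeg₂ ℓ m => (ℓ, m)

/-- The frequencies obtained from a pair by changes of signs and order. -/
def signedPairs (q : ℕ × ℕ) : Fin 8 → ℤ × ℤ :=
  ![(q.1, q.2), (-q.1, -q.2), (q.2, q.1), (-q.2, -q.1),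
    (q.1, -q.2), (-q.1, q.2), (-q.2, q.1), (q.2, -q.1)]

/-- The coefficients of a basis vector with respect to the modes, up to a common factor. -/
def Label.sign : Label → Fin 8 → ℤ
  | .zero => ![1, 0, 0, 0, 0, 0, 0, 0]
  | .axisEven₁ _ => ![1, 0, 1, 0, 0, 0, 0, 0]
  | .axisEven₂ _ => ![0, 1, 0, -1, 0, 0, 0, 0]
  | .axisOdd₁ _ => ![1, 0, -1, 0, 0, 0, 0, 0]
  | .axisOdd₂ _ => ![0, 1, 0, 1, 0, 0, 0, 0]
  | .diag₁ _ => ![1, 1, 0, 0, 0, 0, 0, 0]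
  | .diag₂ _ => ![0, 0, 0, 0, -1, 1, 0, 0]
  | .diag₃ _ => ![1, -1, 0, 0, 0, 0, 0, 0]
  | .diag₄ _ => ![0, 0, 0, 0, 1, 1, 0, 0]
  | .samePos₁ _ _ => ![1, 1, 1, 1, 0, 0, 0, 0]
  | .samePos₂ _ _ => ![0, 0, 0, 0, 1, -1, -1, 1]
  | .sameNeg₁ _ _ => ![1, 1, -1, -1, 0, 0, 0, 0]
  | .sameNeg₂ _ _ => ![0, 0, 0, 0, 1, -1, 1, -1]
  | .oppPos₁ _ _ => ![1, -1, 1, -1, 0, 0, 0, 0]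
  | .oppPos₂ _ _ => ![0, 0, 0, 0, 1, 1, -1, -1]
  | .oppNeg₁ _ _ => ![1, -1, -1, 1, 0, 0, 0, 0]
  | .oppNeg₂ _ _ => ![0, 0, 0, 0, 1, 1, 1, 1]

/-- The normalizing factor of a basis vector. -/
def Label.scale : Label → ℝ
  | .zero => 1
  | .axisEven₁ _ => √(1 / 2)
  | .axisEven₂ _ => √(1 / 2)
  | .axisOdd₁ _ => √(1 / 2)
  | .axisOdd₂ _ => √(1 / 2)
  | .diag₁ _ => √(1 / 2)
  | .diag₂ _ => √(1 / 2)
  | .diag₃ _ => √(1 / 2)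
  | .diag₄ _ => √(1 / 2)
  | .samePos₁ _ _ => 1 / 2
  | .samePos₂ _ _ => 1 / 2
  | .sameNeg₁ _ _ => 1 / 2
  | .sameNeg₂ _ _ => 1 / 2
  | .oppPos₁ _ _ => 1 / 2
  | .oppPos₂ _ _ => 1 / 2
  | .oppNeg₁ _ _ => 1 / 2
  | .oppNeg₂ _ _ => 1 / 2

/-- The range of the frequencies in a label. -/
def Label.Range : Label → Prop
  | .zero => True
  | .axisEven₁ ℓ => 0 < ℓ
  | .axisEven₂ ℓ => 0 < ℓ
  | .axisOdd₁ ℓ => 0 < ℓ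
  | .axisOdd₂ ℓ => 0 < ℓ
  | .diag₁ ℓ => 0 < ℓ
  | .diag₂ ℓ => 0 < ℓ
  | .diag₃ ℓ => 0 < ℓ
  | .diag₄ ℓ => 0 < ℓ
  | .samePos₁ ℓ m => 0 < m ∧ m < ℓ
  | .samePos₂ ℓ m => 0 < m ∧ m < ℓ
  | .sameNeg₁ ℓ m => 0 < m ∧ m < ℓ
  | .sameNeg₂ ℓ m => 0 < m ∧ m < ℓ
  | .oppPos₁ ℓ m => 0 < m ∧ m < ℓ
  | .oppPos₂ ℓ m => 0 < m ∧ m < ℓ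
  | .oppNeg₁ ℓ m => 0 < m ∧ m < ℓ
  | .oppNeg₂ ℓ m => 0 < m ∧ m < ℓ

theorem Label.Cond.range {n k : ℕ} {c : Label} (hc : c.Cond n k) : c.Range := by
  cases c
  case zero => trivial
  all_goals first
    | exact hc.1.1
    | exact ⟨hc.1.1, hc.1.2.1⟩

theorem Label.Range.pair_le {c : Label} (hc : c.Range) : c.pair.2 ≤ c.pair.1 := by
  cases c <;> simp only [Label.Range, Label.pair] at hc ⊢ <;> omega

theorem Label.Cond.modeExists {n k : ℕ} {c : Label} (hc : c.Cond n k) :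
    ModeExists k c.pair.1 c.pair.2 := by
  cases c
  case zero => exact hc.1
  all_goals first
    | exact hc.1.2
    | exact hc.1.2.1
    | exact hc.1.2.2

theorem modeExists_signedPairs {k : ℕ} {q : ℕ × ℕ} (h : ModeExists k q.1 q.2) (i : Fin 8) :
    ModeExists k (signedPairs q i).1 (signedPairs q i).2 := by
  have h' := modeExists_comm.mp h
  fin_cases i <;>
    simp [signedPairs, modeExists_neg_left, modeExists_neg_right, h, h']

/-- A uniform expansion over eight positions, so that inner products of basis vectors become dot
products of sign vectors. -/
theorem vec_eq_sum (k : ℕ) (c : Label) (p : S3) : c.vec k p =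
    ∑ i, c.scale * c.sign i * Psi k (signedPairs c.pair i).1 (signedPairs c.pair i).2 p := by
  cases c <;> rw [Fin.sum_univ_eight] <;>
    simp only [Label.vec, Label.scale, Label.sign, Label.pair, signedPairs, Pi.smul_apply,
      Pi.add_apply, Pi.sub_apply, smul_eq_mul, Matrix.cons_val, Int.cast_zero, Int.cast_one,
      Int.cast_neg, Nat.cast_zero, neg_zero] <;> ring

theorem natAbs_signedPairs (q : ℕ × ℕ) (h : q.2 ≤ q.1) (i : Fin 8) :
    (max (signedPairs q i).1.natAbs (signedPairs q i).2.natAbs,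
      min (signedPairs q i).1.natAbs (signedPairs q i).2.natAbs) = q := by
  obtain ⟨a, b⟩ := q
  have h' : b ≤ a := h
  fin_cases i <;> simp [signedPairs, h']

theorem pair_eq_of_signedPairs_eq {q q' : ℕ × ℕ} (h : q.2 ≤ q.1) (h' : q'.2 ≤ q'.1) {i j : Fin 8}
    (e : signedPairs q i = signedPairs q' j) : q = q' := by
  rw [← natAbs_signedPairs q h i, ← natAbs_signedPairs q' h' j, e]

/-- The indices for which `signedPairs q` takes pairwise distinct values. -/
def RelevantIndex (q : ℕ × ℕ) (i : Fin 8) : Prop :=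
  (q.2 = 0 → i < 4) ∧ (q.1 = q.2 → i = 0 ∨ i = 1 ∨ i = 4 ∨ i = 5) ∧ (q.1 = 0 → i = 0)

theorem relevantIndex_of_sign_ne_zero {c : Label} (hc : c.Range) {i : Fin 8} (h : c.sign i ≠ 0) :
    RelevantIndex c.pair i := by
  revert h
  cases c <;> simp only [Label.Range] at hc <;> fin_cases i <;>
    simp [Label.sign, RelevantIndex, Label.pair] <;> omega

/-- The eight signed pairs coincide partly when `q` has a zero entry or equal entries. The relevant
indices pick one representative of each, and the sign vectors are supported there. -/
theorem signedPairs_injOn {q : ℕ × ℕ} (h : q.2 ≤ q.1) {i j : Fin 8} (hi : RelevantIndex q i)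
    (hj : RelevantIndex q j) (e : signedPairs q i = signedPairs q j) : i = j := by
  obtain ⟨a, b⟩ := q
  revert hi hj e
  fin_cases i <;> fin_cases j <;> simp [RelevantIndex, signedPairs] <;> omega

theorem sum_sign_mul_self (c : Label) : c.scale * c.scale * (∑ i, c.sign i * c.sign i : ℤ) = 1 := by
  have hr : √(1 / 2 : ℝ) * √(1 / 2) = 1 / 2 := Real.mul_self_sqrt (by norm_num)
  cases c <;> rw [Fin.sum_univ_eight] <;>
    simp only [Label.scale, Label.sign, Matrix.cons_val, hr] <;> norm_num

/-- Within the ranges, equal pairs force both labels into the same family: zero, axis, diagonal or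
generic. Sign vectors of one family are mutually orthogonal, even for labels whose parity conditions
exclude each other. -/
theorem sum_sign_mul {c c' : Label} (hc : c.Range) (hc' : c'.Range) (h : c.pair = c'.pair)
    (hne : c ≠ c') : ∑ i, c.sign i * c'.sign i = 0 := by
  cases c <;> cases c' <;>
    simp only [Label.Range, Label.pair, Prod.mk.injEq] at hc hc' h <;>
    -- The alternatives are labels of different families, different kinds in one family, and the
    -- same kind, where equal pairs make the labels equal.
    first
    | (exfalso; omega)
    | (rw [Fin.sum_univ_eight]; rfl)
    | exact absurd (by congr 1 <;> omega) hne

theorem exists_nat_or_neg (ℓ : ℤ) : (∃ a : ℕ, ℓ = a) ∨ ∃ a : ℕ, 0 < a ∧ ℓ = -a := by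
  rcases le_or_gt 0 ℓ with h | h
  · exact .inl ⟨ℓ.toNat, by omega⟩
  · exact .inr ⟨(-ℓ).toNat, by omega, by omega⟩

theorem continuous_Psi (k : ℕ) (ℓ m : ℤ) : Continuous (Psi k ℓ m) := by
  have hre : ∀ d ℓ m, Continuous fun p : S3 => (mode d ℓ m p).re := fun d ℓ m =>
    Complex.continuous_re.comp (continuous_mode d ℓ m)
  have him : ∀ d ℓ m, Continuous fun p : S3 => (mode d ℓ m p).im := fun d ℓ m =>
    Complex.continuous_im.comp (continuous_mode d ℓ m)
  obtain ⟨a, rfl⟩ | ⟨a, ha, rfl⟩ := exists_nat_or_neg ℓ <;>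
    obtain ⟨b, rfl⟩ | ⟨b, hb, rfl⟩ := exists_nat_or_neg m
  · rw [funext fun p => Psi_nat_nat k a b p]
    exact ((hre _ _ _).add (hre _ _ _)).div_const _
  · rw [funext fun p => Psi_nat_neg k a b hb p]
    exact ((him _ _ _).sub (him _ _ _)).div_const _
  · rw [funext fun p => Psi_neg_nat k a b ha p]
    exact ((him _ _ _).add (him _ _ _)).div_const _
  · rw [funext fun p => Psi_neg_neg k a b ha hb p]
    exact ((hre _ _ _).sub (hre _ _ _)).div_const _

theorem continuous_vec (k : ℕ) (c : Label) : Continuous (c.vec k) := by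
  rw [funext fun p => vec_eq_sum k c p]
  exact continuous_finsetSum _ fun i _ => continuous_const.mul (continuous_Psi _ _ _)

theorem integral_vec_mul_vec_eq_sum {n k : ℕ} {c c' : Label} (hc : c.Cond n k)
    (hc' : c'.Cond n k) : ∫ p, c.vec k p * c'.vec k p ∂sphereMeasure =
      c.scale * c'.scale * ∑ i, ∑ j, (c.sign i * c'.sign j : ℝ) *
        if signedPairs c.pair i = signedPairs c'.pair j then 1 else 0 := by
  have e : ∀ p, c.vec k p * c'.vec k p = ∑ i, ∑ j,
      (c.scale * c.sign i * (c'.scale * c'.sign j)) *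
        (Psi k (signedPairs c.pair i).1 (signedPairs c.pair i).2 p *
          Psi k (signedPairs c'.pair j).1 (signedPairs c'.pair j).2 p) := fun p => by
    rw [vec_eq_sum, vec_eq_sum, Finset.sum_mul_sum]
    exact Finset.sum_congr rfl fun i _ => Finset.sum_congr rfl fun j _ => by ring
  have hi : ∀ i j, Integrable (fun p => (c.scale * c.sign i * (c'.scale * c'.sign j)) *
        (Psi k (signedPairs c.pair i).1 (signedPairs c.pair i).2 p *
          Psi k (signedPairs c'.pair j).1 (signedPairs c'.pair j).2 p)) sphereMeasure := fun i j =>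
    integrable_of_continuous (continuous_const.mul ((continuous_Psi _ _ _).mul (continuous_Psi _ _ _)))
  simp only [e]
  rw [integral_finsetSum _ fun i _ => integrable_finsetSum _ fun j _ => hi i j, Finset.mul_sum]
  refine Finset.sum_congr rfl fun i _ => ?_
  rw [integral_finsetSum _ fun j _ => hi i j, Finset.mul_sum]
  refine Finset.sum_congr rfl fun j _ => ?_
  rw [integral_const_mul, integral_Psi_mul_Psi (modeExists_signedPairs hc.modeExists i)
    (modeExists_signedPairs hc'.modeExists j)]
  simp only [Prod.ext_iff]
  ring

open Classical in
/-- The basis vectors are orthonormal. -/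
theorem integral_vec_mul_vec {n k : ℕ} {c c' : Label} (hc : c.Cond n k) (hc' : c'.Cond n k) :
    ∫ p, c.vec k p * c'.vec k p ∂sphereMeasure = if c = c' then 1 else 0 := by
  rw [integral_vec_mul_vec_eq_sum hc hc']
  by_cases hp : c.pair = c'.pair
  · have e : ∑ i, ∑ j, (c.sign i * c'.sign j : ℝ) *
        (if signedPairs c.pair i = signedPairs c'.pair j then 1 else 0) =
        ((∑ i, c.sign i * c'.sign i : ℤ) : ℝ) := by
      push_cast
      refine Finset.sum_congr rfl fun i _ => ?_
      rw [Finset.sum_eq_single i, if_pos (by rw [hp]), mul_one]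
      · intro j _ hji
        by_cases h1 : c.sign i = 0
        · simp [h1]
        by_cases h2 : c'.sign j = 0
        · simp [h2]
        rw [if_neg, mul_zero]
        intro h3
        have hj := relevantIndex_of_sign_ne_zero hc'.range h2
        rw [← hp] at h3 hj
        exact hji (signedPairs_injOn hc.range.pair_le
          (relevantIndex_of_sign_ne_zero hc.range h1) hj h3).symm
      · simp
    rw [e]
    split_ifs with hcc
    · subst hcc
      exact sum_sign_mul_self c
    · rw [sum_sign_mul hc.range hc'.range hp hcc, Int.cast_zero, mul_zero]
  · rw [if_neg fun h => hp (congrArg Label.pair h)]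
    refine mul_eq_zero_of_right _ (Finset.sum_eq_zero fun i _ => Finset.sum_eq_zero fun j _ => ?_)
    rw [if_neg fun h3 => hp (pair_eq_of_signedPairs_eq hc.range.pair_le hc'.range.pair_le h3),
      mul_zero]

/-- Only finitely many labels satisfy the conditions for a given wave number. -/
theorem finite_cond (n k : ℕ) : {c : Label | c.Cond n k}.Finite := by
  have h : (Label.pair ⁻¹' (Iic (k, k))).Finite := by
    -- Existence of the mode bounds both frequencies by `k`, and only finitely many kinds of label
    -- share a given pair.
    refine (finite_Iic (k, k)).preimage' fun q _ => ?_
    obtain ⟨ℓ, m⟩ := q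
    refine (Set.toFinite {Label.zero, .axisEven₁ ℓ, .axisEven₂ ℓ, .axisOdd₁ ℓ, .axisOdd₂ ℓ,
      .diag₁ ℓ, .diag₂ ℓ, .diag₃ ℓ, .diag₄ ℓ, .samePos₁ ℓ m, .samePos₂ ℓ m, .sameNeg₁ ℓ m,
      .sameNeg₂ ℓ m, .oppPos₁ ℓ m, .oppPos₂ ℓ m, .oppNeg₁ ℓ m, .oppNeg₂ ℓ m}).subset ?_
    intro c hc
    cases c <;> simp [Label.pair] at hc <;> simp [hc]
  refine h.subset fun c (hc : c.Cond n k) => ?_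
  have := hc.modeExists.add_eq
  simp only [Int.natAbs_natCast] at this
  exact ⟨by show c.pair.1 ≤ k; omega, by show c.pair.2 ≤ k; omega⟩

/-! ### The eigenspaces -/

/-- Otherwise `f` would be orthogonal to every mode, by symmetry of the Laplacian, and hence zero by
totality. -/
theorem exists_eigenvalue_eq {f : S3 → ℝ} (hf : ContMDiff (𝓡 3) 𝓘(ℝ, ℝ) ∞ f) (h0 : f ≠ 0)
    {lam : ℝ} (hl : ∀ p, sphereLaplacian f p = lam * f p) :
    ∃ k : ℕ, lam = -((k : ℝ) * (k + 2)) := by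
  by_contra! h
  exact h0 (eq_zero_of_integral_mode_eq_zero hf.continuous fun d ℓ m =>
    modeIntegral_eq_zero_of_eigenvalue_ne hf hl rfl (h _))

theorem modeIntegral_sub {f g : S3 → ℝ} (hf : Continuous f) (hg : Continuous g) (d : ℕ) (ℓ m : ℤ) :
    modeIntegral (f - g) d ℓ m = modeIntegral f d ℓ m - modeIntegral g d ℓ m := by
  have hi : ∀ {f : S3 → ℝ}, Continuous f →
      Integrable (fun p : S3 => (f p : ℂ) * mode d ℓ m p) sphereMeasure := fun hf =>
    integrable_of_continuous ((Complex.continuous_ofReal.comp hf).mul (continuous_mode d ℓ m) :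
      Continuous fun p : S3 => (_ : ℂ) * mode d ℓ m p)
  rw [modeIntegral, modeIntegral, modeIntegral, ← integral_sub (hi hf) (hi hg)]
  simp only [Pi.sub_apply, Complex.ofReal_sub, sub_mul]

theorem integrable_mul_vec {f : S3 → ℝ} (hf : Continuous f) (k : ℕ) (c : Label) :
    Integrable (fun p => f p * c.vec k p) sphereMeasure :=
  integrable_of_continuous (hf.mul (continuous_vec k c))

/-- The orthogonal projection to the span of the basis vectors with wave number `k`. -/
def projection (n k : ℕ) (f : S3 → ℝ) : S3 → ℝ :=
  ∑ c ∈ (finite_cond n k).toFinset, (∫ p, f p * c.vec k p ∂sphereMeasure) • c.vec k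

theorem projection_mem_sphericalHarmonics (n k : ℕ) (f : S3 → ℝ) :
    projection n k f ∈ sphericalHarmonics k :=
  Submodule.sum_mem _ fun c hc =>
    Submodule.smul_mem _ _ (c.vec_mem_sphericalHarmonics ((finite_cond n k).mem_toFinset.mp hc))

theorem integral_projection_mul_vec {n k : ℕ} (f : S3 → ℝ) {c : Label} (hc : c.Cond n k) :
    ∫ p, projection n k f p * c.vec k p ∂sphereMeasure = ∫ p, f p * c.vec k p ∂sphereMeasure := by
  have e : ∀ p, projection n k f p * c.vec k p = ∑ c' ∈ (finite_cond n k).toFinset,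
      (∫ p, f p * c'.vec k p ∂sphereMeasure) * (c'.vec k p * c.vec k p) := fun p => by
    simp only [projection, Finset.sum_apply, Pi.smul_apply, smul_eq_mul, Finset.sum_mul, mul_assoc]
  simp only [e]
  rw [integral_finsetSum _ fun c' _ =>
    (integrable_mul_vec (continuous_vec k c') k c).const_mul _, Finset.sum_eq_single c]
  · rw [integral_const_mul, integral_vec_mul_vec hc hc, if_pos rfl, mul_one]
  · intro c' hc' hne
    rw [integral_const_mul, integral_vec_mul_vec ((finite_cond n k).mem_toFinset.mp hc') hc,
      if_neg hne, mul_zero]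
  · exact fun h => absurd ((finite_cond n k).mem_toFinset.mpr hc) h

theorem projection_sphereMap {n k : ℕ} (hn : 1 ≤ n) (f : S3 → ℝ) {g : E4 ≃ₗᵢ[ℝ] E4}
    (hg : g ∈ binaryDihedral n) (p : S3) :
    projection n k f (sphereMap g p) = projection n k f p := by
  simp only [projection, Finset.sum_apply, Pi.smul_apply]
  refine Finset.sum_congr rfl fun c hc => ?_
  obtain ⟨F, hF⟩ := c.exists_lift_eq_vec hn ((finite_cond n k).mem_toFinset.mp hc)
  rw [← hF, lift_sphereMap F hg]

/-- An invariant eigenfunction is a combination of the basis vectors. -/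
theorem projection_lift_eq {n k : ℕ} (hn : 1 ≤ n) {f : PrismSpace n → ℝ}
    (hf : IsEigenfunction n (-((k : ℝ) * (k + 2))) f) : projection n k (lift f) = lift f := by
  obtain ⟨hs, hl⟩ := hf
  have hP := projection_mem_sphericalHarmonics n k (lift f)
  have hPs := contMDiff_of_mem_sphericalHarmonics hP
  have hinv : ∀ g ∈ binaryDihedral n, ∀ p, (lift f - projection n k (lift f)) (sphereMap g p) =
      (lift f - projection n k (lift f)) p := fun g hg p => by
    simp only [Pi.sub_apply, lift_sphereMap f hg, projection_sphereMap hn _ hg]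
  have H : OrthogonalToBasis n k (lift f - projection n k (lift f)) :=
    { continuous := hs.continuous.sub hPs.continuous
      corkscrew := hinv _ (Subgroup.subset_closure (by simp))
      quarterTurn := hinv _ (Subgroup.subset_closure (by simp))
      orthogonal := fun c hc => by
        simp only [Pi.sub_apply, sub_mul]
        rw [integral_sub (integrable_mul_vec hs.continuous k c)
          (integrable_mul_vec hPs.continuous k c),
          integral_projection_mul_vec _ hc, sub_self] }
  refine (sub_eq_zero.mp (eq_zero_of_integral_mode_eq_zero H.continuous fun d ℓ m => ?_)).symm
  change modeIntegral _ d ℓ m = 0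
  -- Modes of degree `k` are handled by invariance and orthogonality to the basis, those of other
  -- degrees by the eigenvalue, separately for the function and its projection.
  by_cases hk : ℓ.natAbs + m.natAbs + 2 * d = k
  · obtain ⟨he, rfl⟩ := modeExists_of_degree hk
    exact H.modeIntegral_eq_zero hn he
  · have hne : -((k : ℝ) * (k + 2)) ≠
        -(((ℓ.natAbs + m.natAbs + 2 * d : ℕ) : ℝ) * ((ℓ.natAbs + m.natAbs + 2 * d : ℕ) + 2)) :=
      fun h => hk (eigenvalue_injective h).symm
    rw [modeIntegral_sub hs.continuous hPs.continuous,
      modeIntegral_eq_zero_of_eigenvalue_ne hs hl rfl hne,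
      modeIntegral_eq_zero_of_eigenvalue_ne hPs (sphereLaplacian_of_mem_sphericalHarmonics hP) rfl
        hne, sub_zero]

theorem isEigenfunction_of_lift_mem {n k : ℕ} {f : PrismSpace n → ℝ}
    (h : lift f ∈ sphericalHarmonics k) : IsEigenfunction n (-((k : ℝ) * (k + 2))) f :=
  ⟨contMDiff_of_mem_sphericalHarmonics h, sphereLaplacian_of_mem_sphericalHarmonics h⟩

/-- The lift of functions as a linear map. -/
def liftLinear (n : ℕ) : (PrismSpace n → ℝ) →ₗ[ℝ] S3 → ℝ where
  toFun := lift
  map_add' _ _ := rfl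
  map_smul' _ _ := rfl

/-- The basis vectors are spherical harmonics, which gives one inclusion; conversely an invariant
eigenfunction equals its own projection, an explicit finite combination of them. -/
theorem span_range_eq {n k : ℕ} (hn : 1 ≤ n) {b : {c : Label // c.Cond n k} → PrismSpace n → ℝ}
    (hb : ∀ c, lift (b c) = c.1.vec k) :
    (Submodule.span ℝ (range b) : Set (PrismSpace n → ℝ)) =
      {f | IsEigenfunction n (-((k : ℝ) * (k + 2))) f} := by
  refine Subset.antisymm (fun f hf => ?_) fun f hf => ?_
  · have hle : Submodule.span ℝ (range b) ≤ (sphericalHarmonics k).comap (liftLinear n) := by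
      rw [Submodule.span_le]
      rintro _ ⟨c, rfl⟩
      show lift (b c) ∈ sphericalHarmonics k
      rw [hb]
      exact c.1.vec_mem_sphericalHarmonics c.2
    exact isEigenfunction_of_lift_mem (hle hf)
  · have hmem : lift f ∈ (Submodule.span ℝ (range b)).map (liftLinear n) := by
      rw [← projection_lift_eq hn hf]
      refine Submodule.sum_mem _ fun c hc => Submodule.smul_mem _ _ ?_
      rw [← hb ⟨c, (finite_cond n k).mem_toFinset.mp hc⟩]
      exact Submodule.mem_map_of_mem (f := liftLinear n) (Submodule.subset_span ⟨_, rfl⟩)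
    obtain ⟨g, hg, e⟩ := hmem
    rwa [← lift_injective e]

end Prism

end

theorem theorem3 (n : ℕ) (hn : 1 ≤ n) :
    (∀ (lam : ℝ) (f : Prism.PrismSpace n → ℝ), f ≠ 0 → Prism.IsEigenfunction n lam f →
      ∃ k : ℕ, lam = -((k : ℝ) * ((k : ℝ) + 2))) ∧
    ∀ k : ℕ, ∃ b : {c : Prism.Label // c.Cond n k} → (Prism.PrismSpace n → ℝ),
      (∀ c, Prism.lift (b c) = c.1.vec k) ∧
      (∀ c, Prism.sphereInner (Prism.lift (b c)) (Prism.lift (b c)) = 1) ∧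
      (∀ c c', c ≠ c' → Prism.sphereInner (Prism.lift (b c)) (Prism.lift (b c')) = 0) ∧
      (Submodule.span ℝ (Set.range b) : Set (Prism.PrismSpace n → ℝ)) =
        {f | Prism.IsEigenfunction n (-((k : ℝ) * ((k : ℝ) + 2))) f} := by
  refine ⟨fun lam f h0 hf => ?_, fun k => ?_⟩
  · exact Prism.exists_eigenvalue_eq hf.1 (fun h => h0 (Prism.lift_injective h)) hf.2
  · choose b hb using fun c : {c : Prism.Label // c.Cond n k} =>
      c.1.exists_lift_eq_vec hn c.2
    refine ⟨b, hb, fun c => ?_, fun c c' hne => ?_, Prism.span_range_eq hn hb⟩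
    · rw [hb]
      exact (Prism.integral_vec_mul_vec c.2 c.2).trans (if_pos rfl)
    · rw [hb, hb]
      exact (Prism.integral_vec_mul_vec c.2 c'.2).trans (if_neg fun h => hne (Subtype.ext h))
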